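/- **Setting.** Let $k$ be an algebraically closed field of characteristic $p>0$, let $K_0=\operatorname{Frac}(W(k))$, and let $K_n=K_0(\zeta_{p^n})$, where $\zeta_{p^n}$ is a primitive $p^n$-th root of unity in a fixed algebraic closure of $K_0$. For a finite extension $L/K_0$ let $v_L$ be its valuation, normalized so that uniformizers have valuation $1$ and $v_L(0)=\infty$; write $v_\ell=v_{K_\ell}$. For a finite Galois extension $L/K_0$ with group $G$, the lower ramification groups are $G_i=\{g\in G: v_L(g\pi_L-\pi_L)\ge i+1\}$ for real $i\ge 0$ ($\pi_L$ a uniformizer of $L$), the upper ones are $G^i=G_{\psi(i)}$, where $\psi$ is the inverse of the function $\varphi(u)=\int_0^u \frac{dt}{[G_0:G_t]}$ on $[0,\infty)$, and the conductor is $h_{L/K_0}=\sup\{i\ge 0: G^i\ne\{\mathrm{id}\}\}$ (with $h_{L/K_0}=0$ if $L=K_0$). A nonzero element $a=1+t\in K_\ell$ is called *$p$-primitive for $K_\ell$* if either $p\nmid v_\ell(a)$, or $0<v_\ell(t)<\frac{p}{p-1}v_\ell(p)$ and $p\nmid v_\ell(t)$. **Statement.** Let $\ell\ge 1$ and $c\ge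 1$ be integers and let $\alpha\in K_\ell$ with $v_\ell(\alpha)\ge 0$ (not necessarily $p$-primitive). Then $\alpha$ can be written as $\alpha=\alpha'\beta^p$ with $\alpha',\beta\in K_\ell$, $v_\ell(\beta)\ge 0$, and $\alpha'$ either equal to $1$ or $p$-primitive for $K_\ell$. For every such decomposition, write $\alpha'=1+t_{\alpha'}$ and $\beta=1+t_\beta$, and let $L$ be the Galois closure of $K_{\max(\ell,c)}(\sqrt[p^c]{\alpha})$ over $K_0$ (for any choice of the root). Then $$h_{L/K_0}\le \max\left(\max(\ell,c)-1,\;\; c+\ell-1-\frac{v_\ell(t_{\alpha'})-1}{p^{\ell-1}(p-1)},\;\; c+\ell-2-\frac{v_\ell(t_\beta)-1}{p^{\ell-1}(p-1)}\right),$$ where a term containing $v_\ell(0)=\infty$ is read as $-\infty$. -/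

import Mathlib

namespace WittKummer

/-! ### The base field `K₀ = Frac W(k)` and normalized valuations -/

/-- The field `K₀ = Frac(W(k))`. -/
abbrev K₀ (p : ℕ) [Fact p.Prime] (k : Type*) [Field k] [CharP k p] : Type _ :=
  FractionRing (WittVector p k)

theorem charZero_K₀ (p : ℕ) [Fact p.Prime] (k : Type*) [Field k] [CharP k p] :
    CharZero (K₀ p k) := by
  have h0 : (p : WittVector p k) ≠ 0 := WittVector.p_nonzero p k
  have : CharZero (WittVector p k) := by
    refine charZero_of_inj_zero fun n hn => ?_
    induction n using Nat.strong_induction_on with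
    | _ n ih =>
      by_contra hn0
      have hc : ((n : ℕ) : k) = 0 := by
        have := congrArg (WittVector.constantCoeff (p := p) (R := k)) hn
        simpa using this
      obtain ⟨m, rfl⟩ := (CharP.cast_eq_zero_iff k p n).1 hc
      have hm : (m : WittVector p k) = 0 := by
        have : (p : WittVector p k) * (m : WittVector p k) = 0 := by exact_mod_cast hn
        exact (mul_eq_zero.1 this).resolve_left h0
      have hm0 : m ≠ 0 := by rintro rfl; simp at hn0
      exact hm0 (ih m (by
        have := (Fact.out : p.Prime).two_le
        nlinarith [Nat.pos_of_ne_zero hm0]) hm)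
  exact charZero_of_injective_algebraMap (IsFractionRing.injective (WittVector p k) (K₀ p k))

/-- `v : L → ℤ ∪ {∞}` is a normalized discrete valuation on the extension `L` of `K₀`:
it is surjective (uniformizers have valuation `1`) and nonnegative on the image of `W(k)`.
For `L / K₀` finite there is exactly one such `v`. -/
def IsNormalizedVal (p : ℕ) [Fact p.Prime] (k : Type*) [Field k] [CharP k p]
    {L : Type*} [Field L] [Algebra (K₀ p k) L] (v : AddValuation L (WithTop ℤ)) : Prop :=
  Function.Surjective v ∧
    ∀ a : WittVector p k,
      0 ≤ v (algebraMap (K₀ p k) L (algebraMap (WittVector p k) (K₀ p k) a))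

/-- Rewriting a multiplicative `ℤᵐ⁰`-valued valuation additively. -/
theorem exists_addValuation {L : Type*} [Field L]
    (w : Valuation L (WithZero (Multiplicative ℤ))) :
    ∃ v : AddValuation L (WithTop ℤ), ∀ x, v x = if w x = 0 then ⊤ else
      ((-WithZero.log (w x) : ℤ) : WithTop ℤ) := by
  refine ⟨AddValuation.of (fun x => if w x = 0 then ⊤ else
      ((-WithZero.log (w x) : ℤ) : WithTop ℤ)) (by simp) (by simp) ?_ ?_, fun x => rfl⟩
  · intro x y
    by_cases hxy : w (x + y) = 0
    · simp [hxy]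
    by_cases hx : w x = 0
    · have hx' : x = 0 := by simpa using hx
      rw [hx', map_zero, zero_add]; simp
    by_cases hy : w y = 0
    · have hy' : y = 0 := by simpa using hy
      rw [hy', map_zero, add_zero]; simp
    simp only [hx, hy, hxy, if_false]
    rw [min_le_iff]
    rcases le_max_iff.1 (w.map_add x y) with h | h
    · left
      exact_mod_cast neg_le_neg ((WithZero.log_le_log hxy hx).2 h)
    · right
      exact_mod_cast neg_le_neg ((WithZero.log_le_log hxy hy).2 h)
  · intro x y
    by_cases hx : w x = 0
    · simp [hx]
    by_cases hy : w y = 0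
    · simp [hy]
    simp only [map_mul, hx, hy, mul_eq_zero, or_self, if_false]
    rw [WithZero.log_mul hx hy]
    rw [← WithTop.coe_add, neg_add]

theorem exists_isNormalizedVal (p : ℕ) [Fact p.Prime] (k : Type*) [Field k] [CharP k p]
    [IsAlgClosed k] (L : Type*) [Field L] [Algebra (K₀ p k) L] [FiniteDimensional (K₀ p k) L] :
    ∃ v : AddValuation L (WithTop ℤ), IsNormalizedVal p k v := by
  have := charZero_K₀ p k
  let A := WittVector p k
  let _ : Algebra A L := ((algebraMap (K₀ p k) L).comp (algebraMap A (K₀ p k))).toAlgebra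
  have : IsScalarTower A (K₀ p k) L := IsScalarTower.of_algebraMap_eq fun _ => rfl
  let B := integralClosure A L
  have : IsFractionRing B L := integralClosure.isFractionRing_of_finite_extension (K₀ p k) L
  have : IsDedekindDomain B := integralClosure.isDedekindDomain A (K₀ p k) L
  have hB : ¬ IsField B := by
    intro h
    have hinj : Function.Injective (algebraMap A B) := by
      have : Function.Injective (algebraMap A L) :=
        (algebraMap (K₀ p k) L).injective.comp (IsFractionRing.injective A (K₀ p k))
      rw [IsScalarTower.algebraMap_eq A B L] at this
      exact Function.Injective.of_comp (f := algebraMap B L) (by simpa using this)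
    exact IsDiscreteValuationRing.not_isField A (isField_of_isIntegral_of_isField hinj h)
  obtain ⟨M, hM⟩ := Ideal.exists_maximal B
  let P : IsDedekindDomain.HeightOneSpectrum B :=
    ⟨M, hM.isPrime, Ring.ne_bot_of_isMaximal_of_not_isField hM hB⟩
  obtain ⟨v, hv⟩ := exists_addValuation (P.valuation L)
  refine ⟨v, ?_, ?_⟩
  · intro y
    induction y using WithTop.recTopCoe with
    | top => exact ⟨0, by simp⟩
    | coe n =>
      obtain ⟨x, hx⟩ := P.valuation_surjective L (WithZero.exp (-n))
      refine ⟨x, ?_⟩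
      rw [hv, hx]
      simp
  · intro a
    have h1 : P.valuation L (algebraMap (K₀ p k) L (algebraMap A (K₀ p k) a)) ≤ 1 := by
      exact P.valuation_le_one (K := L) (algebraMap A B a)
    rw [hv]
    split_ifs with h
    · exact le_top
    · have h2 := (WithZero.log_le_log h one_ne_zero).2 h1
      rw [WithZero.log_one] at h2
      exact_mod_cast neg_nonneg.2 h2

/-- The normalized valuation `v_L` of a finite extension `L` of `K₀` (unique, since `W(k)` is a
complete discrete valuation ring). -/
noncomputable def normVal (p : ℕ) [Fact p.Prime] (k : Type*) [Field k] [CharP k p]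
    [IsAlgClosed k] (L : Type*) [Field L] [Algebra (K₀ p k) L] [FiniteDimensional (K₀ p k) L] :
    AddValuation L (WithTop ℤ) :=
  (exists_isNormalizedVal p k L).choose

/-! ### Higher ramification filtration and conductor

`L / K` is a finite Galois extension of complete discrete valuation fields, with algebraically
closed residue field, and `v` is the normalized valuation of `L`. -/

section Ramification

variable (K : Type*) {L : Type*} [Field K] [Field L] [Algebra K L]
  (v : AddValuation L (WithTop ℤ))

/-- The `i`-th ramification group for the lower numbering (as a subset of the Galois group):
`g ∈ G_i ↔ v_L (g π - π) ≥ i + 1`, for uniformizers `π` of `L`. -/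
def lowerRam (i : ℝ) : Set (L ≃ₐ[K] L) :=
  {g | ∀ π : L, v π = 1 →
    ((i + 1 : ℝ) : WithTop ℝ) ≤ WithTop.map (fun n : ℤ => (n : ℝ)) (v (g π - π))}

/-- The Herbrand function `φ_{L/K} (u) = ∫₀ᵘ dt / [G₀ : G_t]`. -/
noncomputable def herbrandPhi (u : ℝ) : ℝ :=
  ∫ t in (0 : ℝ)..u, (Nat.card (lowerRam K v t) : ℝ) / (Nat.card (lowerRam K v 0) : ℝ)

/-- `ψ_{L/K}`, the inverse of the bijection `φ_{L/K} : [0, ∞) → [0, ∞)`. -/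
noncomputable def herbrandPsi (u : ℝ) : ℝ :=
  Function.invFunOn (herbrandPhi K v) (Set.Ici 0) u

/-- The `i`-th ramification group for the upper numbering: `G^i = G_{ψ(i)}`. -/
noncomputable def upperRam (i : ℝ) : Set (L ≃ₐ[K] L) :=
  lowerRam K v (herbrandPsi K v i)

/-- The conductor `h_{L/K} = sup {i ∈ [0, ∞) | G^i ≠ {id}}`
(equal to `0` when there is no such `i`, i.e. for the trivial extension). -/
noncomputable def conductor : ℝ :=
  sSup {i : ℝ | 0 ≤ i ∧ upperRam K v i ≠ {1}}

end Ramification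

/-- `a = 1 + t` is `p`-primitive for the field with normalized valuation `v`: either
`p ∤ v(a)` (with `a ≠ 0`), or `0 < v(t) < p/(p-1) * e` and `p ∤ v(t)`, where `e = v(p)`. -/
def IsPPrimitive (p : ℕ) {K : Type*} [Field K] (v : AddValuation K (WithTop ℤ)) (a : K) : Prop :=
  (∃ n : ℤ, v a = n ∧ ¬ (p : ℤ) ∣ n) ∨
  (∃ n e : ℤ, v (a - 1) = n ∧ v (p : K) = e ∧ 0 < n ∧
    (n : ℝ) < (p : ℝ) / ((p : ℝ) - 1) * (e : ℝ) ∧ ¬ (p : ℤ) ∣ n)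

/-! ### The fields `K_n`, `K_m(a^(1/p^c))` inside an algebraic closure `Ω` of `K₀` -/

section Fields

variable (p : ℕ) [Fact p.Prime] (k : Type*) [Field k] [CharP k p]
  (Ω : Type*) [Field Ω] [Algebra (K₀ p k) Ω]

/-- `K_n = K₀(ζ_{p^n})`, generated by the `p^n`-th roots of unity. -/
noncomputable def Kn (n : ℕ) : IntermediateField (K₀ p k) Ω :=
  IntermediateField.adjoin (K₀ p k) {ζ : Ω | ζ ^ p ^ n = 1}

theorem isIntegral_of_pow_eq_one {n : ℕ} {ζ : Ω} (hζ : ζ ^ p ^ n = 1) :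
    IsIntegral (K₀ p k) ζ := by
  refine IsIntegral.of_pow (pow_pos (Fact.out : p.Prime).pos n) ?_
  rw [hζ]
  exact isIntegral_one

instance finiteDimensional_Kn (n : ℕ) : FiniteDimensional (K₀ p k) (Kn p k Ω n) := by
  classical
  have hpos : 0 < p ^ n := pow_pos (Fact.out : p.Prime).pos n
  have : Finite {ζ : Ω | ζ ^ p ^ n = 1} := by
    refine Set.Finite.subset (Polynomial.nthRoots (p ^ n) (1 : Ω)).toFinset.finite_toSet ?_
    intro ζ hζ
    simpa [Polynomial.mem_nthRoots hpos] using hζ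
  exact IntermediateField.finiteDimensional_adjoin fun x hx =>
    isIntegral_of_pow_eq_one p k Ω hx

/-- The normalized valuation `v_n` of `K_n`. -/
noncomputable def vn [IsAlgClosed k] (n : ℕ) : AddValuation (Kn p k Ω n) (WithTop ℤ) :=
  normVal p k (Kn p k Ω n)

/-- `K_m(x)` for `x ∈ Ω`. -/
noncomputable def KnAdjoin (m : ℕ) (x : Ω) : IntermediateField (K₀ p k) Ω :=
  Kn p k Ω m ⊔ IntermediateField.adjoin (K₀ p k) {x}

instance finiteDimensional_KnAdjoin [Algebra.IsAlgebraic (K₀ p k) Ω] (m : ℕ) (x : Ω) :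
    FiniteDimensional (K₀ p k) (KnAdjoin p k Ω m x) := by
  have : FiniteDimensional (K₀ p k) (IntermediateField.adjoin (K₀ p k) {x}) :=
    IntermediateField.adjoin.finiteDimensional (Algebra.IsIntegral.isIntegral x)
  unfold KnAdjoin
  infer_instance

/-- The Galois closure of `K_m(x)` over `K₀` (inside the algebraic closure `Ω`). -/
noncomputable def galoisClosure (m : ℕ) (x : Ω) : IntermediateField (K₀ p k) Ω :=
  IntermediateField.normalClosure (K₀ p k) (KnAdjoin p k Ω m x) Ω

instance finiteDimensional_galoisClosure [Algebra.IsAlgebraic (K₀ p k) Ω] (m : ℕ) (x : Ω) :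
    FiniteDimensional (K₀ p k) (galoisClosure p k Ω m x) := by
  unfold galoisClosure
  infer_instance

end Fields

/-- The quantity `b - (v - 1) / (p^(ℓ-1) (p-1))` for `v ∈ ℤ ∪ {∞}`; it is `-∞` when `v = ∞`. -/
noncomputable def boundTerm (p ℓ : ℕ) (b : ℝ) : WithTop ℤ → WithBot ℝ
  | ⊤ => ⊥
  | (n : ℤ) => ((b - ((n : ℝ) - 1) / ((p : ℝ) ^ (ℓ - 1) * ((p : ℝ) - 1)) : ℝ) : WithBot ℝ)

end WittKummer

namespace WittKummer
open Polynomial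

/-! ### Integer lower bounds for `ℤ ∪ {∞}`-valued valuations -/

/-! Let `v` be the valuation of the Galois closure L, π a uniformizer, i(g) = v(gπ - π), and e =
v(p) = [L : K₀], all extensions being totally ramified. Suppose the conductor exceeds the maximum B
of the three terms, and let i₀ be the largest finite value of i. Integrating the ramification step
functions gives D := ∑_g min(i₀, i(g)) > (B + 1)e (`exists_ramification_of_lt_conductor`). The
contradiction is that H = {h : i(h) ≥ i₀} turns out to be trivial, although it contains an element
with i = i₀.

Let `w` be the Gauss valuation on L[X] of the disc of radius i₀ about π (`isGenericPoint_discVal`).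
It equals D at ∏_g (X - gπ), so every W(k)-polynomial vanishing at π has w ≥ D: replacing π by X
turns identities in L into congruences in L[X] of precision governed by D. Moreover H preserves the
disc, so `w` is invariant under H acting on coefficients, while polynomials over W(k) are fixed.
Hence if such a polynomial lies within b of a constant a, then v(ha - a) ≥ b for h in H
(`val_sub_algEquiv_of_close`). Krasner's argument (`exists_close_root`) finds such constants among
the roots of an equation, and H fixes them once b exceeds the distances between roots.

Put ε = e/(p - 1), the valuation of ζ_p - 1. For p^m-th roots of unity the method needs only D > me;
this is the first term of the bound. For a p^c-th root of α = α'β^p, elements of K_ℓ are lifted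
through their expansion in ζ - 1, with relative precision κ = D - ℓe + ε - N, where ζ is a primitive
p^ℓ-th root of unity and N = v(ζ - 1). The root requires relative precision above ce + ε. The
decomposition improves what is available: the error in α' is measured relative to α' - 1, a gain of
N·v_ℓ(α' - 1); the error in β is measured relative to β - 1, and raising to the p-th power gains a
further e (`exists_approx_root_mul`). Since e = p^(ℓ-1)(p - 1)N, the resulting inequalities are the
other two terms of the bound. Only a conjugate of the root is shown to be fixed
(`exists_algEquiv_root_fixed`), but H is normal, so it fixes K_max(x) and then its whole normal
closure.

The decomposition itself exists because k is closed under p-th roots, which allows p-th powers to be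
stripped off one valuation at a time, and because 1 + t is a p-th power once v(t) ≥ pe/(p - 1)
(`exists_mul_pow_of_close`, `exists_pow_eq_one_add`). -/

theorem int_lt_iff {a : ℤ} {x : WithTop ℤ} :
    (a : WithTop ℤ) < x ↔ ((a + 1 : ℤ) : WithTop ℤ) ≤ x := by
  induction x using WithTop.recTopCoe with
  | top => simp
  | coe n => norm_cast

/-- Equalities of Gauss valuations are checked through integer lower bounds, since such a bound on a
minimum splits into conditions on the single coefficients. -/
theorem eq_of_forall_int_le {x y : WithTop ℤ}
    (h : ∀ a : ℤ, (a : WithTop ℤ) ≤ x ↔ (a : WithTop ℤ) ≤ y) : x = y := by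
  induction x using WithTop.recTopCoe with
  | top =>
    induction y using WithTop.recTopCoe with
    | top => rfl
    | coe n => have := (h (n + 1)).1 le_top; norm_cast at this; omega
  | coe m =>
    induction y using WithTop.recTopCoe with
    | top => have := (h (m + 1)).2 le_top; norm_cast at this; omega
    | coe n =>
      have h1 := (h m).1 le_rfl
      have h2 := (h n).2 le_rfl
      norm_cast at h1 h2 ⊢
      omega

theorem int_le_mono {a b : ℤ} {x : WithTop ℤ} (hb : (b : WithTop ℤ) ≤ x) (hab : a ≤ b) :
    (a : WithTop ℤ) ≤ x :=
  (WithTop.coe_le_coe.2 hab).trans hb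

theorem int_le_add {a b : ℤ} {x y : WithTop ℤ} (hx : (a : WithTop ℤ) ≤ x)
    (hy : (b : WithTop ℤ) ≤ y) : ((a + b : ℤ) : WithTop ℤ) ≤ x + y := by
  rw [WithTop.coe_add]; exact add_le_add hx hy

theorem int_le_add_coe {a b : ℤ} {x : WithTop ℤ} :
    (a : WithTop ℤ) ≤ x + (b : WithTop ℤ) ↔ ((a - b : ℤ) : WithTop ℤ) ≤ x := by
  induction x using WithTop.recTopCoe with
  | top => simp
  | coe n => norm_cast; omega

section AddVal

variable {R : Type*} [CommRing R] (v : AddValuation R (WithTop ℤ))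

theorem le_map_mul {a b : ℤ} {x y : R} (hx : (a : WithTop ℤ) ≤ v x)
    (hy : (b : WithTop ℤ) ≤ v y) : ((a + b : ℤ) : WithTop ℤ) ≤ v (x * y) := by
  rw [v.map_mul]; exact int_le_add hx hy

theorem le_map_pow {a : ℤ} {x : R} (hx : (a : WithTop ℤ) ≤ v x) (n : ℕ) :
    ((n * a : ℤ) : WithTop ℤ) ≤ v (x ^ n) := by
  induction n with
  | zero => simp
  | succ n ih =>
    rw [pow_succ]
    exact int_le_mono (le_map_mul v ih hx) (by push_cast; linarith)

theorem map_pow_coe {a : ℤ} {x : R} (hx : v x = a) (n : ℕ) :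
    v (x ^ n) = ((n * a : ℤ) : WithTop ℤ) := by
  induction n with
  | zero => simp
  | succ n ih =>
    rw [pow_succ, v.map_mul, ih, hx, ← WithTop.coe_add]
    congr 1
    push_cast; ring

theorem val_prod {ι : Type*} (s : Finset ι) (f : ι → R) :
    v (∏ i ∈ s, f i) = ∑ i ∈ s, v (f i) := by
  classical
  induction s using Finset.induction_on with
  | empty => simp
  | insert i s hi ih => rw [Finset.prod_insert hi, Finset.sum_insert hi, v.map_mul, ih]

theorem map_natCast_nonneg (n : ℕ) : 0 ≤ v (n : R) := by
  induction n with
  | zero => simp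
  | succ n ih =>
    rw [Nat.cast_succ]
    exact v.map_le_add ih (by simp)

theorem map_unit_nonneg_eq_zero {x y : R} (hxy : x * y = 1) (hx : 0 ≤ v x) (hy : 0 ≤ v y) :
    v x = 0 := by
  have h : v x + v y = 0 := by rw [← v.map_mul, hxy, v.map_one]
  refine le_antisymm ?_ hx
  calc v x ≤ v x + v y := le_add_of_nonneg_right hy
    _ = 0 := h

end AddVal

/-! ### Gauss valuations on polynomials -/

section Gauss

variable {L : Type*} [Field L] (v : AddValuation L (WithTop ℤ)) (ρ : ℤ)

/-- `min_i (v(a_i) + i ρ)` for `f = ∑ a_i X^i`. -/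
noncomputable def gaussFun (f : L[X]) : WithTop ℤ :=
  f.support.inf fun i => v (f.coeff i) + (((i : ℤ) * ρ : ℤ) : WithTop ℤ)

theorem int_le_gaussFun {a : ℤ} {f : L[X]} :
    (a : WithTop ℤ) ≤ gaussFun v ρ f ↔ ∀ i : ℕ, ((a - i * ρ : ℤ) : WithTop ℤ) ≤ v (f.coeff i) := by
  unfold gaussFun
  rw [Finset.le_inf_iff]
  refine ⟨fun h i => ?_, fun h i _ => int_le_add_coe.2 (h i)⟩
  by_cases hi : i ∈ f.support
  · exact int_le_add_coe.1 (h i hi)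
  · rw [notMem_support_iff.1 hi]; simp

theorem gaussFun_mul_le {f g : L[X]} {a b : ℤ} (hf : (a : WithTop ℤ) ≤ gaussFun v ρ f)
    (hg : (b : WithTop ℤ) ≤ gaussFun v ρ g) :
    ((a + b : ℤ) : WithTop ℤ) ≤ gaussFun v ρ (f * g) := by
  rw [int_le_gaussFun] at *
  intro i
  rw [coeff_mul]
  refine v.map_le_sum fun x hx => ?_
  refine int_le_mono (le_map_mul v (hf x.1) (hg x.2)) (le_of_eq ?_)
  rw [← Finset.HasAntidiagonal.mem_antidiagonal.1 hx]; push_cast; ring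

/-- The first index at which the minimum is attained, as required for the proof of Gauss's lemma. -/
theorem exists_gaussFun_coeff {f : L[X]} {a : ℤ} (hf : gaussFun v ρ f = a) :
    ∃ i : ℕ, v (f.coeff i) = ((a - i * ρ : ℤ) : WithTop ℤ) ∧
      ∀ j < i, ((a + 1 - j * ρ : ℤ) : WithTop ℤ) ≤ v (f.coeff j) := by
  classical
  have h1 := (int_le_gaussFun v ρ).1 hf.ge
  have hex : ∃ i : ℕ, ¬ ((a + 1 - i * ρ : ℤ) : WithTop ℤ) ≤ v (f.coeff i) := by
    by_contra! h
    have := (int_le_gaussFun v ρ).2 h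
    rw [hf] at this
    norm_cast at this; omega
  refine ⟨Nat.find hex, le_antisymm ?_ (h1 _), fun j hj => ?_⟩
  · have := Nat.find_spec hex
    rw [add_sub_right_comm, ← int_lt_iff, not_lt] at this
    exact this
  · by_contra h
    exact Nat.find_min hex hj h

/-- Gauss's lemma. If i and j are the first indices where f and g attain their minima, then the
coefficient of degree i + j of the product has exactly one summand of minimal valuation, so no
cancellation occurs. -/
theorem gaussFun_mul (f g : L[X]) : gaussFun v ρ (f * g) = gaussFun v ρ f + gaussFun v ρ g := by
  classical
  rcases hf : gaussFun v ρ f with _ | a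
  · have : f = 0 := by
      by_contra h0
      obtain ⟨i, hi⟩ := nonempty_support_iff.2 h0
      have h2 : v (f.coeff i) + (((i : ℤ) * ρ : ℤ) : WithTop ℤ) = ⊤ :=
        top_le_iff.1 ((hf.symm.le).trans (Finset.inf_le hi))
      rw [WithTop.add_eq_top] at h2
      rcases h2 with h2 | h2
      · exact mem_support_iff.1 hi (v.top_iff.1 h2)
      · exact WithTop.coe_ne_top h2
    subst this
    change _ = ⊤ + _
    rw [zero_mul, top_add]; exact hf
  rcases hg : gaussFun v ρ g with _ | b
  · have : g = 0 := by
      by_contra h0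
      obtain ⟨i, hi⟩ := nonempty_support_iff.2 h0
      have h2 : v (g.coeff i) + (((i : ℤ) * ρ : ℤ) : WithTop ℤ) = ⊤ :=
        top_le_iff.1 ((hg.symm.le).trans (Finset.inf_le hi))
      rw [WithTop.add_eq_top] at h2
      rcases h2 with h2 | h2
      · exact mem_support_iff.1 hi (v.top_iff.1 h2)
      · exact WithTop.coe_ne_top h2
    subst this
    change _ = (a : WithTop ℤ) + ⊤
    rw [mul_zero, WithTop.add_top]; exact hg
  change gaussFun v ρ f = (a : WithTop ℤ) at hf
  change gaussFun v ρ g = (b : WithTop ℤ) at hg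
  change _ = (a : WithTop ℤ) + (b : WithTop ℤ)
  rw [← WithTop.coe_add]
  refine le_antisymm ?_ (gaussFun_mul_le v ρ hf.ge hg.ge)
  by_contra hcon
  rw [not_le, int_lt_iff, int_le_gaussFun] at hcon
  obtain ⟨i, hi, hi'⟩ := exists_gaussFun_coeff v ρ hf
  obtain ⟨j, hj, hj'⟩ := exists_gaussFun_coeff v ρ hg
  have h1 := (int_le_gaussFun v ρ).1 hf.ge
  have h2 := (int_le_gaussFun v ρ).1 hg.ge
  have h := hcon (i + j)
  have hmem : (i, j) ∈ Finset.HasAntidiagonal.antidiagonal (i + j) := by simp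
  rw [coeff_mul, ← Finset.add_sum_erase _ _ hmem] at h
  -- Every other pair on the antidiagonal has first index below i or second index below j, and one
  -- of the two strict bounds applies.
  have hrest : ((a + b + 1 - ((i + j : ℕ) : ℤ) * ρ : ℤ) : WithTop ℤ) ≤
      v (∑ x ∈ (Finset.HasAntidiagonal.antidiagonal (i + j)).erase (i, j), f.coeff x.1 * g.coeff x.2) := by
    refine v.map_le_sum fun x hx => ?_
    obtain ⟨hne, hx⟩ := Finset.mem_erase.1 hx
    have hx := Finset.HasAntidiagonal.mem_antidiagonal.1 hx
    have hx2 : ((i + j : ℕ) : ℤ) = x.1 + x.2 := by rw [← hx]; push_cast; ring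
    rw [hx2]
    by_cases hlt : x.1 < i
    · exact int_le_mono (le_map_mul v (hi' _ hlt) (h2 x.2)) (le_of_eq (by ring))
    · have hlt2 : x.2 < j := by
        by_contra h3
        apply hne
        ext <;> simp only <;> omega
      exact int_le_mono (le_map_mul v (h1 x.1) (hj' _ hlt2)) (le_of_eq (by ring))
  have h3 := v.map_le_sub h hrest
  rw [add_sub_cancel_right, v.map_mul, hi, hj, ← WithTop.coe_add, WithTop.coe_le_coe] at h3
  push_cast at h3
  nlinarith

/-- The Gauss valuation of radius `ρ` centred at `0`. -/
noncomputable def gaussVal : AddValuation L[X] (WithTop ℤ) :=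
  AddValuation.of (gaussFun v ρ) (by simp [gaussFun])
    (by
      refine eq_of_forall_int_le fun a => ?_
      rw [int_le_gaussFun]
      constructor
      · intro h; simpa using h 0
      · intro h i
        rw [coeff_one]
        split_ifs with hi
        · subst hi; simpa using h
        · simp)
    (by
      intro f g
      rw [min_le_iff]
      rcases le_total (gaussFun v ρ f) (gaussFun v ρ g) with h | h
      · left
        by_contra hcon
        rw [not_le] at hcon
        obtain ⟨b, hb⟩ := WithTop.ne_top_iff_exists.1 hcon.ne_top
        rw [← hb, int_lt_iff] at hcon
        have h1 := (int_le_gaussFun v ρ).1 hcon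
        have h2 := (int_le_gaussFun v ρ).1 (hcon.trans h)
        have h3 : ((b + 1 : ℤ) : WithTop ℤ) ≤ gaussFun v ρ (f + g) := by
          rw [int_le_gaussFun]
          intro i
          rw [coeff_add]
          exact v.map_le_add (h1 i) (h2 i)
        rw [← hb] at h3
        norm_cast at h3; omega
      · right
        by_contra hcon
        rw [not_le] at hcon
        obtain ⟨b, hb⟩ := WithTop.ne_top_iff_exists.1 hcon.ne_top
        rw [← hb, int_lt_iff] at hcon
        have h1 := (int_le_gaussFun v ρ).1 hcon
        have h2 := (int_le_gaussFun v ρ).1 (hcon.trans h)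
        have h3 : ((b + 1 : ℤ) : WithTop ℤ) ≤ gaussFun v ρ (f + g) := by
          rw [int_le_gaussFun]
          intro i
          rw [coeff_add]
          exact v.map_le_add (h2 i) (h1 i)
        rw [← hb] at h3
        norm_cast at h3; omega)
    (gaussFun_mul v ρ)

theorem int_le_gaussVal {a : ℤ} {f : L[X]} :
    (a : WithTop ℤ) ≤ gaussVal v ρ f ↔ ∀ i : ℕ, ((a - i * ρ : ℤ) : WithTop ℤ) ≤ v (f.coeff i) :=
  int_le_gaussFun v ρ

theorem gaussVal_C (a : L) : gaussVal v ρ (C a) = v a := by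
  refine eq_of_forall_int_le fun n => ?_
  rw [int_le_gaussVal]
  constructor
  · intro h; simpa using h 0
  · intro h i
    rw [coeff_C]
    split_ifs with hi
    · subst hi; simpa using h
    · simp

theorem gaussVal_X_add_C (a : L) : gaussVal v ρ (X + C a) = min (ρ : WithTop ℤ) (v a) := by
  refine eq_of_forall_int_le fun n => ?_
  rw [int_le_gaussVal, le_min_iff]
  constructor
  · intro h
    have h0 := h 0
    have h1 := h 1
    simp only [coeff_add, coeff_X_zero, coeff_C_zero, zero_add, Nat.cast_zero, zero_mul, sub_zero,
      coeff_X_one, Nat.cast_one, one_mul] at h0 h1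
    rw [coeff_C_of_ne_zero one_ne_zero, add_zero, v.map_one] at h1
    refine ⟨?_, h0⟩
    norm_cast at h1 ⊢; omega
  · rintro ⟨h1, h2⟩ i
    rcases i with _ | _ | i
    · simpa using h2
    · simp only [coeff_add, zero_add, coeff_X_one]
      rw [coeff_C_of_ne_zero one_ne_zero, add_zero, v.map_one]
      norm_cast at h1 ⊢; omega
    · have : (X + C a).coeff (i + 1 + 1) = 0 := by
        rw [coeff_add, coeff_C_of_ne_zero (by omega), coeff_X_of_ne_one (by omega), add_zero]
      rw [this]; simp

/-- The Gauss valuation of radius `ρ` centred at `z`. -/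
noncomputable def discVal (z : L) : AddValuation L[X] (WithTop ℤ) :=
  (gaussVal v ρ).comap (compRingHom (X + C z))

theorem discVal_apply (z : L) (f : L[X]) : discVal v ρ z f = gaussVal v ρ (f.comp (X + C z)) := rfl

theorem discVal_C (z a : L) : discVal v ρ z (C a) = v a := by
  rw [discVal_apply, C_comp, gaussVal_C]

theorem discVal_X_sub_C (z a : L) :
    discVal v ρ z (X - C a) = min (ρ : WithTop ℤ) (v (z - a)) := by
  rw [discVal_apply, sub_comp, X_comp, C_comp, add_sub_assoc, ← C_sub, gaussVal_X_add_C]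

/-- Moving the centre inside the disc does not change the valuation. -/
theorem int_le_discVal_of_center {z z' : L} (hz : (ρ : WithTop ℤ) ≤ v (z' - z)) {a : ℤ} {f : L[X]}
    (h : (a : WithTop ℤ) ≤ discVal v ρ z f) : (a : WithTop ℤ) ≤ discVal v ρ z' f := by
  rw [discVal_apply, int_le_gaussVal] at h
  have hf : f.comp (X + C z') = (f.comp (X + C z)).comp (X + C (z' - z)) := by
    rw [comp_assoc]; congr 1; simp only [add_comp, X_comp, C_comp, C_sub]; ring
  rw [discVal_apply, hf, comp_eq_sum_left, sum_def]
  refine AddValuation.map_le_sum _ fun i _ => ?_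
  have h1 : (ρ : WithTop ℤ) ≤ gaussVal v ρ (X + C (z' - z)) := by
    rw [gaussVal_X_add_C]; exact le_min le_rfl hz
  refine int_le_mono (le_map_mul _ (a := a - i * ρ) (b := i * ρ) ?_ (le_map_pow _ h1 i)) (by simp)
  rw [gaussVal_C]
  exact h i

/-- An isometry carries the disc about z to the disc about σ z. Combined with a change of centre
this makes the disc valuation invariant under inertia. -/
theorem int_le_discVal_map {σ : L →+* L} (hσ : ∀ x, v (σ x) = v x) {z : L} {a : ℤ} {f : L[X]}
    (h : (a : WithTop ℤ) ≤ discVal v ρ z f) :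
    (a : WithTop ℤ) ≤ discVal v ρ (σ z) (f.map σ) := by
  have hf : (f.map σ).comp (X + C (σ z)) = (f.comp (X + C z)).map σ := by
    rw [Polynomial.map_comp]; simp
  rw [discVal_apply, int_le_gaussVal] at h ⊢
  intro i
  rw [hf, coeff_map, hσ]
  exact h i

/-- Quotients by monic polynomials with integral coefficients are integral. -/
theorem coeff_nonneg_of_monic_mul {P S : L[X]} (hP : P.Monic) (hP0 : ∀ i, 0 ≤ v (P.coeff i))
    (h : ∀ i, 0 ≤ v ((P * S).coeff i)) (i : ℕ) : 0 ≤ v (S.coeff i) := by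
  -- The leading coefficient 1 bounds the minimum from above, integrality of the others from below.
  have h1 : gaussVal v 0 P = 0 := by
    refine le_antisymm ?_ ?_
    · by_contra hcon
      rw [not_le] at hcon
      have h2 := (int_le_gaussVal v 0).1 ((int_lt_iff (a := 0)).1 hcon) P.natDegree
      rw [coeff_natDegree, hP.leadingCoeff, v.map_one] at h2
      norm_cast at h2
    · exact (int_le_gaussVal v 0 (a := 0)).2 (by simpa using hP0)
  have h2 : ((0 : ℤ) : WithTop ℤ) ≤ gaussVal v 0 (P * S) :=
    (int_le_gaussVal v 0).2 (by simpa using h)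
  rw [AddValuation.map_mul, h1, zero_add, int_le_gaussVal] at h2
  simpa using h2 i

end Gauss

/-! ### Approximate roots -/

section Krasner

variable {L : Type*} [Field L]

/-- A nonarchimedean form of Krasner's argument: if `∏ (Z - s)` is small then `Z` is
correspondingly close to one of the roots. -/
theorem exists_close_root {R : Type*} [CommRing R] [Algebra L R]
    (v : AddValuation L (WithTop ℤ)) (w : AddValuation R (WithTop ℤ))
    (hw : ∀ a, w (algebraMap L R a) = v a) [DecidableEq L] (S : Finset L) (hS : S.Nonempty)
    (Z : R) {B : ℤ} (hB : (B : WithTop ℤ) ≤ w (∏ s ∈ S, (Z - algebraMap L R s))) :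
    ∃ s₀ ∈ S, (B : WithTop ℤ) ≤ w (Z - algebraMap L R s₀) + v (∏ s ∈ S.erase s₀, (s₀ - s)) := by
  obtain ⟨s₀, hs₀, hmax⟩ := S.exists_max_image (fun s => w (Z - algebraMap L R s)) hS
  refine ⟨s₀, hs₀, hB.trans ?_⟩
  rw [val_prod, val_prod, ← Finset.add_sum_erase _ _ hs₀]
  gcongr with s hs
  -- As s₀ is the root nearest to Z, the ultrametric inequality shows that s₀ is at least as close
  -- to s as Z is.
  have h1 := hmax s (Finset.mem_of_mem_erase hs)
  have h2 : algebraMap L R (s₀ - s) = (Z - algebraMap L R s) - (Z - algebraMap L R s₀) := by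
    rw [map_sub]; ring
  rw [← hw, h2]
  exact w.map_le_sub le_rfl h1

/-- Turns the loss in Krasner's argument into a value of a derivative, which is computable for
cyclotomic polynomials and for X^q - a. -/
theorem prod_erase_eq_derivative [DecidableEq L] (S : Finset L) {s₀ : L} (hs₀ : s₀ ∈ S) :
    ∏ s ∈ S.erase s₀, (s₀ - s) = (derivative (∏ s ∈ S, (X - C s))).eval s₀ := by
  have := Lagrange.eval_nodal_derivative_eval_node_eq (v := id) hs₀
  simp only [Lagrange.nodal, id] at this
  rw [this, eval_prod]
  simp

end Krasner


/-! ### Valuations on fields -/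

section FieldVal

variable {L : Type*} [Field L] {v : AddValuation L (WithTop ℤ)}

theorem exists_val_eq_coe (v : AddValuation L (WithTop ℤ)) {x : L} (hx : x ≠ 0) :
    ∃ n : ℤ, v x = n := by
  obtain ⟨n, hn⟩ := WithTop.ne_top_iff_exists.1 (v.ne_top_iff.2 hx)
  exact ⟨n, hn.symm⟩

theorem ne_zero_of_val_eq_coe {x : L} {n : ℤ} (hx : v x = n) : x ≠ 0 := by
  rintro rfl; simp at hx

theorem map_mul_coe {a b : ℤ} {x y : L} (hx : v x = a) (hy : v y = b) :
    v (x * y) = ((a + b : ℤ) : WithTop ℤ) := by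
  rw [v.map_mul, hx, hy, WithTop.coe_add]

theorem map_inv_coe {a : ℤ} {x : L} (hx : v x = a) : v x⁻¹ = ((-a : ℤ) : WithTop ℤ) := by
  have hx0 := ne_zero_of_val_eq_coe hx
  obtain ⟨b, hb⟩ := exists_val_eq_coe v (inv_ne_zero hx0)
  have h := map_mul_coe hx hb
  rw [mul_inv_cancel₀ hx0, v.map_one] at h
  rw [hb]
  norm_cast at h ⊢
  omega

theorem map_div_coe {a b : ℤ} {x y : L} (hx : v x = a) (hy : v y = b) :
    v (x / y) = ((a - b : ℤ) : WithTop ℤ) := by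
  rw [div_eq_mul_inv, map_mul_coe hx (map_inv_coe hy), sub_eq_add_neg]

theorem map_zpow_coe {a : ℤ} {x : L} (hx : v x = a) (n : ℤ) :
    v (x ^ n) = ((n * a : ℤ) : WithTop ℤ) := by
  obtain ⟨m, rfl | rfl⟩ := n.eq_nat_or_neg
  · rw [zpow_natCast]; exact map_pow_coe v hx m
  · rw [zpow_neg, zpow_natCast, map_inv_coe (map_pow_coe v hx m), neg_mul]

theorem int_le_val_div {x y : L} {a b : ℤ} (hx : ((a + b : ℤ) : WithTop ℤ) ≤ v x) (hy : v y = b) :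
    (a : WithTop ℤ) ≤ v (x / y) := by
  have hy0 : y ≠ 0 := by rintro rfl; simp at hy
  have h1 : x = x / y * y := by field_simp
  rw [h1, v.map_mul, hy, int_le_add_coe] at hx
  simpa using hx

/-- Replaces a limit argument in L: two elements congruent modulo all powers of p coincide. -/
theorem eq_zero_of_forall_mul_le_val {x : L} {e : ℤ}
    (h : ∀ n : ℕ, ((n * e : ℤ) : WithTop ℤ) ≤ v x) (he : 1 ≤ e) : x = 0 := by
  rw [← v.top_iff]
  by_contra hx
  obtain ⟨m, hm⟩ := WithTop.ne_top_iff_exists.1 hx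
  have := h (m.toNat + 1)
  rw [← hm] at this
  norm_cast at this
  push_cast at this
  nlinarith [Int.self_le_toNat m]

end FieldVal

/-! ### Elements of a finite extension as power series in a uniformizer -/

section Integral

variable {A R : Type*} [CommRing A] [CommRing R] (w : AddValuation R (WithTop ℤ)) {f : A →+* R}

theorem val_eval₂_nonneg (hf : ∀ a, 0 ≤ w (f a)) {x : R} (hx : 0 ≤ w x) (P : A[X]) :
    0 ≤ w (P.eval₂ f x) := by
  rw [eval₂_eq_sum, sum_def]
  refine w.map_le_sum fun i _ => ?_
  exact int_le_mono (le_map_mul w (a := 0) (hf (P.coeff i)) (le_map_pow w (a := 0) hx i)) (by simp)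

theorem le_val_pow_sub_pow {x y : R} (hx : 0 ≤ w x) (hy : 0 ≤ w y) {c : WithTop ℤ}
    (h : c ≤ w (x - y)) (n : ℕ) : c ≤ w (x ^ n - y ^ n) := by
  induction n with
  | zero => simp
  | succ n ih =>
    have h1 : x ^ (n + 1) - y ^ (n + 1) = x * (x ^ n - y ^ n) + (x - y) * y ^ n := by ring
    rw [h1]
    refine w.map_le_add ?_ ?_
    · rw [w.map_mul]; exact le_add_of_nonneg_of_le hx ih
    · rw [w.map_mul]
      refine le_add_of_le_of_nonneg h ?_
      exact int_le_mono (a := 0) (le_map_pow w (a := 0) hy n) (by simp)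

theorem le_val_eval₂_sub (hf : ∀ a, 0 ≤ w (f a)) {x y : R} (hx : 0 ≤ w x) (hy : 0 ≤ w y)
    {c : WithTop ℤ} (h : c ≤ w (x - y)) (P : A[X]) :
    c ≤ w (P.eval₂ f x - P.eval₂ f y) := by
  rw [eval₂_eq_sum, eval₂_eq_sum, sum_def, sum_def, ← Finset.sum_sub_distrib]
  refine w.map_le_sum fun i _ => ?_
  rw [← mul_sub, w.map_mul]
  exact le_add_of_nonneg_of_le (hf _) (le_val_pow_sub_pow w hx hy h i)

variable {L : Type*} [Field L] (v : AddValuation L (WithTop ℤ)) {f : A →+* L}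

/-- If v(x) < 0, the leading term of a monic equation has strictly smaller valuation than all the
others. -/
theorem val_nonneg_of_isIntegralElem (hf : ∀ a, 0 ≤ v (f a)) {x : L} (hx : f.IsIntegralElem x) :
    0 ≤ v x := by
  obtain ⟨P, hP, h⟩ := hx
  by_contra hneg
  rw [not_le] at hneg
  obtain ⟨m, hm⟩ := WithTop.ne_top_iff_exists.1 hneg.ne_top
  have hm0 : m < 0 := by rw [← hm] at hneg; exact_mod_cast hneg
  rw [hP.as_sum, eval₂_add, eval₂_pow, eval₂_X, eval₂_finsetSum] at h
  have h1 : ((P.natDegree * m + 1 : ℤ) : WithTop ℤ) ≤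
      v (∑ i ∈ Finset.range P.natDegree, eval₂ f x (C (P.coeff i) * X ^ i)) := by
    refine v.map_le_sum fun i hi => ?_
    rw [eval₂_mul, eval₂_C, eval₂_pow, eval₂_X]
    refine int_le_mono (le_map_mul v (a := 0) (hf _) (le_map_pow v hm.le i)) ?_
    have hi : (i : ℤ) + 1 ≤ P.natDegree := by exact_mod_cast Finset.mem_range.1 hi
    nlinarith
  rw [add_eq_zero_iff_eq_neg] at h
  have h2 := map_pow_coe v hm.symm P.natDegree
  rw [h, v.map_neg] at h2
  rw [h2] at h1
  norm_cast at h1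
  omega

end Integral

variable (p : ℕ) [Fact p.Prime] (k : Type*) [Field k] [CharP k p]

/-! ### The structure map from W(k) -/

section OfWitt

variable (L : Type*) [Field L] [Algebra (K₀ p k) L]

/-- The structure map `W(k) → L` of an extension `L` of `K₀`. -/
noncomputable def ofWitt : WittVector p k →+* L :=
  (algebraMap (K₀ p k) L).comp (algebraMap (WittVector p k) (K₀ p k))

include p k in
theorem charZero_ext : CharZero L := by
  have := charZero_K₀ p k
  exact charZero_of_injective_algebraMap (algebraMap (K₀ p k) L).injective

include k in
theorem p_ne_zero_ext : (p : L) ≠ 0 := by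
  have := charZero_ext p k L
  exact_mod_cast (Fact.out : p.Prime).ne_zero

end OfWitt

/-! ### Total ramification: residue field, expansions in a uniformizer, uniqueness of the valuation
-/

section Structure

variable {p k} {L : Type*} [Field L] [Algebra (K₀ p k) L] {v : AddValuation L (WithTop ℤ)}

/-- Divide by p as long as the reduction vanishes; this stops because the exponent of p in one fixed
nonzero coefficient drops each time. -/
theorem exists_primitive_annihilator [IsAlgClosed k] {x : L} {f : (WittVector p k)[X]}
    (hf : f ≠ 0) (hx : f.eval₂ (ofWitt p k L) x = 0) :
    ∃ g : (WittVector p k)[X], g.map WittVector.constantCoeff ≠ 0 ∧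
      g.eval₂ (ofWitt p k L) x = 0 := by
  obtain ⟨i, hi⟩ := nonempty_support_iff.2 hf
  obtain ⟨n, b, hb, hn⟩ := WittVector.exists_eq_pow_p_mul _ (mem_support_iff.1 hi)
  clear hf hi
  induction n generalizing f with
  | zero =>
    refine ⟨f, fun h => hb ?_, hx⟩
    have := congrArg (fun q => q.coeff i) h
    rw [coeff_map, hn] at this
    simpa using this
  | succ n ih =>
    by_cases h : f.map WittVector.constantCoeff = 0
    · have hdvd : C (p : WittVector p k) ∣ f := by
        rw [C_dvd_iff_dvd_coeff]
        intro j
        rw [← Ideal.mem_span_singleton, WittVector.mem_span_p_iff_coeff_zero_eq_zero]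
        have := congrArg (fun q => q.coeff j) h
        simpa [coeff_map] using this
      obtain ⟨f', rfl⟩ := hdvd
      refine ih (f := f') ?_ ?_
      · rw [eval₂_mul, eval₂_C, map_natCast] at hx
        exact (mul_eq_zero.1 hx).resolve_left (p_ne_zero_ext p k L)
      · rw [coeff_C_mul, pow_succ', mul_assoc] at hn
        exact mul_left_cancel₀ (WittVector.p_nonzero p k) hn
    · exact ⟨f, h, hx⟩

variable (hv : IsNormalizedVal p k v)
include hv

theorem val_ofWitt_nonneg (a : WittVector p k) : 0 ≤ v (ofWitt p k L a) := hv.2 a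

theorem val_ofWitt_of_isUnit {a : WittVector p k} (ha : IsUnit a) : v (ofWitt p k L a) = 0 := by
  obtain ⟨b, hb⟩ := ha.exists_right_inv
  refine map_unit_nonneg_eq_zero v (y := ofWitt p k L b) ?_ (hv.2 a) (hv.2 b)
  rw [← map_mul, hb, map_one]

theorem exists_uniformizer : ∃ π : L, v π = 1 := hv.1 1

variable [IsAlgClosed k]

theorem exists_val_algebraMap {e : ℤ} (he : v (p : L) = e) {c : K₀ p k} (hc : c ≠ 0) :
    ∃ n : ℤ, v (algebraMap (K₀ p k) L c) = ((n * e : ℤ) : WithTop ℤ) := by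
  obtain ⟨a, b, hb, rfl⟩ := IsFractionRing.div_surjective (A := WittVector p k) c
  have hb0 : b ≠ 0 := nonZeroDivisors.ne_zero hb
  have ha0 : a ≠ 0 := by rintro rfl; simp at hc
  have key : ∀ a : WittVector p k, a ≠ 0 → ∃ n : ℤ, v (ofWitt p k L a) = ((n * e : ℤ) : WithTop ℤ) := by
    intro a ha
    obtain ⟨n, u, hu, rfl⟩ := WittVector.exists_eq_pow_p_mul a ha
    refine ⟨n, ?_⟩
    rw [map_mul, map_pow, map_natCast, v.map_mul,
      val_ofWitt_of_isUnit hv (WittVector.isUnit_of_coeff_zero_ne_zero u hu), add_zero,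
      map_pow_coe v he]
  obtain ⟨n, hn⟩ := key a ha0
  obtain ⟨m, hm⟩ := key b hb0
  refine ⟨n - m, ?_⟩
  rw [map_div₀]
  change v (ofWitt p k L a / ofWitt p k L b) = _
  rw [map_div_coe hn hm, sub_mul]

/-- If v(p) were 0, then v would be nonnegative on K₀, hence on every element algebraic over it,
against surjectivity. -/
theorem exists_val_p [Algebra.IsAlgebraic (K₀ p k) L] :
    ∃ e : ℕ, 1 ≤ e ∧ v (p : L) = ((e : ℤ) : WithTop ℤ) := by
  obtain ⟨e, he⟩ := WithTop.ne_top_iff_exists.1 (v.ne_top_iff.2 (p_ne_zero_ext p k L))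
  have he0 : 0 ≤ e := by
    have := map_natCast_nonneg v p
    rw [← he] at this; exact_mod_cast this
  obtain ⟨e, rfl⟩ := Int.eq_ofNat_of_zero_le he0
  refine ⟨e, ?_, he.symm⟩
  by_contra hlt
  have : e = 0 := by omega
  subst this
  have hall : ∀ c, 0 ≤ v (algebraMap (K₀ p k) L c) := by
    intro c
    by_cases hc : c = 0
    · simp [hc]
    · obtain ⟨n, hn⟩ := exists_val_algebraMap hv he.symm hc
      rw [hn]; simp
  obtain ⟨x, hx⟩ := hv.1 ((-1 : ℤ) : WithTop ℤ)
  have := val_nonneg_of_isIntegralElem v hall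
    (x := x) (Algebra.IsIntegral.isIntegral (R := K₀ p k) x)
  rw [hx] at this
  norm_cast at this

variable [Algebra.IsAlgebraic (K₀ p k) L]

theorem one_le_val_p : ((1 : ℤ) : WithTop ℤ) ≤ v (p : L) := by
  obtain ⟨e, he, h⟩ := exists_val_p hv
  rw [h]; exact_mod_cast he

theorem one_le_val_ofWitt {a : WittVector p k} (ha : WittVector.constantCoeff a = 0) :
    ((1 : ℤ) : WithTop ℤ) ≤ v (ofWitt p k L a) := by
  have : a ∈ Ideal.span {(p : WittVector p k)} :=
    (WittVector.mem_span_p_iff_coeff_zero_eq_zero a).2 ha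
  obtain ⟨b, rfl⟩ := Ideal.mem_span_singleton.1 this
  rw [map_mul, map_natCast]
  exact le_map_mul v (a := 1) (b := 0) (one_le_val_p hv) (val_ofWitt_nonneg hv b)

/-- The residue field of `L` is `k`. -/
theorem exists_residue {x : L} (hx : 0 ≤ v x) :
    ∃ a : WittVector p k, ((1 : ℤ) : WithTop ℤ) ≤ v (x - ofWitt p k L a) := by
  obtain ⟨f, hf, hfx⟩ : ∃ f : (WittVector p k)[X], f ≠ 0 ∧ f.eval₂ (ofWitt p k L) x = 0 := by
    obtain ⟨q, hq, hqx⟩ := Algebra.IsAlgebraic.isAlgebraic (R := K₀ p k) x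
    refine ⟨IsLocalization.integerNormalization (nonZeroDivisors (WittVector p k)) q, ?_,
      IsLocalization.integerNormalization_eval₂_eq_zero _ _ _ hqx⟩
    exact (IsFractionRing.integerNormalization_eq_zero_iff (A := WittVector p k)).not.2 hq
  obtain ⟨g, hg, hgx⟩ := exists_primitive_annihilator hf hfx
  set gb := g.map (WittVector.constantCoeff (p := p) (R := k)) with hgb
  obtain ⟨c, hc⟩ := WittVector.constantCoeff_surjective p gb.leadingCoeff
  -- F lifts the factorization of the reduction of g into linear factors over the algebraically
  -- closed field k; it agrees with g modulo p.
  let F : (WittVector p k)[X] :=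
    C c * (gb.roots.map fun a => X - C (WittVector.teichmuller p a)).prod
  have hF : (g - F).map (WittVector.constantCoeff (p := p) (R := k)) = 0 := by
    have h1 := (IsAlgClosed.splits gb).eq_prod_roots
    have h2 : F.map (WittVector.constantCoeff (p := p) (R := k)) = gb := by
      rw [Polynomial.map_mul, Polynomial.map_C, hc, Polynomial.map_multiset_prod, Multiset.map_map]
      conv_rhs => rw [h1]
      congr 3
      funext a
      simp [WittVector.teichmuller_coeff_zero]
    rw [Polynomial.map_sub, ← hgb, sub_eq_zero, h2]
  have h1 : ((1 : ℤ) : WithTop ℤ) ≤ v (F.eval₂ (ofWitt p k L) x) := by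
    have h2 : ((1 : ℤ) : WithTop ℤ) ≤ v ((g - F).eval₂ (ofWitt p k L) x) := by
      rw [eval₂_eq_sum, sum_def]
      refine v.map_le_sum fun i _ => ?_
      refine int_le_mono (le_map_mul v (b := 0) (one_le_val_ofWitt hv ?_)
        (le_map_pow v (a := 0) hx i)) (by simp)
      have := congrArg (fun q => q.coeff i) hF
      rw [coeff_map, coeff_zero] at this
      exact this
    rw [eval₂_sub, hgx, zero_sub, v.map_neg] at h2
    exact h2
  -- Otherwise every factor x - [a] of F(x) is a unit, and so is the lifted leading coefficient,
  -- while F(x) has positive valuation.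
  by_contra! hcon
  have h0 : v (F.eval₂ (ofWitt p k L) x) = 0 := by
    rw [eval₂_mul, eval₂_C, v.map_mul, val_ofWitt_of_isUnit hv, zero_add]
    · rw [eval₂_multiset_prod, Multiset.map_map]
      induction gb.roots using Multiset.induction_on with
      | empty => simp
      | cons a s ih =>
        rw [Multiset.map_cons, Multiset.prod_cons, v.map_mul, ih, add_zero]
        have h2 := hcon (WittVector.teichmuller p a)
        simp only [Function.comp, eval₂_sub, eval₂_X, eval₂_C]
        refine le_antisymm ?_ (v.map_le_sub hx (val_ofWitt_nonneg hv _))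
        rw [← not_lt, ← WithTop.coe_zero, int_lt_iff, zero_add, not_le]
        exact h2
    · refine WittVector.isUnit_of_coeff_zero_ne_zero c ?_
      change WittVector.constantCoeff c ≠ 0
      rw [hc]
      exact leadingCoeff_ne_zero.2 hg
  rw [h0] at h1
  norm_cast at h1

/-- Successive π-adic digits, each a residue supplied by `exists_residue`. -/
theorem exists_poly_approx {π : L} (hπ : v π = 1) {x : L} (hx : 0 ≤ v x) (j : ℕ) :
    ∃ V : (WittVector p k)[X], V.degree < j ∧
      ((j : ℤ) : WithTop ℤ) ≤ v (x - V.eval₂ (ofWitt p k L) π) := by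
  induction j with
  | zero => exact ⟨0, by simp, by simpa using hx⟩
  | succ j ih =>
    obtain ⟨V, hV, h⟩ := ih
    have hπj : v (π ^ j) = ((j : ℤ) : WithTop ℤ) := by
      simpa using map_pow_coe v (a := 1) hπ j
    obtain ⟨a, ha⟩ := exists_residue hv (x := (x - V.eval₂ (ofWitt p k L) π) / π ^ j)
      (int_le_val_div (a := 0) (by simpa using h) hπj)
    refine ⟨V + C a * X ^ j, ?_, ?_⟩
    · refine (degree_add_le _ _).trans_lt (max_lt (hV.trans (by exact_mod_cast j.lt_succ_self)) ?_)
      exact (degree_C_mul_X_pow_le j a).trans_lt (by exact_mod_cast j.lt_succ_self)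
    · have hπ0 : π ≠ 0 := by rintro rfl; simp at hπ
      have h2 : x - (V + C a * X ^ j).eval₂ (ofWitt p k L) π =
          ((x - V.eval₂ (ofWitt p k L) π) / π ^ j - ofWitt p k L a) * π ^ j := by
        rw [eval₂_add, eval₂_mul, eval₂_C, eval₂_pow, eval₂_X]
        field_simp
        ring
      rw [h2]
      exact int_le_mono (le_map_mul v ha hπj.ge) (by push_cast; omega)

/-- Every integral element is a `W(k)`-polynomial of degree `< e` in a uniformizer. -/
theorem exists_poly_of_nonneg {π : L} (hπ : v π = 1) {e : ℕ} (he : v (p : L) = ((e : ℤ) : WithTop ℤ))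
    {x : L} (hx : 0 ≤ v x) :
    ∃ V : (WittVector p k)[X], V.degree < e ∧ x = V.eval₂ (ofWitt p k L) π := by
  have he1 : 1 ≤ e := by
    have := one_le_val_p hv
    rw [he] at this; exact_mod_cast this
  have hp0 := p_ne_zero_ext p k L
  -- After e digits the remainder is divisible by p, so the procedure restarts with the quotient.
  -- This keeps the degree in π below e.
  have step : ∀ y : {y : L // 0 ≤ v y}, ∃ V : (WittVector p k)[X], ∃ y' : {y : L // 0 ≤ v y},
      V.degree < e ∧ (y : L) = V.eval₂ (ofWitt p k L) π + p * y' := by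
    intro y
    obtain ⟨V, hV, h⟩ := exists_poly_approx hv hπ y.2 e
    refine ⟨V, ⟨_, int_le_val_div (a := 0) (by simpa using h) he⟩, hV, ?_⟩
    field_simp
    ring
  choose V y' hV hy using step
  let s : ℕ → {y : L // 0 ≤ v y} := fun n => y'^[n] ⟨x, hx⟩
  have hs : ∀ n, ((s n : {y : L // 0 ≤ v y}) : L) =
      (V (s n)).eval₂ (ofWitt p k L) π + p * ((s (n + 1) : {y : L // 0 ≤ v y}) : L) :=
    fun n => by
      have h1 : s (n + 1) = y' (s n) := Function.iterate_succ_apply' y' n _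
      rw [h1]
      exact hy (s n)
  have hsum : ∀ n, x = (∑ i ∈ Finset.range n, C ((p : WittVector p k) ^ i) * V (s i)).eval₂
      (ofWitt p k L) π + p ^ n * s n := by
    intro n
    induction n with
    | zero => simp [s]
    | succ n ih =>
      rw [Finset.sum_range_succ, eval₂_add, eval₂_mul, eval₂_C, map_pow, map_natCast]
      conv_lhs => rw [ih, hs n]
      ring
  -- `T j n` is the n-th partial sum of the coefficient of π^j. It converges p-adically in W(k), so
  -- only the completeness of W(k) is used and not that of L.
  let T : ℕ → ℕ → WittVector p k := fun j n =>
    ∑ i ∈ Finset.range n, (p : WittVector p k) ^ i * (V (s i)).coeff j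
  have hlim : ∀ j, ∃ A : WittVector p k, ∀ n, (p : WittVector p k) ^ n ∣ T j n - A := by
    intro j
    obtain ⟨A, hA⟩ := (WittVector.isAdicCompleteIdealSpanP (p := p) (k := k)).toIsPrecomplete.prec'
      (T j) (by
        intro m n hmn
        rw [SModEq.sub_mem, smul_eq_mul, Ideal.mul_top, Ideal.span_singleton_pow,
          Ideal.mem_span_singleton, dvd_sub_comm]
        simp only [T]
        rw [← Finset.sum_range_add_sum_Ico _ hmn, add_sub_cancel_left]
        refine Finset.dvd_sum fun i hi => ?_
        exact (pow_dvd_pow _ (Finset.mem_Ico.1 hi).1).mul_right _)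
    refine ⟨A, fun n => ?_⟩
    have := hA n
    rwa [SModEq.sub_mem, smul_eq_mul, Ideal.mul_top, Ideal.span_singleton_pow,
          Ideal.mem_span_singleton] at this
  choose A hA using hlim
  have hVdeg : ∀ y j, e ≤ j → (V y).coeff j = 0 := fun y j hj =>
    coeff_eq_zero_of_degree_lt ((hV y).trans_le (by exact_mod_cast hj))
  refine ⟨∑ j ∈ Finset.range e, C (A j) * X ^ j, ?_, ?_⟩
  · refine (degree_sum_le _ _).trans_lt ((Finset.sup_lt_iff (WithBot.bot_lt_coe e)).2 ?_)
    intro j hj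
    exact (degree_C_mul_X_pow_le j _).trans_lt (WithBot.coe_lt_coe.2 (Finset.mem_range.1 hj))
  rw [← sub_eq_zero]
  refine eq_zero_of_forall_mul_le_val (v := v) (e := e) (fun n => ?_) (by exact_mod_cast he1)
  have hpn : v ((p : L) ^ n) = ((n * e : ℤ) : WithTop ℤ) := map_pow_coe v he n
  have hpoly : ∑ i ∈ Finset.range n, C ((p : WittVector p k) ^ i) * V (s i) =
      ∑ j ∈ Finset.range e, C (T j n) * X ^ j := by
    refine Polynomial.ext fun j => ?_
    simp only [finsetSum_coeff, coeff_C_mul, coeff_X_pow, mul_ite, mul_one, mul_zero]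
    rw [Finset.sum_ite_eq]
    split_ifs with hj
    · rfl
    · apply Finset.sum_eq_zero
      intro i _
      rw [hVdeg _ _ (by simpa using hj), mul_zero]
  have hx' := hsum n
  rw [hpoly] at hx'
  have h3 : x - (∑ j ∈ Finset.range e, C (A j) * X ^ j).eval₂ (ofWitt p k L) π =
      (∑ j ∈ Finset.range e, ofWitt p k L (T j n - A j) * π ^ j) + p ^ n * s n := by
    conv_lhs => rw [hx']
    simp only [eval₂_finsetSum, eval₂_mul, eval₂_C, eval₂_pow, eval₂_X, map_sub, sub_mul,
      Finset.sum_sub_distrib]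
    ring
  rw [h3]
  refine v.map_le_add (v.map_le_sum fun j _ => ?_) ?_
  · obtain ⟨b, hb⟩ := hA j n
    rw [hb, (ofWitt p k L).map_mul, (ofWitt p k L).map_pow, map_natCast (ofWitt p k L), mul_assoc]
    refine int_le_mono (le_map_mul v hpn.ge (b := 0) ?_) (by simp)
    refine int_le_mono (le_map_mul v (a := 0) (val_ofWitt_nonneg hv b)
      (le_map_pow v (a := 0) ?_ j)) (by simp)
    rw [hπ]; exact zero_le_one
  · exact int_le_mono (le_map_mul v hpn.ge (b := 0) (s n).2) (by simp)

/-- Expanding π^e in degree below e gives a monic equation for π over W(k), so π is integral for any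
normalized valuation. -/
theorem val_nonneg_uniformizer_of_isNormalizedVal {v' : AddValuation L (WithTop ℤ)}
    (hv' : IsNormalizedVal p k v') {π : L} (hπ : v π = 1) : 0 ≤ v' π := by
  obtain ⟨e, he1, he⟩ := exists_val_p hv
  have hπe : 0 ≤ v (π ^ e) := by
    have := map_pow_coe v (a := 1) hπ e
    rw [this]; exact_mod_cast (by positivity)
  obtain ⟨V, hV, h⟩ := exists_poly_of_nonneg hv hπ he hπe
  refine val_nonneg_of_isIntegralElem v' (val_ofWitt_nonneg hv') ⟨X ^ e - V, monic_X_pow_sub hV, ?_⟩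
  · rw [eval₂_sub, eval₂_pow, eval₂_X, h, sub_self]

theorem val_nonneg_of_isNormalizedVal {v' : AddValuation L (WithTop ℤ)}
    (hv' : IsNormalizedVal p k v') {x : L} (hx : 0 ≤ v x) : 0 ≤ v' x := by
  obtain ⟨π, hπ⟩ := exists_uniformizer hv
  obtain ⟨e, he1, he⟩ := exists_val_p hv
  obtain ⟨V, hV, rfl⟩ := exists_poly_of_nonneg hv hπ he hx
  exact val_eval₂_nonneg v' (val_ofWitt_nonneg hv')
    (val_nonneg_uniformizer_of_isNormalizedVal hv hv' hπ) V

/-- The normalized valuation is unique. -/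
theorem isNormalizedVal_unique {v' : AddValuation L (WithTop ℤ)}
    (hv' : IsNormalizedVal p k v') (x : L) : v' x = v x := by
  have hO : ∀ x, v x = 0 → v' x = 0 := by
    intro x hx
    have hx0 : x ≠ 0 := by rintro rfl; simp at hx
    have hxx : x * x⁻¹ = 1 := mul_inv_cancel₀ hx0
    refine map_unit_nonneg_eq_zero v' hxx (val_nonneg_of_isNormalizedVal hv hv' hx.ge)
      (val_nonneg_of_isNormalizedVal hv hv' ?_)
    have : v x + v x⁻¹ = 0 := by rw [← v.map_mul, hxx, v.map_one]
    rw [hx, zero_add] at this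
    exact this.ge
  obtain ⟨π, hπ⟩ := exists_uniformizer hv
  have hπ0 : π ≠ 0 := by rintro rfl; simp at hπ
  obtain ⟨m, hm⟩ := WithTop.ne_top_iff_exists.1 (v'.ne_top_iff.2 hπ0)
  have hm0 : 0 ≤ m := by
    have := val_nonneg_uniformizer_of_isNormalizedVal hv hv' hπ
    rw [← hm] at this; exact_mod_cast this
  have hz : ∀ n : ℤ, v' (π ^ n) = ((n * m : ℤ) : WithTop ℤ) := map_zpow_coe hm.symm
  have hval : ∀ x (n : ℤ), v x = n → v' x = ((n * m : ℤ) : WithTop ℤ) := by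
    intro x n hx
    have h1 : x = x / π ^ n * π ^ n := (div_mul_cancel₀ _ (zpow_ne_zero _ hπ0)).symm
    rw [h1, v'.map_mul, hO, zero_add, hz]
    have h2 := map_div_coe hx (map_zpow_coe (a := 1) hπ n)
    simpa using h2
  obtain ⟨π', hπ'⟩ := exists_uniformizer hv'
  -- All values of `v'` are multiples of m = v'(π), and `v'` takes the value 1.
  have hm1 : m = 1 := by
    have hπ'0 : π' ≠ 0 := by rintro rfl; simp at hπ'
    obtain ⟨n, hn⟩ := WithTop.ne_top_iff_exists.1 (v.ne_top_iff.2 hπ'0)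
    have := hval π' n hn.symm
    rw [hπ'] at this
    norm_cast at this
    exact Int.eq_one_of_mul_eq_one_left hm0 this.symm
  by_cases hx : x = 0
  · simp [hx]
  · obtain ⟨n, hn⟩ := WithTop.ne_top_iff_exists.1 (v.ne_top_iff.2 hx)
    rw [hval x n hn.symm, ← hn, hm1, mul_one]

/-- The normalized valuation is invariant under automorphisms. -/
theorem val_algEquiv (g : L ≃ₐ[K₀ p k] L) (x : L) : v (g x) = v x := by
  have hv' : IsNormalizedVal p k (v.comap (g : L →+* L)) := by
    refine ⟨fun n => ?_, fun a => ?_⟩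
    · obtain ⟨y, hy⟩ := hv.1 n
      refine ⟨g.symm y, ?_⟩
      change v (g (g.symm y)) = n
      rw [g.apply_symm_apply, hy]
    · have := hv.2 a
      rw [← g.commutes] at this
      exact this
  exact isNormalizedVal_unique hv hv' x

/-- The powers 1, π, …, π^(e-1) form a basis: elements of K₀ have valuations divisible by e, so the
terms of a relation have distinct valuations; spanning is the expansion in π. Thus every finite
extension of K₀ is totally ramified. -/
theorem finrank_eq_of_val_p {e : ℕ} (he : v (p : L) = ((e : ℤ) : WithTop ℤ)) :
    Module.finrank (K₀ p k) L = e := by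
  classical
  obtain ⟨π, hπ⟩ := exists_uniformizer hv
  have he1 : 1 ≤ e := by
    have := one_le_val_p hv
    rw [he] at this; exact_mod_cast this
  have hli : LinearIndependent (K₀ p k) (fun i : Fin e => π ^ (i : ℕ)) := by
    rw [Fintype.linearIndependent_iff]
    intro c hc
    by_contra! hne
    have hval : ∀ i, c i ≠ 0 → ∃ n : ℤ, v (c i • π ^ (i : ℕ)) = ((n * e + i : ℤ) : WithTop ℤ) := by
      intro i hi
      obtain ⟨n, hn⟩ := exists_val_algebraMap hv he hi
      refine ⟨n, ?_⟩
      rw [Algebra.smul_def, v.map_mul, hn, map_pow_coe v (a := 1) hπ, mul_one, ← WithTop.coe_add]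
    obtain ⟨i, hi, hmin⟩ := (Finset.univ.filter fun i => c i ≠ 0).exists_min_image
      (fun i => v (c i • π ^ (i : ℕ))) (by obtain ⟨i, hi⟩ := hne; exact ⟨i, by simpa using hi⟩)
    have hi0 : c i ≠ 0 := (Finset.mem_filter.1 hi).2
    obtain ⟨n, hn⟩ := hval i hi0
    rw [← Finset.add_sum_erase _ _ (Finset.mem_univ i), add_eq_zero_iff_eq_neg] at hc
    have h1 : ((n * e + i + 1 : ℤ) : WithTop ℤ) ≤
        v (∑ j ∈ Finset.univ.erase i, c j • π ^ (j : ℕ)) := by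
      refine v.map_le_sum fun j hj => ?_
      by_cases hj0 : c j = 0
      · simp [hj0]
      have h2 := hmin j (by simpa using hj0)
      obtain ⟨m, hm⟩ := hval j hj0
      rw [hn, hm] at h2
      rw [hm]
      norm_cast at h2 ⊢
      have hne : (n * e + (i : ℕ) : ℤ) ≠ m * e + (j : ℕ) := by
        intro h
        have h3 := congrArg (fun t : ℤ => t % e) h
        simp only [Int.add_comm (n * e), Int.add_comm (m * e),
          Int.add_mul_emod_self_right] at h3
        rw [Int.emod_eq_of_lt (by positivity) (by exact_mod_cast i.2),
          Int.emod_eq_of_lt (by positivity) (by exact_mod_cast j.2)] at h3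
        exact (Finset.mem_erase.1 hj).1 (Fin.ext (by exact_mod_cast h3.symm))
      omega
    rw [← v.map_neg, ← hc, hn] at h1
    norm_cast at h1
    omega
  have hspan : ⊤ ≤ Submodule.span (K₀ p k) (Set.range fun i : Fin e => π ^ (i : ℕ)) := by
    intro x _
    obtain ⟨n, hn⟩ : ∃ n : ℕ, 0 ≤ v ((p : L) ^ n * x) := by
      by_cases hx : x = 0
      · exact ⟨0, by simp [hx]⟩
      obtain ⟨m, hm⟩ := WithTop.ne_top_iff_exists.1 (v.ne_top_iff.2 hx)
      refine ⟨m.natAbs, ?_⟩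
      refine int_le_mono (a := 0) (le_map_mul v (map_pow_coe v he _).ge hm.le) ?_
      have : (1 : ℤ) ≤ e := by exact_mod_cast he1
      have h2 : -m ≤ (m.natAbs : ℤ) := by omega
      nlinarith
    obtain ⟨V, hV, h⟩ := exists_poly_of_nonneg hv hπ he hn
    have hmem : (p : L) ^ n * x ∈
        Submodule.span (K₀ p k) (Set.range fun i : Fin e => π ^ (i : ℕ)) := by
      rw [h, eval₂_eq_sum, sum_def]
      refine Submodule.sum_mem _ fun i hi => ?_
      have hie : i < e := by
        by_contra hge
        exact mem_support_iff.1 hi (coeff_eq_zero_of_degree_lt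
          (hV.trans_le (by exact_mod_cast not_lt.1 hge)))
      change algebraMap (K₀ p k) L _ * _ ∈ _
      rw [← Algebra.smul_def]
      exact Submodule.smul_mem _ _ (Submodule.subset_span ⟨⟨i, hie⟩, rfl⟩)
    have hp0 : (p : K₀ p k) ≠ 0 := p_ne_zero_ext p k (K₀ p k)
    have h3 : x = ((p : K₀ p k) ^ n)⁻¹ • ((p : L) ^ n * x) := by
      rw [Algebra.smul_def, map_inv₀, map_pow, map_natCast, inv_mul_cancel_left₀]
      exact pow_ne_zero _ (p_ne_zero_ext p k L)
    rw [h3]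
    exact Submodule.smul_mem _ _ hmem
  have := Module.finrank_eq_card_basis (Module.Basis.mk hli hspan)
  simpa using this

end Structure

/-! ### Ramification groups and the conductor -/

section Conductor

variable {p : ℕ} [Fact p.Prime] {k : Type*} [Field k] [CharP k p] [IsAlgClosed k]
  {L : Type*} [Field L] [Algebra (K₀ p k) L] [FiniteDimensional (K₀ p k) L]
  {v : AddValuation L (WithTop ℤ)} (hv : IsNormalizedVal p k v)

omit [IsAlgClosed k] [FiniteDimensional (K₀ p k) L] in
theorem algEquiv_ofWitt (g : L ≃ₐ[K₀ p k] L) (a : WittVector p k) :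
    g (ofWitt p k L a) = ofWitt p k L a := g.commutes _

omit [IsAlgClosed k] [FiniteDimensional (K₀ p k) L] in
theorem algEquiv_eval₂_ofWitt (g : L ≃ₐ[K₀ p k] L) (V : (WittVector p k)[X]) (x : L) :
    g (V.eval₂ (ofWitt p k L) x) = V.eval₂ (ofWitt p k L) (g x) := by
  have h := hom_eval₂ V (ofWitt p k L) (g : L →+* L) x
  have h2 : (g : L →+* L).comp (ofWitt p k L) = ofWitt p k L :=
    RingHom.ext fun a => algEquiv_ofWitt g a
  rw [h2] at h
  exact h

include hv

/-- Automorphisms move integral elements at least as little as a uniformizer. -/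
theorem val_uniformizer_sub_le {π : L} (hπ : v π = 1) (g : L ≃ₐ[K₀ p k] L) {x : L}
    (hx : 0 ≤ v x) : v (g π - π) ≤ v (g x - x) := by
  obtain ⟨e, he1, he⟩ := exists_val_p hv
  obtain ⟨V, -, rfl⟩ := exists_poly_of_nonneg hv hπ he hx
  rw [algEquiv_eval₂_ofWitt]
  have hπ0 : 0 ≤ v π := by rw [hπ]; exact zero_le_one
  refine le_val_eval₂_sub v (val_ofWitt_nonneg hv) ?_ hπ0 le_rfl V
  rwa [val_algEquiv hv]

theorem algEquiv_eq_one_of_uniformizer {π : L} (hπ : v π = 1) {g : L ≃ₐ[K₀ p k] L}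
    (hg : g π = π) : g = 1 := by
  have h0 : ∀ x, 0 ≤ v x → g x = x := by
    intro x hx
    have := val_uniformizer_sub_le hv hπ g hx
    rw [hg, sub_self, v.map_zero, top_le_iff, v.top_iff, sub_eq_zero] at this
    exact this
  ext x
  change g x = x
  rcases le_or_gt 0 (v x) with hx | hx
  · exact h0 x hx
  · have hx0 : x ≠ 0 := by rintro rfl; simp at hx
    obtain ⟨n, hn⟩ := exists_val_eq_coe v hx0
    have h1 := h0 x⁻¹ (by
      rw [map_inv_coe hn]
      rw [hn] at hx
      norm_cast at hx ⊢
      omega)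
    rw [map_inv₀] at h1
    exact inv_injective h1

theorem exists_val_algEquiv_sub {π : L} (hπ : v π = 1) {g : L ≃ₐ[K₀ p k] L} (hg : g ≠ 1) :
    ∃ n : ℤ, 1 ≤ n ∧ v (g π - π) = n := by
  obtain ⟨n, hn⟩ := exists_val_eq_coe v (x := g π - π) (fun h =>
    hg (algEquiv_eq_one_of_uniformizer hv hπ (sub_eq_zero.1 h)))
  refine ⟨n, ?_, hn⟩
  have : (1 : WithTop ℤ) ≤ v (g π - π) :=
    v.map_le_sub (by rw [val_algEquiv hv, hπ]) hπ.ge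
  rw [hn] at this
  exact_mod_cast this

/-- One uniformizer suffices, because any integral element is moved at least as little as π. -/
theorem mem_lowerRam_iff {π : L} (hπ : v π = 1) {i : ℝ} {g : L ≃ₐ[K₀ p k] L} :
    g ∈ lowerRam (K₀ p k) v i ↔
      ((i + 1 : ℝ) : WithTop ℝ) ≤ WithTop.map (fun n : ℤ => (n : ℝ)) (v (g π - π)) := by
  refine ⟨fun h => h π hπ, fun h π' hπ' => h.trans ?_⟩
  have hmono : Monotone (fun n : ℤ => (n : ℝ)) := Int.cast_mono
  exact hmono.withTop_map (val_uniformizer_sub_le hv hπ g (by rw [hπ']; exact zero_le_one))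

theorem mem_lowerRam_iff_of_eq {π : L} (hπ : v π = 1) {i : ℝ} {g : L ≃ₐ[K₀ p k] L} {n : ℤ}
    (hn : v (g π - π) = n) : g ∈ lowerRam (K₀ p k) v i ↔ i + 1 ≤ n := by
  rw [mem_lowerRam_iff hv hπ, hn, WithTop.map_coe, WithTop.coe_le_coe]

omit hv [IsAlgClosed k] [FiniteDimensional (K₀ p k) L] in
theorem one_mem_lowerRam (v : AddValuation L (WithTop ℤ)) (i : ℝ) :
    1 ∈ lowerRam (K₀ p k) v i := by
  intro π _
  simp

omit hv [IsAlgClosed k] [FiniteDimensional (K₀ p k) L] in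
theorem lowerRam_antitone (v : AddValuation L (WithTop ℤ)) : Antitone (lowerRam (K₀ p k) v) := by
  intro i j hij g hg π hπ
  exact le_trans (by exact_mod_cast (by linarith)) (hg π hπ)

omit hv [IsAlgClosed k] in
theorem card_lowerRam_antitone (v : AddValuation L (WithTop ℤ)) :
    Antitone fun t => (Nat.card (lowerRam (K₀ p k) v t) : ℝ) / Nat.card (lowerRam (K₀ p k) v 0) := by
  intro i j hij
  have : Nat.card (lowerRam (K₀ p k) v j) ≤ Nat.card (lowerRam (K₀ p k) v i) :=
    Nat.card_mono (Set.toFinite _) (lowerRam_antitone v hij)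
  dsimp only
  gcongr

omit hv [IsAlgClosed k] in
theorem card_lowerRam_pos (v : AddValuation L (WithTop ℤ)) (i : ℝ) :
    1 ≤ Nat.card (lowerRam (K₀ p k) v i) := by
  have : Nonempty (lowerRam (K₀ p k) v i) := ⟨⟨1, one_mem_lowerRam v i⟩⟩
  exact Nat.one_le_iff_ne_zero.2 Nat.card_pos.ne'

omit hv [IsAlgClosed k] in
-- φ is continuous, vanishes at 0 and has slope at least 1/|G₀|, so the intermediate value theorem
-- applies. This makes the value of `herbrandPsi` a genuine preimage.
theorem herbrandPhi_surjOn (v : AddValuation L (WithTop ℤ)) {i : ℝ} (hi : 0 ≤ i) :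
    ∃ u ∈ Set.Ici (0 : ℝ), herbrandPhi (K₀ p k) v u = i := by
  set N : ℝ := ((Nat.card (lowerRam (K₀ p k) v 0) : ℕ) : ℝ)
  have hN1 : 1 ≤ N := Nat.one_le_cast.2 (card_lowerRam_pos (p := p) (k := k) v 0)
  have hcont : Continuous (herbrandPhi (K₀ p k) v) :=
    intervalIntegral.continuous_primitive
      (fun a b => (card_lowerRam_antitone v).intervalIntegrable) 0
  have h0 : herbrandPhi (K₀ p k) v 0 = 0 := intervalIntegral.integral_same
  have hlow : i ≤ herbrandPhi (K₀ p k) v (i * N) := by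
    have h1 : ∫ _ in (0 : ℝ)..(i * N), (1 / N) ≤ herbrandPhi (K₀ p k) v (i * N) := by
      refine intervalIntegral.integral_mono_on (by positivity) (by simp)
        (card_lowerRam_antitone v).intervalIntegrable fun t _ => ?_
      have : (1 : ℝ) ≤ Nat.card (lowerRam (K₀ p k) v t) := by
        exact_mod_cast card_lowerRam_pos (p := p) (k := k) v t
      gcongr
    rw [intervalIntegral.integral_const, smul_eq_mul, sub_zero] at h1
    field_simp at h1
    exact h1
  obtain ⟨u, hu, h⟩ := intermediate_value_Icc (a := 0) (b := i * N) (by positivity)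
    hcont.continuousOn ⟨h0.le.trans hi, hlow⟩
  exact ⟨u, hu.1, h⟩

/-- Exchanging sum and integral in the definition of φ gives (φ(u) + 1)|G| = ∑_g min(i(g), u + 1),
where G₀ = G by total ramification. The terms only grow when u + 1 is replaced by i₀. -/
theorem herbrandPhi_le {π : L} (hπ : v π = 1) {i₀ : ℤ} {u : ℝ} (hu : 0 ≤ u) (hui : u + 1 ≤ i₀)
    {n : (L ≃ₐ[K₀ p k] L) → ℤ} (hn : ∀ g, min (i₀ : WithTop ℤ) (v (g π - π)) = n g) :
    (herbrandPhi (K₀ p k) v u + 1) * Nat.card (L ≃ₐ[K₀ p k] L) ≤ ((∑ g, n g : ℤ) : ℝ) := by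
  classical
  have hcard0 : Nat.card (lowerRam (K₀ p k) v 0) = Nat.card (L ≃ₐ[K₀ p k] L) := by
    have : lowerRam (K₀ p k) v 0 = Set.univ := by
      refine Set.eq_univ_of_forall fun g => ?_
      by_cases hg : g = 1
      · rw [hg]; exact one_mem_lowerRam v 0
      · obtain ⟨n, hn1, hn⟩ := exists_val_algEquiv_sub hv hπ hg
        rw [mem_lowerRam_iff_of_eq hv hπ hn, zero_add]
        exact_mod_cast hn1
    rw [this, Nat.card_univ]
  have hG : (0 : ℝ) < Nat.card (L ≃ₐ[K₀ p k] L) := by exact_mod_cast Nat.card_pos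
  have hcard : ∀ t, (Nat.card (lowerRam (K₀ p k) v t) : ℝ) =
      ∑ g : L ≃ₐ[K₀ p k] L, if g ∈ lowerRam (K₀ p k) v t then (1 : ℝ) else 0 := by
    intro t
    rw [Finset.sum_boole, Nat.card_eq_fintype_card]
    norm_cast
    exact Fintype.card_subtype _
  have hint : ∀ g : L ≃ₐ[K₀ p k] L, ∀ a b, IntervalIntegrable
      (fun t => if g ∈ lowerRam (K₀ p k) v t then (1 : ℝ) else 0) MeasureTheory.volume a b := by
    intro g a b
    refine Antitone.intervalIntegrable fun s t hst => ?_
    by_cases ht : g ∈ lowerRam (K₀ p k) v t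
    · simp [ht, lowerRam_antitone v hst ht]
    · simp only [ht, if_false]; split_ifs <;> norm_num
  have hphi : herbrandPhi (K₀ p k) v u * Nat.card (L ≃ₐ[K₀ p k] L) =
      ∑ g : L ≃ₐ[K₀ p k] L, ∫ t in (0 : ℝ)..u,
        if g ∈ lowerRam (K₀ p k) v t then (1 : ℝ) else 0 := by
    unfold herbrandPhi
    rw [hcard0, intervalIntegral.integral_div, div_mul_cancel₀ _ hG.ne',
      ← intervalIntegral.integral_finsetSum fun g _ => hint g 0 u]
    simp_rw [hcard]
  have hg : ∀ g : L ≃ₐ[K₀ p k] L, (∫ t in (0 : ℝ)..u,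
      if g ∈ lowerRam (K₀ p k) v t then (1 : ℝ) else 0) ≤ n g - 1 := by
    intro g
    by_cases hge : u + 1 ≤ n g
    · calc (∫ t in (0 : ℝ)..u, if g ∈ lowerRam (K₀ p k) v t then (1 : ℝ) else 0)
          ≤ ∫ _ in (0 : ℝ)..u, (1 : ℝ) :=
            intervalIntegral.integral_mono_on hu (hint g 0 u) (by simp)
              fun t _ => by split_ifs <;> norm_num
        _ ≤ n g - 1 := by simp; linarith
    · have hlt : (n g : ℝ) < i₀ := (not_le.1 hge).trans_le hui
      have hlt' : n g < i₀ := by exact_mod_cast hlt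
      have hng := hn g
      have hvg : v (g π - π) = n g := by
        rcases min_choice (i₀ : WithTop ℤ) (v (g π - π)) with h | h
        · rw [h] at hng
          norm_cast at hng
          omega
        · rw [← h, hng]
      have hg1 : g ≠ 1 := by
        rintro rfl
        simp at hvg
      obtain ⟨m, hm1, hm⟩ := exists_val_algEquiv_sub hv hπ hg1
      have hmn : m = n g := by rw [hm] at hvg; exact_mod_cast hvg
      subst hmn
      -- Here i(g) < u + 1, so g contributes exactly the length i(g) - 1 of the interval on which it
      -- lies in G_t.
      have hset : (fun t => if g ∈ lowerRam (K₀ p k) v t then (1 : ℝ) else 0) =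
          {t | t ≤ (n g - 1 : ℝ)}.indicator fun _ => 1 := by
        funext t
        simp only [Set.indicator_apply, Set.mem_ofPred_eq]
        congr 1
        rw [mem_lowerRam_iff_of_eq hv hπ hvg, le_sub_iff_add_le]
      have hm1' : (1 : ℝ) ≤ n g := by exact_mod_cast hm1
      rw [hset, intervalIntegral.integral_indicator ⟨by linarith, by linarith [not_le.1 hge]⟩]
      simp
  rw [add_mul, one_mul, hphi]
  calc _ ≤ ∑ g : L ≃ₐ[K₀ p k] L, ((n g : ℝ) - 1) + Nat.card (L ≃ₐ[K₀ p k] L) := by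
        gcongr with g
        exact hg g
    _ = _ := by
        rw [Finset.sum_sub_distrib, Nat.card_eq_fintype_card]
        simp

/-- If the conductor exceeds `B`, then `∑_g min(i(g), i₀) > (B + 1) |G|`, where `i(g) = v(gπ - π)`
and `i₀` is the largest finite value of `i`. -/
theorem exists_ramification_of_lt_conductor {π : L} (hπ : v π = 1) {B : ℝ} (hB : 0 ≤ B)
    (h : B < conductor (K₀ p k) v) :
    ∃ i₀ D : ℤ, 1 ≤ i₀ ∧ (∃ g : L ≃ₐ[K₀ p k] L, g ≠ 1 ∧ v (g π - π) = i₀) ∧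
      ∑ g : L ≃ₐ[K₀ p k] L, min (i₀ : WithTop ℤ) (v (g π - π)) = D ∧
      (B + 1) * Nat.card (L ≃ₐ[K₀ p k] L) < D := by
  classical
  -- The supremum of the empty set is 0, which cannot exceed B ≥ 0.
  have hne : {i : ℝ | 0 ≤ i ∧ upperRam (K₀ p k) v i ≠ {1}}.Nonempty := by
    by_contra hemp
    rw [Set.not_nonempty_iff_eq_empty] at hemp
    unfold conductor at h
    rw [hemp, Real.sSup_empty] at h
    exact absurd h (not_lt.2 hB)
  obtain ⟨i, ⟨hi0, hi⟩, hBi⟩ := exists_lt_of_lt_csSup hne h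
  have hsurj := herbrandPhi_surjOn (p := p) (k := k) v hi0
  have hψ0 : 0 ≤ herbrandPsi (K₀ p k) v i := Function.invFunOn_mem hsurj
  have hψ : herbrandPhi (K₀ p k) v (herbrandPsi (K₀ p k) v i) = i := Function.invFunOn_eq hsurj
  obtain ⟨g₁, hg₁, hg₁1⟩ : ∃ g ∈ upperRam (K₀ p k) v i, g ≠ 1 := by
    by_contra! hcon
    exact hi (Set.eq_singleton_iff_unique_mem.2 ⟨one_mem_lowerRam v _, hcon⟩)
  -- g₀ realizes the largest finite i; the nontrivial g₁ in G^i then forces ψ(i) + 1 ≤ i₀.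
  obtain ⟨g₀, hg₀, hmax⟩ := (Finset.univ.filter fun g : L ≃ₐ[K₀ p k] L => g ≠ 1).exists_max_image
    (fun g => v (g π - π)) ⟨g₁, by simpa using hg₁1⟩
  have hg₀1 : g₀ ≠ 1 := (Finset.mem_filter.1 hg₀).2
  obtain ⟨i₀, hi₀1, hi₀⟩ := exists_val_algEquiv_sub hv hπ hg₀1
  obtain ⟨n₁, hn₁1, hn₁⟩ := exists_val_algEquiv_sub hv hπ hg₁1
  have hle := hmax g₁ (by simpa using hg₁1)
  rw [hn₁, hi₀, WithTop.coe_le_coe] at hle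
  have hu : herbrandPsi (K₀ p k) v i + 1 ≤ i₀ :=
    ((mem_lowerRam_iff_of_eq hv hπ hn₁).1 hg₁).trans (by exact_mod_cast hle)
  have hn : ∀ g : L ≃ₐ[K₀ p k] L, ∃ n : ℤ, min (i₀ : WithTop ℤ) (v (g π - π)) = n := by
    intro g
    by_cases hg : g = 1
    · exact ⟨i₀, by simp [hg]⟩
    · obtain ⟨n, -, hn⟩ := exists_val_algEquiv_sub hv hπ hg
      exact ⟨min i₀ n, by rw [hn]; rfl⟩
  choose n hn using hn
  have hphi := herbrandPhi_le hv hπ hψ0 hu hn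
  rw [hψ] at hphi
  refine ⟨i₀, ∑ g, n g, hi₀1, ⟨g₀, hg₀1, hi₀⟩, ?_, lt_of_lt_of_le ?_ hphi⟩
  · simp_rw [hn]
    norm_cast
  · have hG : (0 : ℝ) < Nat.card (L ≃ₐ[K₀ p k] L) := by exact_mod_cast Nat.card_pos
    gcongr

end Conductor

/-! ### Roots of unity -/

section RootsOfUnity

variable {L : Type*} [Field L] (v : AddValuation L (WithTop ℤ))

theorem val_eq_zero_of_pow_eq_one {x : L} {n : ℕ} (hn : n ≠ 0) (hx : x ^ n = 1) : v x = 0 := by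
  have hx0 : x ≠ 0 := by rintro rfl; rw [zero_pow hn] at hx; exact zero_ne_one hx
  obtain ⟨a, ha⟩ := exists_val_eq_coe v hx0
  have h := map_pow_coe v ha n
  rw [hx, v.map_one] at h
  rw [ha]
  norm_cast at h ⊢
  exact ((mul_eq_zero.1 h.symm).resolve_left (by exact_mod_cast hn))

theorem val_sub_one_le_pow {x : L} (hx : 0 ≤ v x) (n : ℕ) : v (x - 1) ≤ v (x ^ n - 1) := by
  have := le_val_pow_sub_pow v hx (y := 1) (by simp) le_rfl n
  simpa using this

theorem val_primitiveRoot_sub_one_eq {n : ℕ} (hn : 0 < n) {x y : L} (hx : IsPrimitiveRoot x n)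
    (hy : IsPrimitiveRoot y n) : v (x - 1) = v (y - 1) := by
  have : NeZero n := ⟨hn.ne'⟩
  have key : ∀ {x y : L}, IsPrimitiveRoot x n → IsPrimitiveRoot y n → v (x - 1) ≤ v (y - 1) := by
    intro x y hx hy
    obtain ⟨i, -, rfl⟩ := hx.eq_pow_of_pow_eq_one hy.pow_eq_one
    exact val_sub_one_le_pow v (val_eq_zero_of_pow_eq_one v hn.ne' hx.pow_eq_one).ge i
  exact le_antisymm (key hx hy) (key hy hx)

variable {p : ℕ} [hp : Fact p.Prime]

/-- p = Φ(1) = ∏ (1 - μ) over the primitive roots μ, and all factors have the same valuation. -/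
theorem val_primitiveRoot_sub_one {n : ℕ} {x : L} (hx : IsPrimitiveRoot x (p ^ (n + 1)))
    {e : ℤ} (he : v (p : L) = e) :
    ∃ N : ℤ, v (x - 1) = N ∧ (p ^ n * (p - 1) : ℤ) * N = e := by
  have hpos : 0 < p ^ (n + 1) := pow_pos hp.out.pos _
  have h1 : (p : L) = ∏ μ ∈ primitiveRoots (p ^ (n + 1)) L, (1 - μ) := by
    rw [← eval_one_cyclotomic_prime_pow (R := L) n, cyclotomic_eq_prod_X_sub_primitiveRoots hx,
      eval_prod]
    simp
  have h2 : v (p : L) = (p ^ (n + 1)).totient • v (x - 1) := by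
    rw [h1, val_prod, ← hx.card_primitiveRoots, ← Finset.sum_const]
    refine Finset.sum_congr rfl fun μ hμ => ?_
    rw [v.map_sub_swap]
    exact val_primitiveRoot_sub_one_eq v hpos ((mem_primitiveRoots hpos).1 hμ) hx
  have hx1 : x - 1 ≠ 0 := by
    refine sub_ne_zero.2 (hx.ne_one ?_)
    exact Nat.one_lt_pow (Nat.succ_ne_zero n) hp.out.one_lt
  obtain ⟨N, hN⟩ := exists_val_eq_coe v hx1
  refine ⟨N, hN, ?_⟩
  rw [hN, he, Nat.totient_prime_pow_succ hp.out] at h2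
  have h3 : e = (p ^ n * (p - 1) : ℕ) * N := by
    have : (p ^ n * (p - 1)) • (N : WithTop ℤ) = (((p ^ n * (p - 1) : ℕ) * N : ℤ) : WithTop ℤ) := by
      rw [← nsmul_eq_mul, WithTop.coe_nsmul]
    rw [this] at h2
    exact_mod_cast h2
  rw [h3, Nat.cast_mul, Nat.cast_sub hp.out.one_le]
  push_cast
  ring

/-- A nontrivial root of unity of p-power order has a power of order p. That power is at distance
exactly ε from 1, and taking powers never moves away from 1. -/
theorem eq_one_of_val_sub_one {c : ℕ} {x : L} (hx : x ^ p ^ c = 1) {e ε : ℤ}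
    (he : v (p : L) = e) (hε : (p - 1 : ℤ) * ε = e) (h : ((ε + 1 : ℤ) : WithTop ℤ) ≤ v (x - 1)) :
    x = 1 := by
  by_contra hx1
  obtain ⟨j, -, hj⟩ := (Nat.dvd_prime_pow hp.out).1 (orderOf_dvd_of_pow_eq_one hx)
  have hprim : IsPrimitiveRoot x (p ^ j) := hj ▸ IsPrimitiveRoot.orderOf x
  rcases j with _ | j
  · exact hx1 (by simpa using hprim.pow_eq_one)
  have hprim' : IsPrimitiveRoot (x ^ p ^ j) (p ^ (0 + 1)) := by
    have := hprim.pow (pow_pos hp.out.pos _) (pow_succ p j)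
    simpa using this
  obtain ⟨N, hN, hNe⟩ := val_primitiveRoot_sub_one v hprim' he
  have hp2 : (2 : ℤ) ≤ p := by exact_mod_cast hp.out.two_le
  have hNε : N = ε := by
    rw [← hε, pow_zero, one_mul] at hNe
    exact mul_left_cancel₀ (by omega) hNe
  have h2 := h.trans (val_sub_one_le_pow v
    (val_eq_zero_of_pow_eq_one v (pow_pos hp.out.pos c).ne' hx).ge (p ^ j))
  rw [hN, hNε] at h2
  norm_cast at h2
  omega

/-- `v(Φ'(ζ)) = n e - e / (p - 1)` for the `p^n`-th cyclotomic polynomial `Φ`. -/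
theorem val_derivative_cyclotomic {n : ℕ} {x : L} (hx : IsPrimitiveRoot x (p ^ (n + 1)))
    {e ε : ℤ} (he : v (p : L) = e) (hε : (p - 1 : ℤ) * ε = e) :
    v ((derivative (cyclotomic (p ^ (n + 1)) L)).eval x) = (((n + 1) * e - ε : ℤ) : WithTop ℤ) := by
  have hpos : 0 < p ^ (n + 1) := pow_pos hp.out.pos _
  have hprim' : IsPrimitiveRoot (x ^ p ^ n) (p ^ (0 + 1)) := by
    have := hx.pow hpos (pow_succ p n)
    simpa using this
  obtain ⟨N, hN, hNe⟩ := val_primitiveRoot_sub_one v hprim' he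
  have hp2 : (2 : ℤ) ≤ p := by exact_mod_cast hp.out.two_le
  have hNε : N = ε := by
    rw [← hε, pow_zero, one_mul] at hNe
    exact mul_left_cancel₀ (by omega) hNe
  -- Differentiate Φ(X)(X^(p^n) - 1) = X^(p^(n+1)) - 1 and evaluate at x; there x^(p^n) - 1 has
  -- valuation ε.
  have h1 := congrArg (fun q => (derivative q).eval x) (cyclotomic_prime_pow_mul_X_pow_sub_one L p n)
  have hroot : (cyclotomic (p ^ (n + 1)) L).eval x = 0 := by
    rw [cyclotomic_eq_prod_X_sub_primitiveRoots hx, eval_prod]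
    exact Finset.prod_eq_zero ((mem_primitiveRoots hpos).2 hx) (by simp)
  simp only [derivative_mul, derivative_sub, derivative_X_pow, derivative_one, eval_add, eval_mul,
    eval_sub, eval_pow, eval_X, eval_one, hroot, zero_mul, add_zero, eval_C,
    sub_zero] at h1
  have h2 : v (x ^ (p ^ (n + 1) - 1)) = 0 := by
    have := map_pow_coe v (a := 0) (val_eq_zero_of_pow_eq_one v hpos.ne' hx.pow_eq_one)
      (p ^ (n + 1) - 1)
    simpa using this
  have h3 := congrArg v h1
  rw [v.map_mul, v.map_mul, h2, add_zero, hN, hNε, Nat.cast_pow, map_pow_coe v he] at h3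
  rcases h4 : v ((derivative (cyclotomic (p ^ (n + 1)) L)).eval x) with _ | r
  · rw [h4] at h3
    change (⊤ : WithTop ℤ) + _ = _ at h3
    rw [WithTop.top_add] at h3
    exact absurd h3.symm WithTop.coe_ne_top
  · rw [h4] at h3
    change (r : WithTop ℤ) + _ = _ at h3
    change (r : WithTop ℤ) = _
    norm_cast at h3
    rw [WithTop.coe_eq_coe]
    push_cast at h3
    linarith

end RootsOfUnity

/-! ### Roots of `x ^ q = 1 + t` close to `1` -/

section CloseRoots

variable {L : Type*} [Field L] (v : AddValuation L (WithTop ℤ))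

theorem prod_sub_eq_pow_sub {R : Type*} [CommRing R] [Algebra L R] [DecidableEq L] {q : ℕ}
    (hq : 0 < q) {ξ : L} (hξ : IsPrimitiveRoot ξ q) {x a : L} (hx : x ^ q = a) (hx0 : x ≠ 0)
    (Z : R) : ∏ s ∈ (Finset.range q).image fun i => ξ ^ i * x, (Z - algebraMap L R s) =
      Z ^ q - algebraMap L R a := by
  rw [Finset.prod_image]
  · have h := congrArg (aeval Z) (X_pow_sub_C_eq_prod hξ hq hx)
    rw [map_prod] at h
    simpa using h.symm
  · intro i hi j hj hij
    exact hξ.pow_inj (by simpa using hi) (by simpa using hj) (mul_right_cancel₀ hx0 hij)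

/-- Some `q`-th root `ηx` of `1 + t` is so close to `1` that no term in the binomial expansion
of `(1 + (ηx - 1))^q - 1` is larger than the sum. -/
theorem exists_root_close_to_one {q : ℕ} (hq : 0 < q) {ξ : L} (hξ : IsPrimitiveRoot ξ q)
    {x t : L} (hx : x ^ q = 1 + t) (hx0 : x ≠ 0) {R : ℕ} (hR : ((R : ℤ) : WithTop ℤ) ≤ v t) :
    ∃ η : L, η ^ q = 1 ∧ ∃ r : ℕ, ((r : ℤ) : WithTop ℤ) ≤ v (η * x - 1) ∧
      ∀ j, 1 ≤ j → j ≤ q →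
        ((R : ℤ) : WithTop ℤ) ≤ v ((q.choose j : ℕ) : L) + ((j * r : ℤ) : WithTop ℤ) := by
  classical
  by_cases ht : t = 0
  · refine ⟨x⁻¹, by rw [inv_pow, hx, ht]; simp, R, by rw [inv_mul_cancel₀ hx0]; simp, ?_⟩
    intro j hj _
    have h1 := int_le_add (a := 0) (map_natCast_nonneg v (q.choose j))
      (le_refl (((j * R : ℤ)) : WithTop ℤ))
    refine int_le_mono h1 ?_
    rw [zero_add]
    have : (1 : ℤ) ≤ j := by exact_mod_cast hj
    nlinarith
  set S : Finset L := (Finset.range q).image fun i => ξ ^ i * x with hS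
  have hSne : S.Nonempty := ⟨x, Finset.mem_image.2 ⟨0, by simpa using hq, by simp⟩⟩
  have hSpow : ∀ s ∈ S, s ^ q = 1 + t := by
    intro s hs
    obtain ⟨i, -, rfl⟩ := Finset.mem_image.1 hs
    rw [mul_pow, ← pow_mul, mul_comm i q, pow_mul, hξ.pow_eq_one, one_pow, one_mul, hx]
  obtain ⟨s₀, hs₀, hmax⟩ := S.exists_max_image (fun s => v (s - 1)) hSne
  have hs₀1 : s₀ - 1 ≠ 0 := by
    intro h
    have := hSpow s₀ hs₀
    rw [sub_eq_zero.1 h, one_pow] at this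
    exact ht (by linear_combination -this)
  obtain ⟨ρ, hρ⟩ := exists_val_eq_coe v hs₀1
  have hprod1 : ∏ s ∈ S, (1 - s) = -t := by
    have := prod_sub_eq_pow_sub hq hξ hx hx0 (1 : L)
    rw [one_pow] at this
    simp only [Algebra.algebraMap_self, RingHom.id_apply] at this
    rw [hS, this]; ring
  -- ρ is the valuation of s - 1 at the root s nearest to 1, so each factor X + (1 - s) has Gauss
  -- valuation v(1 - s) and the product has exactly v(t). The bounds are then read off
  -- coefficientwise.
  have hgauss : gaussVal v ρ ((1 + X) ^ q - C (1 + t)) = v t := by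
    have h1 := prod_sub_eq_pow_sub hq hξ hx hx0 (1 + X : L[X])
    rw [← hS] at h1
    simp only [algebraMap_eq] at h1
    rw [← h1, val_prod, ← v.map_neg t, ← hprod1, val_prod]
    refine Finset.sum_congr rfl fun s hs => ?_
    have : (1 + X - C s : L[X]) = X + C (1 - s) := by rw [C_sub, C_1]; ring
    rw [this, gaussVal_X_add_C, v.map_sub_swap, min_eq_right]
    exact hρ ▸ hmax s hs
  have hcoef : ∀ j, 1 ≤ j → ((R : ℤ) : WithTop ℤ) ≤
      v ((q.choose j : ℕ) : L) + ((j * ρ : ℤ) : WithTop ℤ) := by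
    intro j hj
    have h1 := hR
    rw [← hgauss, int_le_gaussVal] at h1
    have h2 := h1 j
    rw [coeff_sub, coeff_C_of_ne_zero (by omega), sub_zero, coeff_one_add_X_pow] at h2
    exact int_le_add_coe.2 h2
  have hρ0 : 0 ≤ ρ := by
    have h1 := hcoef q hq
    rw [Nat.choose_self, Nat.cast_one, v.map_one, zero_add] at h1
    norm_cast at h1
    by_contra hneg
    have hq' : (0 : ℤ) < q := by exact_mod_cast hq
    nlinarith
  obtain ⟨r, rfl⟩ := Int.eq_ofNat_of_zero_le hρ0
  obtain ⟨i, -, hi⟩ := Finset.mem_image.1 hs₀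
  refine ⟨ξ ^ i, ?_, r, ?_, fun j hj _ => hcoef j hj⟩
  · rw [← pow_mul, mul_comm i q, pow_mul, hξ.pow_eq_one, one_pow]
  · rw [hi, hρ]

end CloseRoots

/-! ### The generic point of the disc of radius `i₀` around a uniformizer -/

section GenericPoint

variable {p : ℕ} [hp : Fact p.Prime] {k : Type*} [Field k] [CharP k p]
  {L : Type*} [Field L] [Algebra (K₀ p k) L]

/-- The polynomial over `L` attached to a polynomial over `W(k)`. -/
noncomputable def wittPoly (L : Type*) [Field L] [Algebra (K₀ p k) L]
    (V : (WittVector p k)[X]) : L[X] := V.map (ofWitt p k L)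

theorem wittPoly_eq_eval₂ (V : (WittVector p k)[X]) :
    wittPoly L V = V.eval₂ ((C : L →+* L[X]).comp (ofWitt p k L)) X := by
  rw [← eval₂_map, ← wittPoly, eval₂_C_X]

theorem wittPoly_comp (U V : (WittVector p k)[X]) :
    wittPoly L (U.comp V) = U.eval₂ ((C : L →+* L[X]).comp (ofWitt p k L)) (wittPoly L V) := by
  rw [← eval₂_map, wittPoly, wittPoly, Polynomial.map_comp]
  rfl

theorem wittPoly_map (h : L ≃ₐ[K₀ p k] L) (V : (WittVector p k)[X]) :
    (wittPoly L V).map (h : L →+* L) = wittPoly L V := by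
  rw [wittPoly, Polynomial.map_map]
  congr 1
  exact RingHom.ext fun a => algEquiv_ofWitt h a

/-- `w` is a valuation on `L[X]` extending `v` and making `X` a good approximation of the
uniformizer `π`: polynomials over `W(k)` vanishing at `π` have valuation at least `D`.
Moreover `w` is invariant under the action of `H` on coefficients. -/
structure IsGenericPoint (p : ℕ) [Fact p.Prime] (k : Type*) [Field k] [CharP k p]
    {L : Type*} [Field L] [Algebra (K₀ p k) L] (v : AddValuation L (WithTop ℤ)) (π : L) (D : ℤ)
    (H : Set (L ≃ₐ[K₀ p k] L)) (w : AddValuation L[X] (WithTop ℤ)) : Prop where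
  val_C : ∀ a, w (C a) = v a
  val_X : w X = 1
  val_root : ∀ Q : (WittVector p k)[X], Q.eval₂ (ofWitt p k L) π = 0 →
    (D : WithTop ℤ) ≤ w (wittPoly L Q)
  inertia : ∀ h ∈ H, ∀ (f : L[X]) (a : ℤ), (a : WithTop ℤ) ≤ w f →
    (a : WithTop ℤ) ≤ w (f.map (h : L →+* L))

variable {v : AddValuation L (WithTop ℤ)} (hv : IsNormalizedVal p k v) {π : L} (hπ : v π = 1)

/-- The value D is that of the minimal polynomial P = ∏ (X - gπ), factor by factor. A
W(k)-polynomial vanishing at π vanishes at all gπ, so P divides it with integral quotient. Elements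
h with v(hπ - π) ≥ i₀ merely move the centre inside the disc. -/
theorem isGenericPoint_discVal [IsAlgClosed k] [FiniteDimensional (K₀ p k) L]
    (hv : IsNormalizedVal p k v) (hπ : v π = 1)
    {i₀ : ℤ} (hi₀ : 1 ≤ i₀) {D : ℤ}
    (hD : ∑ g : L ≃ₐ[K₀ p k] L, min (i₀ : WithTop ℤ) (v (g π - π)) = D) :
    IsGenericPoint p k v π D {h | (i₀ : WithTop ℤ) ≤ v (h π - π)} (discVal v i₀ π) where
  val_C := discVal_C v i₀ π
  val_X := by
    have := discVal_X_sub_C v i₀ π 0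
    rw [C_0, sub_zero, sub_zero, hπ] at this
    rw [this, min_eq_right]
    exact_mod_cast hi₀
  val_root := by
    intro Q hQ
    have hX : discVal v i₀ π X = 1 := by
      have := discVal_X_sub_C v i₀ π 0
      rw [C_0, sub_zero, sub_zero, hπ] at this
      rw [this, min_eq_right]
      exact_mod_cast hi₀
    set P : L[X] := ∏ g : L ≃ₐ[K₀ p k] L, (X - C (g π)) with hP
    have hwP : discVal v i₀ π P = D := by
      rw [hP, val_prod, ← hD]
      refine Finset.sum_congr rfl fun g _ => ?_
      rw [discVal_X_sub_C, v.map_sub_swap]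
    have hinj : Function.Injective fun g : L ≃ₐ[K₀ p k] L => g π := by
      intro g g' h
      have : (g'⁻¹ * g) π = π := by
        change g'.symm (g π) = π
        rw [AlgEquiv.symm_apply_eq]
        exact h
      exact (inv_mul_eq_one.1 (algEquiv_eq_one_of_uniformizer hv hπ this)).symm
    have hdvd : P ∣ wittPoly L Q := by
      refine Finset.prod_dvd_of_coprime (fun g _ g' _ hne => pairwise_coprime_X_sub_C hinj hne) ?_
      intro g _
      rw [dvd_iff_isRoot, IsRoot, wittPoly, eval_map, ← algEquiv_eval₂_ofWitt, hQ, map_zero]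
    obtain ⟨S, hS⟩ := hdvd
    have hmonic : P.Monic := monic_prod_of_monic _ _ fun g _ => monic_X_sub_C _
    have hP0 : ∀ i, 0 ≤ v (P.coeff i) := by
      have : ((0 : ℤ) : WithTop ℤ) ≤ gaussVal v 0 P := by
        rw [hP, val_prod]
        refine Finset.sum_nonneg fun g _ => ?_
        rw [sub_eq_add_neg, ← C_neg, gaussVal_X_add_C, v.map_neg, val_algEquiv hv, hπ]
        exact le_min le_rfl zero_le_one
      intro i
      simpa using (int_le_gaussVal v 0).1 this i
    have hS0 := coeff_nonneg_of_monic_mul v (P := P) (S := S) hmonic hP0 (by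
      intro i
      rw [← hS, wittPoly, coeff_map]
      exact val_ofWitt_nonneg hv _)
    have hwS : 0 ≤ discVal v i₀ π S := by
      rw [S.as_sum_range_C_mul_X_pow]
      refine AddValuation.map_le_sum _ fun i _ => ?_
      refine int_le_mono (a := 0) (le_map_mul _ (a := 0) (b := i) ?_ ?_) (by positivity)
      · rw [discVal_C]; exact hS0 i
      · have := map_pow_coe (discVal v i₀ π) (a := 1) hX i
        rw [this, mul_one]
    rw [hS, AddValuation.map_mul, hwP]
    exact le_add_of_nonneg_right hwS
  inertia := by
    intro h hh f a ha
    have h1 := int_le_discVal_map v i₀ (σ := (h : L →+* L)) (val_algEquiv hv h) ha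
    refine int_le_discVal_of_center v i₀ ?_ h1
    rw [v.map_sub_swap]
    exact hh

/-! ### Lifting elements of `L` to polynomials in the generic point -/

/-- `Z` approximates, with relative precision `κ`, the polynomial obtained by writing
`z = π ^ r V(π)` and replacing `π` by `X`. -/
def Lifts (p : ℕ) [Fact p.Prime] (k : Type*) [Field k] [CharP k p]
    {L : Type*} [Field L] [Algebra (K₀ p k) L] (π : L) (w : AddValuation L[X] (WithTop ℤ)) (κ : ℤ)
    (r : ℕ) (z : L) (Z : L[X]) : Prop :=
  ∃ V : (WittVector p k)[X], z = π ^ r * V.eval₂ (ofWitt p k L) π ∧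
    ((r + κ : ℤ) : WithTop ℤ) ≤ w (Z - X ^ r * wittPoly L V)

variable {D : ℤ} {H : Set (L ≃ₐ[K₀ p k] L)} {w : AddValuation L[X] (WithTop ℤ)}
  (hw : IsGenericPoint p k v π D H w) {κ : ℤ}

theorem Lifts.exact (w : AddValuation L[X] (WithTop ℤ)) (κ : ℤ) (r : ℕ) (V : (WittVector p k)[X]) :
    Lifts p k π w κ r (π ^ r * V.eval₂ (ofWitt p k L) π) (X ^ r * wittPoly L V) :=
  ⟨V, rfl, by simp⟩

theorem Lifts.ofWitt (w : AddValuation L[X] (WithTop ℤ)) (κ : ℤ) (a : WittVector p k) :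
    Lifts p k π w κ 0 (WittKummer.ofWitt p k L a) (C (WittKummer.ofWitt p k L a)) := by
  have := Lifts.exact (π := π) w κ 0 (C a)
  simpa [wittPoly] using this

theorem Lifts.natCast (w : AddValuation L[X] (WithTop ℤ)) (κ : ℤ) (n : ℕ) :
    Lifts p k π w κ 0 (n : L) (n : L[X]) := by
  have := Lifts.ofWitt (p := p) (k := k) (π := π) w κ (n : WittVector p k)
  simpa using this

theorem Lifts.add {r : ℕ} {z₁ z₂ : L} {Z₁ Z₂ : L[X]} (h₁ : Lifts p k π w κ r z₁ Z₁)
    (h₂ : Lifts p k π w κ r z₂ Z₂) : Lifts p k π w κ r (z₁ + z₂) (Z₁ + Z₂) := by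
  obtain ⟨V₁, rfl, h₁⟩ := h₁
  obtain ⟨V₂, rfl, h₂⟩ := h₂
  refine ⟨V₁ + V₂, by rw [eval₂_add]; ring, ?_⟩
  have : Z₁ + Z₂ - X ^ r * wittPoly L (V₁ + V₂) =
      (Z₁ - X ^ r * wittPoly L V₁) + (Z₂ - X ^ r * wittPoly L V₂) := by
    simp only [wittPoly, Polynomial.map_add]; ring
  rw [this]
  exact w.map_le_add h₁ h₂

theorem Lifts.zero (w : AddValuation L[X] (WithTop ℤ)) (κ : ℤ) (r : ℕ) :
    Lifts p k π w κ r 0 0 :=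
  ⟨0, by simp, by simp [wittPoly]⟩

theorem Lifts.sum {ι : Type*} (s : Finset ι) {r : ℕ} {z : ι → L} {Z : ι → L[X]}
    (h : ∀ i ∈ s, Lifts p k π w κ r (z i) (Z i)) :
    Lifts p k π w κ r (∑ i ∈ s, z i) (∑ i ∈ s, Z i) := by
  classical
  induction s using Finset.induction_on with
  | empty => simpa using Lifts.zero w κ r
  | insert i s hi ih =>
    rw [Finset.sum_insert hi, Finset.sum_insert hi]
    exact (h i (Finset.mem_insert_self i s)).add
      (ih fun j hj => h j (Finset.mem_insert_of_mem hj))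

include hv hw

theorem val_wittPoly_nonneg (V : (WittVector p k)[X]) : 0 ≤ w (wittPoly L V) := by
  rw [wittPoly_eq_eval₂]
  refine val_eval₂_nonneg w (fun a => ?_) (by rw [hw.val_X]; exact zero_le_one) V
  rw [RingHom.comp_apply, hw.val_C]
  exact val_ofWitt_nonneg hv a

omit hv in
theorem val_X_pow (r : ℕ) : w (X ^ r) = ((r : ℤ) : WithTop ℤ) := by
  have := map_pow_coe w (a := 1) hw.val_X r
  simpa using this

theorem le_val_X_pow_mul_wittPoly (r : ℕ) (V : (WittVector p k)[X]) :
    ((r : ℤ) : WithTop ℤ) ≤ w (X ^ r * wittPoly L V) := by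
  have := le_map_mul w (b := 0) (val_X_pow hw r).ge (val_wittPoly_nonneg hv hw V)
  simpa using this

theorem Lifts.le_val {r : ℕ} {z : L} {Z : L[X]} (hκ : 0 ≤ κ) (h : Lifts p k π w κ r z Z) :
    ((r : ℤ) : WithTop ℤ) ≤ w Z := by
  obtain ⟨V, -, h⟩ := h
  have h1 : Z = (Z - X ^ r * wittPoly L V) + X ^ r * wittPoly L V := by ring
  rw [h1]
  exact w.map_le_add (int_le_mono h (by omega)) (le_val_X_pow_mul_wittPoly hv hw r V)

omit hv hw in
theorem Lifts.mono {r r' : ℕ} (hr : r ≤ r') {z : L} {Z : L[X]}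
    (h : Lifts p k π w κ r' z Z) : Lifts p k π w κ r z Z := by
  obtain ⟨V, rfl, h⟩ := h
  refine ⟨X ^ (r' - r) * V, ?_, ?_⟩
  · rw [eval₂_mul, eval₂_pow, eval₂_X, ← mul_assoc, ← pow_add, Nat.add_sub_cancel' hr]
  · have : X ^ r * wittPoly L (X ^ (r' - r) * V) = X ^ r' * wittPoly L V := by
      simp only [wittPoly, Polynomial.map_mul, Polynomial.map_pow, Polynomial.map_X]
      rw [← mul_assoc, ← pow_add, Nat.add_sub_cancel' hr]
    rw [this]
    exact int_le_mono h (by omega)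

/-- The precision κ is relative to the orders r₁ and r₂, so it survives multiplication while the
orders add. -/
theorem Lifts.mul (hκ : 0 ≤ κ) {r₁ r₂ : ℕ} {z₁ z₂ : L} {Z₁ Z₂ : L[X]}
    (h₁ : Lifts p k π w κ r₁ z₁ Z₁) (h₂ : Lifts p k π w κ r₂ z₂ Z₂) :
    Lifts p k π w κ (r₁ + r₂) (z₁ * z₂) (Z₁ * Z₂) := by
  have hZ₂ := h₂.le_val hv hw hκ
  obtain ⟨V₁, rfl, h₁⟩ := h₁
  obtain ⟨V₂, rfl, h₂⟩ := h₂
  refine ⟨V₁ * V₂, by rw [eval₂_mul]; ring, ?_⟩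
  have : Z₁ * Z₂ - X ^ (r₁ + r₂) * wittPoly L (V₁ * V₂) =
      (Z₁ - X ^ r₁ * wittPoly L V₁) * Z₂ +
        X ^ r₁ * wittPoly L V₁ * (Z₂ - X ^ r₂ * wittPoly L V₂) := by
    simp only [wittPoly, Polynomial.map_mul]; ring
  rw [this]
  refine w.map_le_add ?_ ?_
  · exact int_le_mono (le_map_mul w h₁ hZ₂) (by push_cast; omega)
  · exact int_le_mono (le_map_mul w (le_val_X_pow_mul_wittPoly hv hw r₁ V₁) h₂)
      (by push_cast; omega)

theorem Lifts.pow (hκ : 0 ≤ κ) {r : ℕ} {z : L} {Z : L[X]} (h : Lifts p k π w κ r z Z) (n : ℕ) :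
    Lifts p k π w κ (n * r) (z ^ n) (Z ^ n) := by
  induction n with
  | zero => simpa using Lifts.natCast (p := p) (k := k) w κ 1
  | succ n ih =>
    rw [Nat.succ_mul, pow_succ, pow_succ]
    exact ih.mul hv hw hκ h

omit hv in
/-- Two approximations of the same element agree up to the precision. -/
theorem Lifts.unique (hκ : κ ≤ D) {r : ℕ} {z : L} {Z Z' : L[X]} (hπ0 : π ≠ 0)
    (h : Lifts p k π w κ r z Z) (h' : Lifts p k π w κ r z Z') :
    ((r + κ : ℤ) : WithTop ℤ) ≤ w (Z - Z') := by
  obtain ⟨V, hV, h⟩ := h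
  obtain ⟨V', hV', h'⟩ := h'
  have hVV : (V - V').eval₂ (WittKummer.ofWitt p k L) π = 0 := by
    rw [eval₂_sub, sub_eq_zero]
    exact mul_left_cancel₀ (pow_ne_zero r hπ0) (hV.symm.trans hV')
  have h1 : Z - Z' = (Z - X ^ r * wittPoly L V) - (Z' - X ^ r * wittPoly L V') +
      X ^ r * wittPoly L (V - V') := by
    simp only [wittPoly, Polynomial.map_sub]; ring
  rw [h1]
  refine w.map_le_add (w.map_le_sub h h') ?_
  exact int_le_mono (le_map_mul w (val_X_pow hw r).ge (hw.val_root _ hVV)) (by omega)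

variable [IsAlgClosed k] [FiniteDimensional (K₀ p k) L]

include hπ

omit hw in
theorem exists_lifts {z : L} {r : ℕ} (hz : ((r : ℤ) : WithTop ℤ) ≤ v z) :
    ∃ V : (WittVector p k)[X], Lifts p k π w κ r z (wittPoly L V) := by
  have hπ0 : π ≠ 0 := by rintro rfl; simp at hπ
  obtain ⟨e, -, he⟩ := exists_val_p hv
  have hπr : v (π ^ r) = ((r : ℤ) : WithTop ℤ) := by simpa using map_pow_coe v (a := 1) hπ r
  obtain ⟨V, -, hV⟩ := exists_poly_of_nonneg hv hπ he
    (int_le_val_div (a := 0) (by simpa using hz) hπr)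
  have hz' : z = π ^ r * V.eval₂ (ofWitt p k L) π := by
    rw [← hV]; field_simp
  refine ⟨X ^ r * V, ?_⟩
  have := Lifts.exact (p := p) (k := k) (π := π) w κ r V
  rw [← hz'] at this
  simpa [wittPoly] using this

/-- The constant p and the lift X^e U of p = π^e U(π) differ by a polynomial vanishing at π, hence
by at least D; this is within precision when κ + e ≤ D. -/
theorem lifts_p {e : ℕ} (he : v (p : L) = ((e : ℤ) : WithTop ℤ)) (hκ : κ + e ≤ D) :
    Lifts p k π w κ e (p : L) (p : L[X]) := by
  obtain ⟨V, hV⟩ := exists_lifts (w := w) (κ := κ) hv hπ he.ge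
  obtain ⟨U, hU, h⟩ := hV
  refine ⟨U, hU, ?_⟩
  have h0 : (C (p : WittVector p k) - X ^ e * U).eval₂ (ofWitt p k L) π = 0 := by
    rw [eval₂_sub, eval₂_mul, eval₂_C, eval₂_pow, eval₂_X, map_natCast, ← hU, sub_self]
  have h1 := hw.val_root _ h0
  have h2 : wittPoly L (C (p : WittVector p k) - X ^ e * U) = (p : L[X]) - X ^ e * wittPoly L U := by
    simp [wittPoly]
  rw [h2] at h1
  exact int_le_mono h1 (by omega)

theorem lifts_natCast {e : ℕ} (he : v (p : L) = ((e : ℤ) : WithTop ℤ)) (hκ0 : 0 ≤ κ)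
    (hκ : κ + e ≤ D) {n : ℕ} (hn : n ≠ 0) :
    ∃ s : ℕ, v (n : L) = ((s : ℤ) : WithTop ℤ) ∧ Lifts p k π w κ s (n : L) (n : L[X]) := by
  obtain ⟨a, m, hm, rfl⟩ := Nat.exists_eq_pow_mul_and_not_dvd hn p hp.out.ne_one
  refine ⟨a * e, ?_, ?_⟩
  · have hu : IsUnit (m : WittVector p k) := by
      refine WittVector.isUnit_of_coeff_zero_ne_zero _ ?_
      change WittVector.constantCoeff (m : WittVector p k) ≠ 0
      rw [map_natCast]
      exact (CharP.cast_eq_zero_iff k p m).not.2 hm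
    have h1 := val_ofWitt_of_isUnit hv hu
    rw [map_natCast] at h1
    rw [Nat.cast_mul, Nat.cast_pow, v.map_mul, h1, add_zero, map_pow_coe v he]
    push_cast
    rfl
  · rw [Nat.cast_mul, Nat.cast_pow, Nat.cast_mul, Nat.cast_pow]
    exact ((lifts_p hv hπ hw he hκ).pow hv hw hκ0 a).mul hv hw hκ0 (Lifts.natCast w κ m)

/-- Every term of the binomial expansion is a lift of order at least R, the powers of p in the
binomial coefficients included, so (1 + Y)^q - 1 has absolute precision R + κ. Expanding (1 + Y)^q
directly would give only κ. -/
theorem Lifts.binomial {e : ℕ} (he : v (p : L) = ((e : ℤ) : WithTop ℤ)) (hκ0 : 0 ≤ κ)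
    (hκ : κ + e ≤ D) {r R q : ℕ} {y : L} {Y : L[X]} (h : Lifts p k π w κ r y Y)
    (hR : ∀ j, 1 ≤ j → j ≤ q →
      ((R : ℤ) : WithTop ℤ) ≤ v ((q.choose j : ℕ) : L) + ((j * r : ℤ) : WithTop ℤ)) :
    Lifts p k π w κ R ((1 + y) ^ q - 1) ((1 + Y) ^ q - 1) := by
  have key : ∀ {A : Type _} [CommRing A] (y : A), (1 + y) ^ q - 1 =
      ∑ j ∈ Finset.range q, ((q.choose (j + 1) : ℕ) : A) * y ^ (j + 1) := by
    intro A _ y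
    rw [add_comm, add_pow, Finset.sum_range_succ']
    simp [mul_comm]
  rw [key, key]
  refine Lifts.sum _ fun j hj => ?_
  have hj : j + 1 ≤ q := Finset.mem_range.1 hj
  obtain ⟨s, hs, hs'⟩ := lifts_natCast hv hπ hw he hκ0 hκ (Nat.choose_pos hj).ne'
  refine Lifts.mono ?_ (hs'.mul hv hw hκ0 (h.pow hv hw hκ0 (j + 1)))
  have := hR (j + 1) (by omega) hj
  rw [hs] at this
  norm_cast at this

end GenericPoint

/-! ### Krasner's argument at the generic point: what inertia fixes -/

section Inertia

variable {p : ℕ} [hp : Fact p.Prime] {k : Type*} [Field k] [CharP k p]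
  {L : Type*} [Field L] [Algebra (K₀ p k) L]
  {v : AddValuation L (WithTop ℤ)} {π : L} {D : ℤ} {H : Set (L ≃ₐ[K₀ p k] L)}
  {w : AddValuation L[X] (WithTop ℤ)} (hw : IsGenericPoint p k v π D H w)

include hw

/-- An element that is well approximated over `K₀(X)` is almost fixed by inertia. -/
theorem val_sub_algEquiv_of_close {h : L ≃ₐ[K₀ p k] L} (hh : h ∈ H) {V : (WittVector p k)[X]}
    {a : L} {b : ℤ} (hb : (b : WithTop ℤ) ≤ w (wittPoly L V - C a)) :
    (b : WithTop ℤ) ≤ v (h a - a) := by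
  have h1 := hw.inertia h hh _ _ hb
  rw [Polynomial.map_sub, wittPoly_map, Polynomial.map_C] at h1
  have h2 := w.map_le_sub hb h1
  rw [sub_sub_sub_cancel_left, ← C_sub, hw.val_C] at h2
  exact h2

variable {e : ℕ} (he : v (p : L) = ((e : ℤ) : WithTop ℤ)) {ε : ℤ} (hε : (p - 1 : ℤ) * ε = e)

include he hε

/-- Φ(F) vanishes at π, so w(Φ(F)) ≥ D. Krasner's argument loses v(Φ'(ζ')) = (n + 1)e - ε. -/
theorem exists_close_primitiveRoot {n : ℕ} {ζ : L} (hζ : IsPrimitiveRoot ζ (p ^ (n + 1)))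
    {F : (WittVector p k)[X]} (hF : F.eval₂ (ofWitt p k L) π = ζ) :
    ∃ ζ' : L, IsPrimitiveRoot ζ' (p ^ (n + 1)) ∧
      ((D - (n + 1) * e + ε : ℤ) : WithTop ℤ) ≤ w (wittPoly L F - C ζ') := by
  classical
  have hpos : 0 < p ^ (n + 1) := pow_pos hp.out.pos _
  have hcyc := cyclotomic_eq_prod_X_sub_primitiveRoots hζ
  have hroot : ((cyclotomic (p ^ (n + 1)) (WittVector p k)).comp F).eval₂ (ofWitt p k L) π = 0 := by
    rw [eval₂_comp, hF, ← eval_map, map_cyclotomic, hcyc, eval_prod]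
    exact Finset.prod_eq_zero ((mem_primitiveRoots hpos).2 hζ) (by simp)
  have h1 := hw.val_root _ hroot
  have h2 : wittPoly L ((cyclotomic (p ^ (n + 1)) (WittVector p k)).comp F) =
      ∏ μ ∈ primitiveRoots (p ^ (n + 1)) L, (wittPoly L F - algebraMap L L[X] μ) := by
    rw [wittPoly, Polynomial.map_comp, map_cyclotomic, hcyc, prod_comp]
    simp [wittPoly]
  rw [h2] at h1
  obtain ⟨ζ', hζ', h3⟩ := exists_close_root v w hw.val_C (primitiveRoots (p ^ (n + 1)) L)
    ⟨ζ, (mem_primitiveRoots hpos).2 hζ⟩ (wittPoly L F) h1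
  have hprim := (mem_primitiveRoots hpos).1 hζ'
  refine ⟨ζ', hprim, ?_⟩
  rw [prod_erase_eq_derivative _ hζ', ← hcyc, val_derivative_cyclotomic v hprim he hε,
    int_le_add_coe] at h3
  refine int_le_mono h3 (by linarith)

/-- For D > (n + 1)e the approximation is better than ε, so hζ'/ζ' is a root of unity too close to 1
to be different from it. -/
theorem algEquiv_primitiveRoot_eq [IsAlgClosed k] [FiniteDimensional (K₀ p k) L]
    (hv : IsNormalizedVal p k v) (hπ : v π = 1) {n : ℕ} {ζ : L}
    (hζ : IsPrimitiveRoot ζ (p ^ (n + 1))) (hD : (n + 1) * e < D) {h : L ≃ₐ[K₀ p k] L}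
    (hh : h ∈ H) {η : L} (hη : η ^ p ^ (n + 1) = 1) : h η = η := by
  have hpos : 0 < p ^ (n + 1) := pow_pos hp.out.pos _
  have : NeZero (p ^ (n + 1)) := ⟨hpos.ne'⟩
  have hζ0 : v ζ = 0 := val_eq_zero_of_pow_eq_one v hpos.ne' hζ.pow_eq_one
  obtain ⟨F, -, hF⟩ := exists_poly_of_nonneg hv hπ he hζ0.ge
  obtain ⟨ζ', hζ', hc⟩ := exists_close_primitiveRoot hw he hε hζ hF.symm
  have h1 := val_sub_algEquiv_of_close hw hh hc
  have hζ'0 : ζ' ≠ 0 := hζ'.ne_zero hpos.ne'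
  have h2 : h ζ' / ζ' = 1 := by
    refine eq_one_of_val_sub_one v (c := n + 1) (e := e) (ε := ε) ?_ he hε ?_
    · rw [div_pow, ← map_pow, hζ'.pow_eq_one, map_one, div_one]
    · have h3 : h ζ' - ζ' = (h ζ' / ζ' - 1) * ζ' := by field_simp
      rw [h3, v.map_mul, val_eq_zero_of_pow_eq_one v hpos.ne' hζ'.pow_eq_one, add_zero] at h1
      exact int_le_mono h1 (by linarith)
  have h3 : h ζ' = ζ' := (div_eq_one_iff_eq hζ'0).1 h2
  obtain ⟨i, -, rfl⟩ := hζ'.eq_pow_of_pow_eq_one hη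
  rw [map_pow, h3]

/-- If a `p^c`-th root of `a` is well approximated over `K₀(X)`, then all of them are fixed by
inertia. -/
theorem algEquiv_root_eq {c : ℕ} {ξ : L} (hξ : IsPrimitiveRoot ξ (p ^ c)) {x a : L}
    (hx : x ^ p ^ c = a) {s : ℤ} (hs : v a = s) {V : (WittVector p k)[X]}
    (hV : ((s + c * e + ε + 1 : ℤ) : WithTop ℤ) ≤ w (wittPoly L V ^ p ^ c - C a))
    {h : L ≃ₐ[K₀ p k] L} (hh : h ∈ H) (ha : h a = a) (hη : ∀ η : L, η ^ p ^ c = 1 → h η = η) :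
    h x = x := by
  classical
  have hpos : 0 < p ^ c := pow_pos hp.out.pos _
  have hx0 : x ≠ 0 := by
    rintro rfl
    rw [zero_pow hpos.ne'] at hx
    exact ne_zero_of_val_eq_coe hs hx.symm
  obtain ⟨r, hr⟩ := exists_val_eq_coe v hx0
  have hqr : s = (p ^ c : ℕ) * r := by
    have := map_pow_coe v hr (p ^ c)
    rw [hx, hs] at this
    exact_mod_cast this
  have hprod := prod_sub_eq_pow_sub hpos hξ hx hx0 (wittPoly L V)
  have hprod' := prod_sub_eq_pow_sub hpos hξ hx hx0 (X : L[X])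
  rw [algebraMap_eq] at hprod hprod'
  rw [← hprod] at hV
  set S : Finset L := (Finset.range (p ^ c)).image fun i => ξ ^ i * x with hS
  obtain ⟨y, hy, h3⟩ := exists_close_root v w hw.val_C S
    ⟨x, Finset.mem_image.2 ⟨0, by simpa using hpos, by simp⟩⟩ (wittPoly L V) hV
  obtain ⟨i, -, hi⟩ := Finset.mem_image.1 hy
  have hξi : (ξ ^ i) ^ p ^ c = 1 := by
    rw [← pow_mul, mul_comm, pow_mul, hξ.pow_eq_one, one_pow]
  have hyr : v y = r := by
    rw [← hi, v.map_mul, val_eq_zero_of_pow_eq_one v hpos.ne' hξi, zero_add, hr]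
  have hy0 : y ≠ 0 := ne_zero_of_val_eq_coe hyr
  -- The product is the derivative p^c y^(p^c - 1) of X^(p^c) - a at y; since s = p^c r, the
  -- remaining precision is r + ε + 1.
  have hder : v (∏ s ∈ S.erase y, (y - s)) = ((c * e + (p ^ c - 1 : ℕ) * r : ℤ) : WithTop ℤ) := by
    rw [prod_erase_eq_derivative _ hy, hprod', derivative_sub, derivative_X_pow, derivative_C,
      sub_zero, eval_mul, eval_C, eval_pow, eval_X, Nat.cast_pow]
    exact map_mul_coe (map_pow_coe v he c) (map_pow_coe v hyr _)
  rw [hder, int_le_add_coe] at h3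
  have hclose : ((r + ε + 1 : ℤ) : WithTop ℤ) ≤ w (wittPoly L V - C y) := by
    refine int_le_mono h3 ?_
    rw [hqr, Nat.cast_sub hpos]
    push_cast
    linarith
  have h4 := val_sub_algEquiv_of_close hw hh hclose
  -- The quotient is a p^c-th root of unity at distance beyond ε from 1.
  have h5 : h y / y = 1 := by
    refine eq_one_of_val_sub_one v (c := c) (e := e) (ε := ε) ?_ he hε ?_
    · have hya : y ^ p ^ c = a := by rw [← hi, mul_pow, hξi, one_mul, hx]
      have ha0 : a ≠ 0 := ne_zero_of_val_eq_coe hs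
      rw [div_pow, ← map_pow, hya, ha, div_self ha0]
    · have h6 : h y - y = (h y / y - 1) * y := by field_simp
      rw [h6, v.map_mul, hyr, int_le_add_coe] at h4
      exact int_le_mono h4 (by linarith)
  have h6 : h y = y := (div_eq_one_iff_eq hy0).1 h5
  rw [← hi, map_mul, hη _ hξi] at h6
  exact mul_left_cancel₀ (pow_ne_zero i (hξ.ne_zero hpos.ne')) h6

end Inertia

/-! ### Approximating elements of the cyclotomic field and their roots -/

/-- The mixed binomial terms gain e from the coefficient and at least μ from E; the pure term E^p
gains pμ. -/
theorem le_val_add_pow_sub_pow {R : Type*} [CommRing R] (w : AddValuation R (WithTop ℤ)) {p : ℕ}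
    (hp : p.Prime) {e σ μ b : ℤ} (he : (e : WithTop ℤ) ≤ w (p : R)) {a E : R}
    (ha : (σ : WithTop ℤ) ≤ w a) (hE : ((σ + μ : ℤ) : WithTop ℤ) ≤ w E) (hμ : 0 ≤ μ)
    (hb : b ≤ e + μ) (hb' : b ≤ p * μ) :
    ((p * σ + b : ℤ) : WithTop ℤ) ≤ w ((a + E) ^ p - a ^ p) := by
  rw [add_pow, Finset.sum_range_succ]
  simp only [Nat.choose_self, Nat.sub_self, pow_zero, mul_one, Nat.cast_one, add_sub_cancel_right]
  refine w.map_le_sum fun j hj => ?_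
  have hj : j < p := Finset.mem_range.1 hj
  have h1 := le_map_mul w (le_map_pow w ha j) (le_map_pow w hE (p - j))
  have hcast : ((p - j : ℕ) : ℤ) = p - j := Nat.cast_sub hj.le
  rw [hcast] at h1
  rcases Nat.eq_zero_or_pos j with rfl | hj0
  · rw [Nat.choose_zero_right, Nat.cast_one, mul_one]
    refine int_le_mono h1 ?_
    push_cast
    nlinarith
  · obtain ⟨m, hm⟩ := hp.dvd_choose_self hj0.ne' hj
    have h2 : (e : WithTop ℤ) ≤ w ((p.choose j : ℕ) : R) := by
      rw [hm, Nat.cast_mul]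
      exact int_le_mono (le_map_mul w he (b := 0) (map_natCast_nonneg w m)) (by simp)
    refine int_le_mono (le_map_mul w h1 h2) ?_
    have h3 : (1 : ℤ) ≤ p - j := by omega
    nlinarith

section Approx

variable {p : ℕ} [hp : Fact p.Prime] {k : Type*} [Field k] [CharP k p]
  {L : Type*} [Field L] [Algebra (K₀ p k) L]

/-- `b` lifts to a polynomial that is close to the constant `b'`. -/
def ApproxBy (p : ℕ) [Fact p.Prime] (k : Type*) [Field k] [CharP k p]
    {L : Type*} [Field L] [Algebra (K₀ p k) L] (π : L) (w : AddValuation L[X] (WithTop ℤ)) (κ : ℤ)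
    (r : ℕ) (b b' : L) : Prop :=
  ∃ B : L[X], Lifts p k π w κ r b B ∧ ((r + κ : ℤ) : WithTop ℤ) ≤ w (B - C b')

theorem le_val_pow_sub_pow_of_le {R : Type*} [CommRing R] (w : AddValuation R (WithTop ℤ))
    {x y : R} {N κ : ℤ} (hx : (N : WithTop ℤ) ≤ w x) (hy : (N : WithTop ℤ) ≤ w y)
    (h : ((N + κ : ℤ) : WithTop ℤ) ≤ w (x - y)) (n : ℕ) :
    ((n * N + κ : ℤ) : WithTop ℤ) ≤ w (x ^ n - y ^ n) := by
  induction n with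
  | zero => simp
  | succ n ih =>
    have h1 : x ^ (n + 1) - y ^ (n + 1) = x * (x ^ n - y ^ n) + (x - y) * y ^ n := by ring
    rw [h1]
    refine w.map_le_add (int_le_mono (le_map_mul w hx ih) ?_)
      (int_le_mono (le_map_mul w h (le_map_pow w hy n)) ?_) <;> push_cast <;> linarith

variable {v : AddValuation L (WithTop ℤ)} (hv : IsNormalizedVal p k v) {π : L} (hπ : v π = 1)
  {D : ℤ} {H : Set (L ≃ₐ[K₀ p k] L)} {w : AddValuation L[X] (WithTop ℤ)}
  (hw : IsGenericPoint p k v π D H w) {κ : ℤ}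
  [IsAlgClosed k] [FiniteDimensional (K₀ p k) L]

include hv hπ hw

omit hw [IsAlgClosed k] [FiniteDimensional (K₀ p k) L] in
theorem Lifts.le_val_self {r : ℕ} {z : L} {Z : L[X]} (h : Lifts p k π w κ r z Z) :
    ((r : ℤ) : WithTop ℤ) ≤ v z := by
  obtain ⟨V, rfl, -⟩ := h
  refine int_le_mono (le_map_mul v (le_map_pow v (a := 1) hπ.ge r) (b := 0)
    (val_eval₂_nonneg v (val_ofWitt_nonneg hv) (by rw [hπ]; exact zero_le_one) V)) (by simp)

/-- With ζ - 1 = F(π) and X^N dividing F, an expression in ζ - 1 lifts to the same expression in F,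
which is close to the one in ζ' - 1. Factoring out X^N keeps the precision relative. -/
theorem approxBy_of_cyclotomic {ζ ζ' : L} {N : ℕ} (hN : v (ζ - 1) = ((N : ℤ) : WithTop ℤ))
    (hN' : v (ζ' - 1) = ((N : ℤ) : WithTop ℤ))
    (hclose : ∀ F : (WittVector p k)[X], F.eval₂ (ofWitt p k L) π = ζ →
      ((N + κ : ℤ) : WithTop ℤ) ≤ w (wittPoly L F - C ζ')) (n : ℕ) (U : (WittVector p k)[X]) :
    ApproxBy p k π w κ (N * n) ((ζ - 1) ^ n * U.eval₂ (ofWitt p k L) (ζ - 1))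
      ((ζ' - 1) ^ n * U.eval₂ (ofWitt p k L) (ζ' - 1)) := by
  have hN0 : 0 ≤ v (ζ - 1) := by rw [hN]; exact_mod_cast N.cast_nonneg
  obtain ⟨e, -, he⟩ := exists_val_p hv
  have hπ0 : π ≠ 0 := by rintro rfl; simp at hπ
  have hπN : v (π ^ N) = ((N : ℤ) : WithTop ℤ) := by simpa using map_pow_coe v (a := 1) hπ N
  obtain ⟨U₀, -, hU₀⟩ := exists_poly_of_nonneg hv hπ he
    (int_le_val_div (a := 0) (by simpa using hN.ge) hπN)
  set F : (WittVector p k)[X] := X ^ N * U₀ with hF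
  have hFπ : F.eval₂ (ofWitt p k L) π = ζ - 1 := by
    rw [hF, eval₂_mul, eval₂_pow, eval₂_X, ← hU₀]; field_simp
  have hFX : wittPoly L F = X ^ N * wittPoly L U₀ := by simp [hF, wittPoly]
  have hwF : ((N : ℤ) : WithTop ℤ) ≤ w (wittPoly L F) := by
    rw [hFX]; exact le_val_X_pow_mul_wittPoly hv hw N U₀
  have hclose' : ((N + κ : ℤ) : WithTop ℤ) ≤ w (wittPoly L F - C (ζ' - 1)) := by
    have := hclose (1 + F) (by rw [eval₂_add, eval₂_one, hFπ]; ring)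
    have h1 : wittPoly L (1 + F) - C ζ' = wittPoly L F - C (ζ' - 1) := by
      simp only [wittPoly, Polynomial.map_add, Polynomial.map_one, C_sub, C_1]; ring
    rwa [h1] at this
  have hwC : w (C (ζ' - 1)) = ((N : ℤ) : WithTop ℤ) := by rw [hw.val_C, hN']
  have hcoef : ∀ a, 0 ≤ w (((C : L →+* L[X]).comp (ofWitt p k L)) a) := by
    intro a
    rw [RingHom.comp_apply, hw.val_C]
    exact val_ofWitt_nonneg hv a
  have hnn : ∀ {Z : L[X]}, ((N : ℤ) : WithTop ℤ) ≤ w Z → 0 ≤ w Z := fun h =>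
    int_le_mono (a := 0) h (by positivity)
  refine ⟨X ^ (N * n) * wittPoly L (U₀ ^ n * U.comp F), ?_, ?_⟩
  · have h1 := Lifts.exact (p := p) (k := k) (π := π) w κ (N * n) (U₀ ^ n * U.comp F)
    have h2 : π ^ (N * n) * (U₀ ^ n * U.comp F).eval₂ (ofWitt p k L) π =
        (ζ - 1) ^ n * U.eval₂ (ofWitt p k L) (ζ - 1) := by
      rw [eval₂_mul, eval₂_pow, eval₂_comp, hFπ, pow_mul, ← mul_assoc, ← mul_pow]
      congr 2
      rw [← hFπ, hF, eval₂_mul, eval₂_pow, eval₂_X]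
    rwa [h2] at h1
  · have h1 : X ^ (N * n) * wittPoly L (U₀ ^ n * U.comp F) =
        wittPoly L F ^ n * U.eval₂ ((C : L →+* L[X]).comp (ofWitt p k L)) (wittPoly L F) := by
      rw [← wittPoly_comp, hFX, mul_pow, ← pow_mul, mul_assoc]
      simp only [wittPoly, Polynomial.map_mul, Polynomial.map_pow]
    have h2 : C ((ζ' - 1) ^ n * U.eval₂ (ofWitt p k L) (ζ' - 1)) =
        C (ζ' - 1) ^ n * U.eval₂ ((C : L →+* L[X]).comp (ofWitt p k L)) (C (ζ' - 1)) := by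
      rw [C_mul, C_pow, hom_eval₂]
    rw [h1, h2]
    have h3 : ∀ a b c d : L[X], a * b - c * d = (a - c) * b + c * (b - d) := by intros; ring
    rw [h3]
    refine w.map_le_add ?_ ?_
    · refine int_le_mono (le_map_mul w (b := 0)
        (le_val_pow_sub_pow_of_le w hwF hwC.ge hclose' n)
        (val_eval₂_nonneg w hcoef (hnn hwF) U)) ?_
      push_cast
      linarith
    · refine int_le_mono (le_map_mul w (le_map_pow w hwC.ge n)
        (le_val_eval₂_sub w hcoef (hnn hwF) (hnn hwC.ge) hclose' U)) ?_
      push_cast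
      linarith [(N.cast_nonneg : (0 : ℤ) ≤ (N : ℤ))]

/-- A `p^c`-th root of `α` is approximated by a polynomial over `W(k)`. -/
theorem exists_approx_root {c : ℕ} {x α α' : L} (hx : x ^ p ^ c = α) {s : ℕ}
    (hs : v α = ((s : ℤ) : WithTop ℤ)) (hα : ApproxBy p k π w κ s α α')
    {e : ℕ} {ε : ℤ} (hκ0 : 0 ≤ κ) (hκ : κ + e ≤ D)
    (hcond : c * e + ε + 1 ≤ κ) :
    ∃ V : (WittVector p k)[X],
      ((s + c * e + ε + 1 : ℤ) : WithTop ℤ) ≤ w (wittPoly L V ^ p ^ c - C α') := by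
  have hpos : 0 < p ^ c := pow_pos hp.out.pos c
  have hπ0 : π ≠ 0 := by rintro rfl; simp at hπ
  have hx0 : x ≠ 0 := by
    rintro rfl
    rw [zero_pow hpos.ne'] at hx
    exact ne_zero_of_val_eq_coe hs hx.symm
  obtain ⟨r, hr⟩ := exists_val_eq_coe v hx0
  have hrs : (p ^ c : ℕ) * r = s := by
    have := map_pow_coe v hr (p ^ c)
    rw [hx, hs] at this
    exact_mod_cast this.symm
  have hpos' : (0 : ℤ) < (p ^ c : ℕ) := by exact_mod_cast hpos
  have hr0 : 0 ≤ r := by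
    by_contra hneg
    nlinarith [(s.cast_nonneg : (0 : ℤ) ≤ (s : ℤ))]
  obtain ⟨r, rfl⟩ := Int.eq_ofNat_of_zero_le hr0
  obtain ⟨V, hV⟩ := exists_lifts (w := w) (κ := κ) hv hπ hr.ge
  have h1 := hV.pow hv hw hκ0 (p ^ c)
  rw [hx, show p ^ c * r = s by exact_mod_cast hrs] at h1
  obtain ⟨B, hB, hB'⟩ := hα
  -- V^(p^c) and B both lift α, so they agree to relative precision κ.
  have h2 := h1.unique hw (by omega) hπ0 hB
  refine ⟨V, ?_⟩
  have h3 := w.map_le_add h2 hB'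
  rw [sub_add_sub_cancel] at h3
  exact int_le_mono h3 (by linarith)

variable {e : ℕ} (he : v (p : L) = ((e : ℤ) : WithTop ℤ)) {ε : ℤ} (hε : (p - 1 : ℤ) * ε = e)
  (hκ0 : 0 ≤ κ) (hκ : κ + e ≤ D)

include he hκ0 hκ hε

/-- The root is extracted in two stages. A p-th root z of a near 1 lifts to Z with Z^p close to a'
to precision κ + r₁, because the error is relative to a - 1. A p^c-th root of bz is then
approximated with relative error above ce + ε, and raising to the p-th power improves this by e. In
the second alternative for b the error is relative to b - 1 as well, which gains r₂. -/
theorem exists_approx_root_mul {c : ℕ} {ξ : L} (hξ : IsPrimitiveRoot ξ (p ^ (c + 1)))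
    {x a b a' b' : L} (hx : x ^ p ^ (c + 1) = a * b ^ p) (hb0 : b ≠ 0)
    {r₁ : ℕ} (hr₁ : 1 ≤ r₁) (ha : ApproxBy p k π w κ r₁ (a - 1) (a' - 1))
    (hcond₁ : (c + 1) * e + ε + 1 ≤ κ + r₁) {s : ℕ}  (hs : v b = ((s : ℤ) : WithTop ℤ))
    (hb : (ApproxBy p k π w κ s b b' ∧ (c + 1) * e + ε + 1 ≤ κ + e) ∨
      ∃ r₂ : ℕ, 1 ≤ r₂ ∧ ApproxBy p k π w κ r₂ (b - 1) (b' - 1) ∧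
        (c + 1) * e + ε + 1 ≤ κ + e + r₂) :
    ∃ V : (WittVector p k)[X],
      ((p * s + (c + 1) * e + ε + 1 : ℤ) : WithTop ℤ) ≤
        w (wittPoly L V ^ p ^ (c + 1) - C (a' * b' ^ p)) := by
  have hπ0 : π ≠ 0 := by rintro rfl; simp at hπ
  have hp2 : (2 : ℤ) ≤ p := by exact_mod_cast hp.out.two_le
  have he0 : (0 : ℤ) ≤ e := e.cast_nonneg
  have hε0 : 0 ≤ ε := by
    by_contra hneg
    nlinarith
  have hpos : 0 < p ^ c := pow_pos hp.out.pos c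
  have hpos' : 0 < p ^ (c + 1) := pow_pos hp.out.pos _
  have hξp : IsPrimitiveRoot (ξ ^ p ^ c) p := hξ.pow hpos' (pow_succ p c)
  have hξq : IsPrimitiveRoot (ξ ^ p) (p ^ c) := hξ.pow hpos' (pow_succ' p c)
  obtain ⟨A, hA, hA'⟩ := ha
  have hva1 : ((r₁ : ℤ) : WithTop ℤ) ≤ v (a - 1) := hA.le_val_self hv hπ
  have hva : v a = 0 := by
    have h1 : v (1 : L) < v (a - 1) := by
      rw [v.map_one]
      exact lt_of_lt_of_le (by exact_mod_cast hr₁) hva1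
    have h2 := v.map_add_eq_of_lt_left h1
    rwa [add_sub_cancel, v.map_one] at h2
  have ha0 : a ≠ 0 := ne_zero_of_val_eq_coe (n := 0) hva
  -- a `p`-th root of `a` close to `1`
  set z₀ := x ^ p ^ c / b with hz₀
  have hz₀p : z₀ ^ p = 1 + (a - 1) := by
    rw [hz₀, div_pow, ← pow_mul, ← pow_succ, hx, add_sub_cancel, mul_div_assoc,
      div_self (pow_ne_zero p hb0), mul_one]
  have hz₀0 : z₀ ≠ 0 := by
    rintro h
    rw [h, zero_pow hp.out.ne_zero, add_sub_cancel] at hz₀p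
    exact ha0 hz₀p.symm
  obtain ⟨η, hη, r, hr, hbin⟩ := exists_root_close_to_one v hp.out.pos hξp hz₀p hz₀0 hva1
  obtain ⟨Y, hY⟩ := exists_lifts (w := w) (κ := κ) hv hπ hr
  set z := η * z₀ with hz
  have hzp : z ^ p = a := by rw [hz, mul_pow, hη, one_mul, hz₀p]; ring
  -- The linear binomial term, j = 1. It makes κ + r sufficient below whenever κ + r₁ is.
  have hre : (r₁ : ℤ) ≤ e + r := by
    have := hbin 1 le_rfl hp.out.one_le
    rw [Nat.choose_one_right, he, ← WithTop.coe_add] at this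
    have h2 := WithTop.coe_le_coe.1 this
    push_cast at h2
    linarith
  have hZbin := hY.binomial hv hπ hw he hκ0 hκ hbin
  rw [add_sub_cancel, hzp] at hZbin
  set Z := 1 + wittPoly L Y with hZ
  have hZp : ((r₁ + κ : ℤ) : WithTop ℤ) ≤ w (Z ^ p - C a') := by
    have h1 := w.map_le_add (hZbin.unique hw (by omega) hπ0 hA) hA'
    have h2 : Z ^ p - 1 - A + (A - C (a' - 1)) = Z ^ p - C a' := by rw [C_sub, C_1]; ring
    rwa [h2] at h1
  have hZ0 : Lifts p k π w κ 0 z Z := by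
    have h1 := (Lifts.natCast (p := p) (k := k) (π := π) w κ 1).add (hY.mono (Nat.zero_le r))
    simpa using h1
  have hvz : v z = 0 := by
    have hz0 : z ≠ 0 := by
      rintro h
      rw [h, zero_pow hp.out.ne_zero] at hzp
      exact ha0 hzp.symm
    obtain ⟨m, hm⟩ := exists_val_eq_coe v hz0
    have := map_pow_coe v hm p
    rw [hzp, hva] at this
    rw [hm]
    norm_cast at this ⊢
    exact (mul_eq_zero.1 this.symm).resolve_left (by exact_mod_cast hp.out.ne_zero)
  obtain ⟨i, -, hi⟩ := hξp.eq_pow_of_pow_eq_one hη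
  -- z differs from x^(p^c)/b by a p-th root of unity, which is absorbed by rotating x.
  set x₁ := ξ ^ i * x with hx₁
  have hx₁z : x₁ ^ p ^ c = b * z := by
    rw [hx₁, mul_pow, hz, hz₀, ← hi, ← pow_mul, ← pow_mul, mul_comm i]
    field_simp
  have hbz0 : b * z ≠ 0 := mul_ne_zero hb0 (ne_zero_of_val_eq_coe (n := 0) hvz)
  have hx₁0 : x₁ ≠ 0 := by
    rintro h
    rw [h, zero_pow hpos.ne'] at hx₁z
    exact hbz0 hx₁z.symm
  -- approximate the `p ^ c`-th root of `b * z`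
  obtain ⟨V, hV, hvb'⟩ : ∃ V : (WittVector p k)[X], ((s + (c * e + ε + 1) : ℤ) : WithTop ℤ) ≤
      w (wittPoly L V ^ p ^ c - C b' * Z) ∧ ((s : ℤ) : WithTop ℤ) ≤ w (C b') := by
    rcases hb with ⟨⟨B, hB, hB'⟩, hcond⟩ | ⟨r₂, hr₂, ⟨B, hB, hB'⟩, hcond⟩
    · obtain ⟨m, hm⟩ := exists_val_eq_coe v hx₁0
      have hms : (p ^ c : ℕ) * m = s := by
        have := map_pow_coe v hm (p ^ c)
        rw [hx₁z, v.map_mul, hvz, add_zero, hs] at this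
        exact_mod_cast this.symm
      have hposZ : (0 : ℤ) < (p ^ c : ℕ) := by exact_mod_cast hpos
      have hm0 : 0 ≤ m := by
        by_contra hneg
        nlinarith [(s.cast_nonneg : (0 : ℤ) ≤ (s : ℤ))]
      obtain ⟨m, rfl⟩ := Int.eq_ofNat_of_zero_le hm0
      obtain ⟨V, hV⟩ := exists_lifts (w := w) (κ := κ) hv hπ hm.ge
      have h1 := hV.pow hv hw hκ0 (p ^ c)
      rw [hx₁z, show p ^ c * m = s by exact_mod_cast hms] at h1
      have h2 := h1.unique hw (by omega) hπ0 (hB.mul hv hw hκ0 hZ0)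
      have h3 := le_map_mul w hB' (b := 0) (hZ0.le_val hv hw hκ0)
      rw [add_zero] at h3
      have h4 := w.map_le_add h2 h3
      refine ⟨V, ?_, ?_⟩
      · have h5 : wittPoly L V ^ p ^ c - B * Z + (B - C b') * Z =
            wittPoly L V ^ p ^ c - C b' * Z := by ring
        rw [h5] at h4
        exact int_le_mono h4 (by linarith)
      · have h5 : C b' = B - (B - C b') := by ring
        rw [h5]
        exact w.map_le_sub (hB.le_val hv hw hκ0) (int_le_mono hB' (by omega))
    · have hs0 : (s : ℤ) = 0 := by
        have h1 : v (1 : L) < v (b - 1) := by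
          rw [v.map_one]
          exact lt_of_lt_of_le (by exact_mod_cast hr₂) (hB.le_val_self hv hπ)
        have h2 := v.map_add_eq_of_lt_left h1
        rw [add_sub_cancel, v.map_one, hs] at h2
        exact_mod_cast h2
      -- bz - 1 is a lift of order R, since both b - 1 and z - 1 are; so R is gained when comparing
      -- with the power of the root.
      set R := min r₂ r with hR
      have hbz : b * z - 1 = (b - 1) + (z - 1) + (b - 1) * (z - 1) := by ring
      have hb1 := hB.mono (min_le_left r₂ r)
      have hz1 := hY.mono (min_le_right r₂ r)
      rw [← hR] at hb1 hz1
      have hlift := (hb1.add hz1).add (((hb1.mul hv hw hκ0 hz1)).mono (Nat.le_add_left R R))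
      rw [← hbz] at hlift
      have hx₁t : x₁ ^ p ^ c = 1 + (b * z - 1) := by rw [hx₁z]; ring
      obtain ⟨η₂, hη₂, r', hr', hbin'⟩ :=
        exists_root_close_to_one v hpos hξq hx₁t hx₁0 (hlift.le_val_self hv hπ)
      obtain ⟨Y₂, hY₂⟩ := exists_lifts (w := w) (κ := κ) hv hπ hr'
      have h1 := hY₂.binomial hv hπ hw he hκ0 hκ hbin'
      rw [add_sub_cancel, mul_pow, hη₂, one_mul, hx₁z] at h1
      have h2 := h1.unique hw (by omega) hπ0 hlift
      have h3 := le_map_mul w hB' (b := 0) (hZ0.le_val hv hw hκ0)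
      have h4 := w.map_le_add (int_le_mono (a := c * e + ε + 1) h2 ?_)
        (int_le_mono (a := c * e + ε + 1) h3 (by linarith))
      · refine ⟨1 + Y₂, ?_, ?_⟩
        · have h5 : (1 + wittPoly L Y₂) ^ p ^ c - 1 -
              (B + wittPoly L Y + B * wittPoly L Y) + (B - C (b' - 1)) * Z =
              wittPoly L (1 + Y₂) ^ p ^ c - C b' * Z := by
            simp only [hZ, wittPoly, Polynomial.map_add, Polynomial.map_one, C_sub, C_1]
            ring
          rw [h5] at h4
          rwa [hs0, zero_add]
        · have h5 : C b' = (1 + B) - (B - C (b' - 1)) := by rw [C_sub, C_1]; ring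
          rw [h5, hs0]
          refine w.map_le_sub (w.map_le_add (by simp) ?_) (int_le_mono hB' (by omega))
          exact int_le_mono (hB.le_val hv hw hκ0) (by omega)
      · rcases min_choice r₂ r with h | h <;> rw [hR, h] <;> linarith
  refine ⟨V, ?_⟩
  have hwZ : ((0 : ℤ) : WithTop ℤ) ≤ w Z := hZ0.le_val hv hw hκ0
  have hwp : w (p : L[X]) = ((e : ℤ) : WithTop ℤ) := by
    rw [← he, ← hw.val_C, C_eq_natCast]
  have hbZ := le_map_mul w hvb' hwZ
  rw [add_zero] at hbZ
  -- Used with μ = ce + ε + 1 and b = e + μ; the bound b ≤ pμ holds because (p - 1)ε = e.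
  have h1 := le_val_add_pow_sub_pow w hp.out (b := (c + 1) * e + ε + 1) hwp.ge hbZ hV
    (by positivity) (by linarith) (by nlinarith [mul_nonneg (c.cast_nonneg : (0 : ℤ) ≤ c) he0])
  have h2 := le_map_mul w (le_map_pow w hvb' p) hZp
  have h3 := w.map_le_add h1 (int_le_mono (a := p * s + ((c + 1) * e + ε + 1)) h2 (by linarith))
  have h4 : (C b' * Z + (wittPoly L V ^ p ^ c - C b' * Z)) ^ p - (C b' * Z) ^ p +
      C b' ^ p * (Z ^ p - C a') = wittPoly L V ^ p ^ (c + 1) - C (a' * b' ^ p) := by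
    rw [add_sub_cancel, ← pow_mul, ← pow_succ, C_mul, C_pow, mul_pow]
    generalize wittPoly L V ^ p ^ (c + 1) = T
    ring
  rw [h4] at h3
  exact int_le_mono h3 (by linarith)

end Approx

/-! ### The cyclotomic extensions of `K₀` are totally ramified -/

section Cyclotomic

open IntermediateField

variable {p : ℕ} [hp : Fact p.Prime] {k : Type*} [Field k] [CharP k p] [IsAlgClosed k]

/-- The degree is at most that of Φ. Conversely it equals e by total ramification, and e is a
positive multiple of p^n(p - 1). Irreducibility of Φ over K₀ follows. -/
theorem finrank_adjoin_primitiveRoot {L : Type*} [Field L] [Algebra (K₀ p k) L] {n : ℕ} {ζ : L}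
    (hζ : IsPrimitiveRoot ζ (p ^ (n + 1))) :
    Module.finrank (K₀ p k) (K₀ p k)⟮ζ⟯ = p ^ n * (p - 1) ∧
      minpoly (K₀ p k) ζ = cyclotomic (p ^ (n + 1)) (K₀ p k) := by
  have hpos : 0 < p ^ (n + 1) := pow_pos hp.out.pos _
  have hint : IsIntegral (K₀ p k) ζ := isIntegral_of_pow_eq_one p k L hζ.pow_eq_one
  have hroot : aeval ζ (cyclotomic (p ^ (n + 1)) (K₀ p k)) = 0 := by
    rw [aeval_def, ← eval_map, map_cyclotomic, cyclotomic_eq_prod_X_sub_primitiveRoots hζ, eval_prod]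
    exact Finset.prod_eq_zero ((mem_primitiveRoots hpos).2 hζ) (by simp)
  have hdvd := minpoly.dvd (K₀ p k) ζ hroot
  have hdeg : (cyclotomic (p ^ (n + 1)) (K₀ p k)).natDegree = p ^ n * (p - 1) := by
    rw [natDegree_cyclotomic, Nat.totient_prime_pow_succ hp.out]
  have hle : (minpoly (K₀ p k) ζ).natDegree ≤ p ^ n * (p - 1) := by
    rw [← hdeg]
    exact natDegree_le_of_dvd hdvd (cyclotomic_ne_zero _ _)
  have hfin : FiniteDimensional (K₀ p k) (K₀ p k)⟮ζ⟯ := adjoin.finiteDimensional hint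
  obtain ⟨v, hv⟩ := exists_isNormalizedVal p k (K₀ p k)⟮ζ⟯
  obtain ⟨e, he1, he⟩ := exists_val_p hv
  have hfe := finrank_eq_of_val_p hv he
  have hgen : IsPrimitiveRoot (AdjoinSimple.gen (K₀ p k) ζ) (p ^ (n + 1)) :=
    IsPrimitiveRoot.of_map_of_injective (f := algebraMap (K₀ p k)⟮ζ⟯ L)
      (by simpa using hζ) (algebraMap (K₀ p k)⟮ζ⟯ L).injective
  obtain ⟨N, -, hNe⟩ := val_primitiveRoot_sub_one v hgen he
  have hge : p ^ n * (p - 1) ≤ e := by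
    have hcast : ((p ^ n * (p - 1) : ℕ) : ℤ) = p ^ n * (p - 1) := by
      rw [Nat.cast_mul, Nat.cast_sub hp.out.one_le]; push_cast; ring
    rw [← hcast] at hNe
    have h0 : (0 : ℤ) ≤ (p ^ n * (p - 1) : ℕ) := Int.natCast_nonneg _
    have he1' : (1 : ℤ) ≤ e := by exact_mod_cast he1
    have hN : 1 ≤ N := by
      by_contra hcon
      nlinarith
    zify
    rw [← hNe]
    push_cast at h0 ⊢
    nlinarith
  rw [adjoin.finrank hint] at hfe ⊢
  refine ⟨le_antisymm hle (hfe ▸ hge), ?_⟩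
  refine (eq_of_monic_of_dvd_of_natDegree_le (minpoly.monic hint) (cyclotomic.monic _ _) hdvd ?_).symm
  rw [hdeg, hfe]
  exact hge

theorem exists_algEquiv_primitiveRoot {L : Type*} [Field L] [Algebra (K₀ p k) L]
    [IsGalois (K₀ p k) L] {n : ℕ} {ζ ζ' : L}
    (hζ : IsPrimitiveRoot ζ (p ^ (n + 1))) (hζ' : IsPrimitiveRoot ζ' (p ^ (n + 1))) :
    ∃ g : L ≃ₐ[K₀ p k] L, g ζ = ζ' := by
  have h : IsConjRoot (K₀ p k) ζ ζ' := by
    rw [isConjRoot_def, (finrank_adjoin_primitiveRoot hζ).2, (finrank_adjoin_primitiveRoot hζ').2]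
  obtain ⟨g, hg⟩ := isConjRoot_iff_exists_algEquiv.1 h.symm
  exact ⟨g, hg⟩

variable (Ω : Type*) [Field Ω] [Algebra (K₀ p k) Ω]

omit [IsAlgClosed k] in
theorem exists_primitiveRoot_Kn [IsAlgClosed Ω] (n : ℕ) :
    ∃ ζ : Kn p k Ω n, IsPrimitiveRoot ζ (p ^ n) := by
  have := charZero_ext p k Ω
  have hpos : 0 < p ^ n := pow_pos hp.out.pos _
  have : NeZero ((p ^ n : ℕ) : Ω) := ⟨by exact_mod_cast hpos.ne'⟩
  obtain ⟨ζ, hζ⟩ := IsAlgClosed.exists_root (cyclotomic (p ^ n) Ω)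
    (degree_cyclotomic_pos _ _ hpos).ne'
  have hprim := isRoot_cyclotomic_iff.1 hζ
  refine ⟨⟨ζ, subset_adjoin _ _ hprim.pow_eq_one⟩, ?_⟩
  exact IsPrimitiveRoot.of_map_of_injective (f := algebraMap (Kn p k Ω n) Ω)
      hprim (algebraMap (Kn p k Ω n) Ω).injective

omit [IsAlgClosed k] in
theorem Kn_eq_adjoin {n : ℕ} {ζ : Ω} (hζ : IsPrimitiveRoot ζ (p ^ n)) :
    Kn p k Ω n = (K₀ p k)⟮ζ⟯ := by
  have : NeZero (p ^ n) := ⟨(pow_pos hp.out.pos _).ne'⟩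
  refine le_antisymm (adjoin_le_iff.2 fun η hη => ?_)
    (adjoin_simple_le_iff.2 (subset_adjoin _ _ hζ.pow_eq_one))
  obtain ⟨i, -, rfl⟩ := hζ.eq_pow_of_pow_eq_one hη
  exact pow_mem (mem_adjoin_simple_self _ _) i

instance isAlgebraic_Kn (n : ℕ) : Algebra.IsAlgebraic (K₀ p k) (Kn p k Ω n) :=
  Algebra.IsAlgebraic.of_finite (K₀ p k) (Kn p k Ω n)

theorem vn_isNormalizedVal (n : ℕ) : IsNormalizedVal p k (vn p k Ω n) :=
  (exists_isNormalizedVal p k (Kn p k Ω n)).choose_spec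

variable {Ω}

theorem vn_p {n : ℕ} {ζ : Kn p k Ω (n + 1)} (hζ : IsPrimitiveRoot ζ (p ^ (n + 1))) :
    vn p k Ω (n + 1) (p : Kn p k Ω (n + 1)) = ((p ^ n * (p - 1) : ℕ) : ℤ) := by
  obtain ⟨e, he1, he⟩ := exists_val_p (vn_isNormalizedVal (p := p) (k := k) Ω (n + 1))
  have h1 := finrank_eq_of_val_p (vn_isNormalizedVal Ω (n + 1)) he
  have hζ' : IsPrimitiveRoot (ζ : Ω) (p ^ (n + 1)) :=
    hζ.map_of_injective (f := algebraMap (Kn p k Ω (n + 1)) Ω) (algebraMap (Kn p k Ω (n + 1)) Ω).injective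
  rw [Kn_eq_adjoin Ω hζ', (finrank_adjoin_primitiveRoot hζ').1] at h1
  rw [he, h1]

theorem vn_primitiveRoot_sub_one {n : ℕ} {ζ : Kn p k Ω (n + 1)}
    (hζ : IsPrimitiveRoot ζ (p ^ (n + 1))) : vn p k Ω (n + 1) (ζ - 1) = 1 := by
  obtain ⟨N, hN, hNe⟩ := val_primitiveRoot_sub_one _ hζ (vn_p hζ)
  rw [hN]
  have hcast : ((p ^ n * (p - 1) : ℕ) : ℤ) = p ^ n * (p - 1) := by
    rw [Nat.cast_mul, Nat.cast_sub hp.out.one_le]; push_cast; ring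
  rw [hcast] at hNe
  have h0 : (p ^ n * (p - 1) : ℤ) ≠ 0 := by
    have hp2 : (2 : ℤ) ≤ p := by exact_mod_cast hp.out.two_le
    exact mul_ne_zero (pow_ne_zero _ (by omega)) (by omega)
  have : N = 1 := mul_left_cancel₀ h0 (by rw [hNe, mul_one])
  rw [this]; rfl

/-- Expansion of integral elements of `K_n` in powers of `ζ - 1`. -/
theorem exists_expansion {n : ℕ} {ζ : Kn p k Ω (n + 1)}
    (hζ : IsPrimitiveRoot ζ (p ^ (n + 1))) {a : Kn p k Ω (n + 1)} {r : ℕ}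
    (ha : ((r : ℤ) : WithTop ℤ) ≤ vn p k Ω (n + 1) a) :
    ∃ U : (WittVector p k)[X],
      a = (ζ - 1) ^ r * U.eval₂ (ofWitt p k (Kn p k Ω (n + 1))) (ζ - 1) := by
  have hπ := vn_primitiveRoot_sub_one hζ
  have hπ0 : ζ - 1 ≠ 0 := ne_zero_of_val_eq_coe (n := 1) hπ
  have hπr := map_pow_coe (vn p k Ω (n + 1)) (a := 1) hπ r
  obtain ⟨U, -, hU⟩ := exists_poly_of_nonneg (vn_isNormalizedVal Ω (n + 1)) hπ (vn_p hζ)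
    (int_le_val_div (a := 0) (by simpa using ha) hπr)
  exact ⟨U, by rw [← hU]; field_simp⟩

omit [IsAlgClosed k] in
theorem algHom_eval₂_ofWitt {L M : Type*} [Field L] [Algebra (K₀ p k) L] [Field M]
    [Algebra (K₀ p k) M] (f : L →ₐ[K₀ p k] M) (U : (WittVector p k)[X]) (x : L) :
    f (U.eval₂ (ofWitt p k L) x) = U.eval₂ (ofWitt p k M) (f x) := by
  have h := hom_eval₂ U (ofWitt p k L) (f : L →+* M) x
  have h2 : (f : L →+* M).comp (ofWitt p k L) = ofWitt p k M :=
    RingHom.ext fun a => f.commutes _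
  rw [h2] at h
  exact h

/-- Write a = (ζ - 1)^s u with u a unit. Both u and its inverse are W(k)-polynomials in ζ - 1, so u
stays a unit in L. -/
theorem val_algHom_Kn {n : ℕ} {ζ : Kn p k Ω (n + 1)} (hζ : IsPrimitiveRoot ζ (p ^ (n + 1)))
    {L : Type*} [Field L] [Algebra (K₀ p k) L] {v : AddValuation L (WithTop ℤ)}
    (hv : IsNormalizedVal p k v) (f : Kn p k Ω (n + 1) →ₐ[K₀ p k] L) {N : ℕ}
    (hN : v (f ζ - 1) = ((N : ℤ) : WithTop ℤ)) {a : Kn p k Ω (n + 1)} {s : ℕ}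
    (ha : vn p k Ω (n + 1) a = ((s : ℤ) : WithTop ℤ)) :
    v (f a) = ((N * s : ℕ) : ℤ) := by
  have hπ := vn_primitiveRoot_sub_one hζ
  obtain ⟨U, hU⟩ := exists_expansion hζ ha.ge
  set u := U.eval₂ (ofWitt p k (Kn p k Ω (n + 1))) (ζ - 1) with hu
  have hu0 : u ≠ 0 := by
    intro h
    rw [h, mul_zero] at hU
    exact ne_zero_of_val_eq_coe ha hU
  obtain ⟨m, hm⟩ := exists_val_eq_coe (vn p k Ω (n + 1)) hu0
  have hm0 : m = 0 := by
    have h1 := map_mul_coe (map_pow_coe (vn p k Ω (n + 1)) (a := 1) hπ s) hm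
    rw [← hU, ha] at h1
    norm_cast at h1
    omega
  subst hm0
  have hui := map_inv_coe hm
  obtain ⟨U', hU'⟩ := exists_expansion hζ (r := 0) (a := u⁻¹) (by rw [hui]; simp)
  rw [pow_zero, one_mul] at hU'
  have hN0 : 0 ≤ v (f (ζ - 1)) := by
    rw [map_sub, map_one, hN]
    exact_mod_cast N.cast_nonneg
  have hnn : ∀ V : (WittVector p k)[X],
      0 ≤ v (f (V.eval₂ (ofWitt p k (Kn p k Ω (n + 1))) (ζ - 1))) := by
    intro V
    rw [algHom_eval₂_ofWitt]
    exact val_eval₂_nonneg v (val_ofWitt_nonneg hv) hN0 V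
  have hfu : v (f u) = 0 := by
    refine map_unit_nonneg_eq_zero v (y := f u⁻¹) ?_ (hnn U) (hU' ▸ hnn U')
    rw [← map_mul, mul_inv_cancel₀ hu0, map_one]
  rw [hU, map_mul, v.map_mul, hfu, add_zero, map_pow, map_sub, map_one, map_pow_coe v hN]
  push_cast
  rw [mul_comm]

end Cyclotomic

/-! ### Inertia and roots of elements of the cyclotomic fields -/

section CyclotomicRoots

variable {p : ℕ} [hp : Fact p.Prime] {k : Type*} [Field k] [CharP k p] [IsAlgClosed k]
  {Ω : Type*} [Field Ω] [Algebra (K₀ p k) Ω]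
  {L : Type*} [Field L] [Algebra (K₀ p k) L] [FiniteDimensional (K₀ p k) L] [IsGalois (K₀ p k) L]
  {v : AddValuation L (WithTop ℤ)} (hv : IsNormalizedVal p k v) {π : L} (hπ : v π = 1)
  {D : ℤ} {H : Set (L ≃ₐ[K₀ p k] L)} {w : AddValuation L[X] (WithTop ℤ)}
  (hw : IsGenericPoint p k v π D H w)
  {e : ℕ} (he : v (p : L) = ((e : ℤ) : WithTop ℤ)) {ε : ℤ} (hε : (p - 1 : ℤ) * ε = e)
  {n : ℕ} {ζ : Kn p k Ω (n + 1)} (hζ : IsPrimitiveRoot ζ (p ^ (n + 1)))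
  (f : Kn p k Ω (n + 1) →ₐ[K₀ p k] L) {N : ℕ} (hN : v (f ζ - 1) = ((N : ℤ) : WithTop ℤ))
  (hε' : ε = (p ^ n : ℕ) * N)

include hv hπ hw he hε hζ hN hε'

/-- Up to an automorphism of `L`, all elements of the cyclotomic field `K_n` are well approximated
over `K₀(X)`. -/
theorem exists_algEquiv_approxBy :
    ∃ g : L ≃ₐ[K₀ p k] L, ∀ (r : ℕ) (a : Kn p k Ω (n + 1)),
      ((r : ℤ) : WithTop ℤ) ≤ vn p k Ω (n + 1) a →
        ApproxBy p k π w (D - (n + 1) * e + ε - N) (N * r) (f a) (g (f a)) := by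
  have hpos : 0 < p ^ (n + 1) := pow_pos hp.out.pos _
  have hp2 : (2 : ℤ) ≤ p := by exact_mod_cast hp.out.two_le
  have hfζ : IsPrimitiveRoot (f ζ) (p ^ (n + 1)) :=
    hζ.map_of_injective (f := f) (f : Kn p k Ω (n + 1) →+* L).injective
  have hζ0 : v (f ζ) = 0 := val_eq_zero_of_pow_eq_one v hpos.ne' hfζ.pow_eq_one
  obtain ⟨F₀, -, hF₀⟩ := exists_poly_of_nonneg hv hπ he hζ0.ge
  obtain ⟨ζ', hζ', hc⟩ := exists_close_primitiveRoot hw he hε hfζ hF₀.symm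
  -- The primitive root near the lift of f ζ need not be f ζ itself, but it is conjugate to it; this
  -- is the source of g.
  obtain ⟨g, hg⟩ := exists_algEquiv_primitiveRoot (k := k) hfζ hζ'
  refine ⟨g, fun r a ha => ?_⟩
  obtain ⟨U, hU⟩ := exists_expansion hζ ha
  have hfa : f a = (f ζ - 1) ^ r * U.eval₂ (ofWitt p k L) (f ζ - 1) := by
    rw [hU, map_mul, map_pow, algHom_eval₂_ofWitt, map_sub, map_one]
  have hgfa : g (f a) = (ζ' - 1) ^ r * U.eval₂ (ofWitt p k L) (ζ' - 1) := by
    rw [hfa, map_mul, map_pow, algEquiv_eval₂_ofWitt, map_sub, map_one, hg]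
  have hN' : v (ζ' - 1) = ((N : ℤ) : WithTop ℤ) := by
    rw [← hN, val_primitiveRoot_sub_one_eq v hpos hζ' hfζ]
  rw [hgfa, hfa]
  refine approxBy_of_cyclotomic hv hπ hw hN hN' (fun F hF => ?_) r U
  have h1 : ((D : ℤ) : WithTop ℤ) ≤ w (wittPoly L (F - F₀)) :=
    hw.val_root _ (by rw [eval₂_sub, hF, ← hF₀, sub_self])
  have h2 : wittPoly L F - C ζ' = wittPoly L (F - F₀) + (wittPoly L F₀ - C ζ') := by
    simp only [wittPoly, Polynomial.map_sub]; ring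
  rw [h2]
  refine w.map_le_add (int_le_mono h1 ?_) (int_le_mono hc (by linarith))
  have : (0 : ℤ) ≤ e := e.cast_nonneg
  have hε0 : 0 ≤ ε := by rw [hε']; positivity
  nlinarith [(n.cast_nonneg : (0 : ℤ) ≤ n)]

/-- Up to an automorphism of `L`, sufficiently small inertia groups fix the roots of
`α' * β ^ p`. -/
theorem exists_algEquiv_root_fixed {c m : ℕ} (hnm : n ≤ m) (hcm : c ≤ m) {ξ : L}
    (hξ : IsPrimitiveRoot ξ (p ^ (m + 1))) (hm : (m + 1) * e < D)
    {α' β : Kn p k Ω (n + 1)} (hα : 0 ≤ vn p k Ω (n + 1) (α' * β ^ p))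
    (hα0 : α' * β ^ p ≠ 0) (hβ : 0 ≤ vn p k Ω (n + 1) β) {κ : ℤ}
    (hκ : κ = D - (n + 1) * e + ε - N)
    (hcase : (c + 1) * e + ε + 1 ≤ κ ∨ ∃ n₁ : ℕ, 1 ≤ n₁ ∧
      ((n₁ : ℤ) : WithTop ℤ) ≤ vn p k Ω (n + 1) (α' - 1) ∧
      (c + 1) * e + ε + 1 ≤ κ + N * n₁ ∧
      ((c + 1) * e + ε + 1 ≤ κ + e ∨ ∃ n₂ : ℕ, 1 ≤ n₂ ∧
        ((n₂ : ℤ) : WithTop ℤ) ≤ vn p k Ω (n + 1) (β - 1) ∧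
        (c + 1) * e + ε + 1 ≤ κ + e + N * n₂))
    {x : L} (hx : x ^ p ^ (c + 1) = f (α' * β ^ p)) :
    ∃ g : L ≃ₐ[K₀ p k] L, ∀ h ∈ H, h (g x) = g x := by
  obtain ⟨g, hg⟩ := exists_algEquiv_approxBy hv hπ hw he hε hζ f hN hε'
  rw [← hκ] at hg
  refine ⟨g, fun h hh => ?_⟩
  have he0 : (0 : ℤ) ≤ e := e.cast_nonneg
  have hp2 : (2 : ℤ) ≤ p := by exact_mod_cast hp.out.two_le
  have hN0 : (0 : ℤ) ≤ N := N.cast_nonneg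
  have hpn : (1 : ℤ) ≤ (p ^ n : ℕ) := by exact_mod_cast Nat.one_le_pow _ _ hp.out.pos
  have hnm' : (n : ℤ) ≤ m := by exact_mod_cast hnm
  have hNε : (N : ℤ) ≤ ε := by rw [hε']; nlinarith
  have hNpos : 0 < N := by
    rcases Nat.eq_zero_or_pos N with h0 | h0
    · have he00 : (e : ℤ) = 0 := by rw [← hε, hε', h0]; simp
      have h1 := one_le_val_p (L := L) hv
      rw [he, he00] at h1
      exact absurd h1 (by decide)
    · exact h0
  -- Equivalent to κ + e ≤ D. For n = 0 it is an equality because ε = N; for n ≥ 1 it follows from ε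
  -- ≤ e.
  have hεn : e + ε ≤ (n + 1) * e + N := by
    rcases Nat.eq_zero_or_pos n with h0 | h0
    · subst h0
      rw [hε']
      push_cast
      linarith
    · have : (1 : ℤ) ≤ n := by exact_mod_cast h0
      nlinarith
  have hκ0 : 0 ≤ κ := by nlinarith
  have hκe : κ + e ≤ D := by linarith
  have hunity : ∀ {j : ℕ}, j ≤ m + 1 → ∀ η : L, η ^ p ^ j = 1 → h η = η := by
    intro j hj η hη
    refine algEquiv_primitiveRoot_eq hw he hε hv hπ hξ hm hh ?_
    rw [← Nat.add_sub_cancel' hj, pow_add, pow_mul, hη, one_pow]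
  -- Integral elements of K_n are W(k)-polynomials in ζ - 1, and inertia already fixes the roots of
  -- unity.
  have hfix : ∀ a : Kn p k Ω (n + 1), 0 ≤ vn p k Ω (n + 1) a → h (g (f a)) = g (f a) := by
    intro a ha
    obtain ⟨U, hU⟩ := exists_expansion hζ (r := 0) ha
    rw [pow_zero, one_mul] at hU
    rw [hU, algHom_eval₂_ofWitt, algEquiv_eval₂_ofWitt, algEquiv_eval₂_ofWitt, map_sub, map_one,
      map_sub, map_one, map_sub, map_one, hunity (Nat.add_le_add_right hnm 1)]
    rw [← map_pow, ← map_pow, hζ.pow_eq_one, map_one, map_one]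
  obtain ⟨s, hs⟩ := exists_val_eq_coe (vn p k Ω (n + 1)) hα0
  have hs0 : 0 ≤ s := by rw [hs] at hα; exact_mod_cast hα
  obtain ⟨s, rfl⟩ := Int.eq_ofNat_of_zero_le hs0
  have hvα := val_algHom_Kn hζ hv f hN hs
  have hξc : IsPrimitiveRoot (ξ ^ p ^ (m - c)) (p ^ (c + 1)) := by
    refine hξ.pow (pow_pos hp.out.pos _) ?_
    rw [← pow_add]
    congr 1
    omega
  obtain ⟨V, hV⟩ : ∃ V : (WittVector p k)[X],
      (((N * s : ℕ) + (c + 1 : ℕ) * e + ε + 1 : ℤ) : WithTop ℤ) ≤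
        w (wittPoly L V ^ p ^ (c + 1) - C (g (f (α' * β ^ p)))) := by
    rcases hcase with hcase | ⟨n₁, hn₁, hα', hcond₁, hcase⟩
    · exact exists_approx_root hv hπ hw hx hvα (hg s _ hs.ge) hκ0 hκe
        (by push_cast; linarith)
    have hβ0 : β ≠ 0 := by
      rintro rfl
      exact hα0 (by simp [hp.out.ne_zero])
    obtain ⟨t, ht⟩ := exists_val_eq_coe (vn p k Ω (n + 1)) hβ0
    have ht0 : 0 ≤ t := by rw [ht] at hβ; exact_mod_cast hβ
    obtain ⟨t, rfl⟩ := Int.eq_ofNat_of_zero_le ht0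
    have hvβ := val_algHom_Kn hζ hv f hN ht
    have hfβ0 : f β ≠ 0 := ne_zero_of_val_eq_coe hvβ
    have hga := hg n₁ _ hα'
    rw [map_sub, map_one, map_sub, map_one] at hga
    rw [map_mul, map_pow] at hx
    obtain ⟨V, hV⟩ := exists_approx_root_mul hv hπ hw he hε hκ0 hκe hξc hx hfβ0
      (Nat.mul_pos hNpos hn₁) hga (by push_cast; linarith) hvβ (b' := g (f β)) (by
        rcases hcase with hcase | ⟨n₂, hn₂, hβ', hcond₂⟩
        · exact Or.inl ⟨hg t _ ht.ge, hcase⟩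
        · have hgb := hg n₂ _ hβ'
          rw [map_sub, map_one, map_sub, map_one] at hgb
          exact Or.inr ⟨N * n₂, Nat.mul_pos hNpos hn₂, hgb, by push_cast; linarith⟩)
    refine ⟨V, ?_⟩
    rw [map_mul, map_mul, map_pow, map_pow]
    refine int_le_mono hV (le_of_eq ?_)
    -- Since α' is close to 1 it is a unit, so the valuation of α'β^p comes from β^p alone.
    have hval : vn p k Ω (n + 1) (α' * β ^ p) = ((p * t : ℕ) : ℤ) := by
      have hα'0 : vn p k Ω (n + 1) α' = 0 := by
        have h1 : vn p k Ω (n + 1) 1 < vn p k Ω (n + 1) (α' - 1) := by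
          rw [AddValuation.map_one]
          exact lt_of_lt_of_le (by exact_mod_cast hn₁) hα'
        have h2 := (vn p k Ω (n + 1)).map_add_eq_of_lt_left h1
        rwa [add_sub_cancel, AddValuation.map_one] at h2
      rw [AddValuation.map_mul, hα'0, zero_add, map_pow_coe _ ht]
      push_cast
      rfl
    have hst : s = p * t := by
      rw [hs] at hval
      exact_mod_cast hval
    rw [hst]
    push_cast
    ring
  refine algEquiv_root_eq hw he hε hξc (x := g x) (a := g (f (α' * β ^ p))) ?_ ?_ hV hh
    (hfix _ hα) (hunity (Nat.add_le_add_right hcm 1))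
  · rw [← map_pow, hx]
  · rw [val_algEquiv hv, hvα]

end CyclotomicRoots

/-! ### The conductor bound -/

section GroupTheory

open IntermediateField

/-- The fixed field of a normal subgroup is normal over K, so once it contains F it contains the
normal closure. -/
theorem eq_one_of_fixes_of_normal {K Ω : Type*} [Field K] [CharZero K] [Field Ω] [Algebra K Ω]
    [Normal K Ω] (F : IntermediateField K Ω) [FiniteDimensional K (normalClosure K F Ω)]
    {G : Subgroup (normalClosure K F Ω ≃ₐ[K] normalClosure K F Ω)} (hn : G.Normal)
    (hG : F ≤ lift (fixedField G))
    {h : normalClosure K F Ω ≃ₐ[K] normalClosure K F Ω} (hh : h ∈ G) : h = 1 := by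
  have : IsGalois K (normalClosure K F Ω) := {}
  have hnor : Normal K (lift (fixedField G)) :=
    Normal.of_algEquiv (liftAlgEquiv (fixedField G))
  have hle' := normalClosure_le_iff_of_normal.2 hG
  ext y
  have hy : y ∈ fixedField G := (mem_lift y).1 (hle' y.2)
  exact congrArg Subtype.val (hy ⟨h, hh⟩)

variable {p : ℕ} [hp : Fact p.Prime] {k : Type*} [Field k] [CharP k p] [IsAlgClosed k]
  {L : Type*} [Field L] [Algebra (K₀ p k) L] [FiniteDimensional (K₀ p k) L]
  {v : AddValuation L (WithTop ℤ)} (hv : IsNormalizedVal p k v) {π : L} (hπ : v π = 1)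

include hv hπ

/-- The ramification groups are normal subgroups. -/
theorem exists_subgroup_val_le (i₀ : WithTop ℤ) : ∃ G : Subgroup (L ≃ₐ[K₀ p k] L), G.Normal ∧
    ∀ h, h ∈ G ↔ i₀ ≤ v (h π - π) := by
  have hconj : ∀ (g : L ≃ₐ[K₀ p k] L) {h : L ≃ₐ[K₀ p k] L}, i₀ ≤ v (h π - π) →
      i₀ ≤ v (h (g π) - g π) := fun g h hh =>
    hh.trans (val_uniformizer_sub_le hv hπ h (by rw [val_algEquiv hv, hπ]; exact zero_le_one))
  refine ⟨⟨⟨⟨{h | i₀ ≤ v (h π - π)}, ?_⟩, ?_⟩, ?_⟩, ⟨?_⟩, fun h => Iff.rfl⟩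
  · intro g h hg hh
    have h1 : (g * h) π - π = (g (h π) - h π) + (h π - π) := by
      rw [AlgEquiv.mul_apply]; ring
    change i₀ ≤ v ((g * h) π - π)
    rw [h1]
    exact v.map_le_add (hconj h hg) hh
  · simp
  · intro g hg
    have h1 : g (g⁻¹ π - π) = -(g π - π) := by
      rw [map_sub, ← AlgEquiv.mul_apply, mul_inv_cancel, AlgEquiv.one_apply]; ring
    change i₀ ≤ v (g⁻¹ π - π)
    rw [← val_algEquiv hv g, h1, v.map_neg]
    exact hg
  · intro h hh g
    have h1 : (g * h * g⁻¹) π - π = g (h (g⁻¹ π) - g⁻¹ π) := by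
      rw [map_sub, AlgEquiv.mul_apply, AlgEquiv.mul_apply, ← AlgEquiv.mul_apply g g⁻¹,
        mul_inv_cancel, AlgEquiv.one_apply]
    change i₀ ≤ v ((g * h * g⁻¹) π - π)
    rw [h1, val_algEquiv hv]
    exact hconj g⁻¹ hh

end GroupTheory

/-! ### From the ramification estimate to the conductor inequality -/

section Bound

variable {p : ℕ} [hp : Fact p.Prime] {k : Type*} [Field k] [CharP k p] [IsAlgClosed k]
  (Ω : Type*) [Field Ω] [Algebra (K₀ p k) Ω]

omit hp in
-- Clears denominators by multiplying with e = p^n(p - 1)N.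
theorem lt_of_boundTerm_le (hp : p.Prime) {n : ℕ} {b B : ℝ} {a : ℤ}
    (h : boundTerm p (n + 1) b (a : WithTop ℤ) ≤ (B : WithBot ℝ)) {e N : ℕ}
    (hN : (p ^ n * (p - 1) : ℝ) * N = e) {D : ℤ} (hD : (B + 1) * e < D) :
    (b + 1) * e - N * (a - 1) < D := by
  have h1 : b - ((a : ℝ) - 1) / ((p : ℝ) ^ n * ((p : ℝ) - 1)) ≤ B := by
    have : boundTerm p (n + 1) b (a : WithTop ℤ) =
      ((b - ((a : ℝ) - 1) / ((p : ℝ) ^ (n + 1 - 1) * ((p : ℝ) - 1)) : ℝ) : WithBot ℝ) := rfl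
    rw [this, WithBot.coe_le_coe] at h
    simpa using h
  have hq : (0 : ℝ) < (p : ℝ) ^ n * ((p : ℝ) - 1) := by
    have : (2 : ℝ) ≤ p := by exact_mod_cast hp.two_le
    have : (0 : ℝ) < p - 1 := by linarith
    positivity
  have h2 : (b + 1) * e - N * (a - 1) =
      (b - ((a : ℝ) - 1) / ((p : ℝ) ^ n * ((p : ℝ) - 1)) + 1) * e := by
    rw [← hN]
    have h3 : ((a : ℝ) - 1) / ((p : ℝ) ^ n * ((p : ℝ) - 1)) * ((p : ℝ) ^ n * ((p : ℝ) - 1)) = a - 1 :=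
      div_mul_cancel₀ _ hq.ne'
    linear_combination (N : ℝ) * h3
  rw [h2]
  refine lt_of_le_of_lt ?_ hD
  gcongr

/-- A `ℕ`-valued lower bound for `V ∈ ℤ ∪ {∞}` that is large if `V = ∞`. -/
theorem exists_nat_le_of_pos {V : WithTop ℤ} (hV : 1 ≤ V) {N : ℕ} (hN : 0 < N) {T : ℤ}
    (h : ∀ a : ℤ, V = a → T ≤ N * a) :
    ∃ n : ℕ, 1 ≤ n ∧ ((n : ℤ) : WithTop ℤ) ≤ V ∧ T ≤ N * n := by
  rcases V with _ | a
  · refine ⟨T.toNat + 1, by omega, le_top, ?_⟩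
    have h1 := Int.self_le_toNat T
    have h2 : (1 : ℤ) ≤ N := by exact_mod_cast hN
    push_cast
    nlinarith [(T.toNat.cast_nonneg : (0 : ℤ) ≤ T.toNat)]
  · have ha : 1 ≤ a := by
      change ((1 : ℤ) : WithTop ℤ) ≤ (a : WithTop ℤ) at hV
      exact_mod_cast hV
    obtain ⟨m, rfl⟩ := Int.eq_ofNat_of_zero_le (show 0 ≤ a by omega)
    exact ⟨m, by omega, le_rfl, h _ rfl⟩

/-- Indices are shifted by one: n + 1, c + 1 and m + 1 stand for ℓ, the exponent of the root and
max(ℓ, c). If the conductor were larger than B, the last nontrivial ramification subgroup would fix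
the roots of unity and x, hence everything. -/
theorem conductor_galoisClosure_le [IsAlgClosed Ω] [Algebra.IsAlgebraic (K₀ p k) Ω] (n c : ℕ)
    (α' β : Kn p k Ω (n + 1)) (hα : 0 ≤ vn p k Ω (n + 1) (α' * β ^ p))
    (hβ : 0 ≤ vn p k Ω (n + 1) β) {x : Ω} (hx : x ^ p ^ (c + 1) = ((α' * β ^ p : Kn p k Ω (n + 1)) : Ω))
    {m : ℕ} (hnm : n ≤ m) (hcm : c ≤ m) {B : ℝ} (hB : (m : ℝ) ≤ B)
    (hα' : boundTerm p (n + 1) (c + n + 1) (vn p k Ω (n + 1) (α' - 1)) ≤ (B : WithBot ℝ))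
    (hβ' : boundTerm p (n + 1) (c + n) (vn p k Ω (n + 1) (β - 1)) ≤ (B : WithBot ℝ)) :
    conductor (K₀ p k) (normVal p k (galoisClosure p k Ω (m + 1) x)) ≤ B := by
  by_contra! hcond
  have := charZero_K₀ p k
  have : IsAlgClosure (K₀ p k) Ω := ⟨inferInstance, inferInstance⟩
  have : Normal (K₀ p k) Ω := IsAlgClosure.normal (K₀ p k) Ω
  have : Normal (K₀ p k) (galoisClosure p k Ω (m + 1) x) := normalClosure.normal _ _ _
  have : IsGalois (K₀ p k) (galoisClosure p k Ω (m + 1) x) := {}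
  set v := normVal p k (galoisClosure p k Ω (m + 1) x) with hvdef
  have hv : IsNormalizedVal p k v := (exists_isNormalizedVal p k _).choose_spec
  obtain ⟨π, hπ⟩ := exists_uniformizer hv
  obtain ⟨i₀, D, hi₀, ⟨g₀, hg₀1, hg₀⟩, hD, hBD⟩ :=
    exists_ramification_of_lt_conductor hv hπ ((Nat.cast_nonneg m).trans hB) hcond
  obtain ⟨e, he1, he⟩ := exists_val_p hv
  rw [IsGalois.card_aut_eq_finrank, finrank_eq_of_val_p hv he] at hBD
  have hw := isGenericPoint_discVal hv hπ hi₀ hD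
  obtain ⟨G, hGn, hG⟩ := exists_subgroup_val_le hv hπ (i₀ : WithTop ℤ)
  have hle : KnAdjoin p k Ω (m + 1) x ≤ galoisClosure p k Ω (m + 1) x :=
    IntermediateField.le_normalClosure _
  -- the roots of unity
  obtain ⟨ξ', hξ'⟩ := exists_primitiveRoot_Kn (p := p) (k := k) Ω (m + 1)
  have hξ'' : IsPrimitiveRoot (ξ' : Ω) (p ^ (m + 1)) :=
    hξ'.map_of_injective (f := algebraMap (Kn p k Ω (m + 1)) Ω)
      (algebraMap (Kn p k Ω (m + 1)) Ω).injective
  have hKm : Kn p k Ω (m + 1) ≤ galoisClosure p k Ω (m + 1) x := le_sup_left.trans hle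
  have hxm : x ∈ galoisClosure p k Ω (m + 1) x :=
    hle ((le_sup_right : _ ≤ KnAdjoin p k Ω (m + 1) x)
      (IntermediateField.mem_adjoin_simple_self _ x))
  set ξ : galoisClosure p k Ω (m + 1) x := IntermediateField.inclusion hKm ξ' with hξdef
  have hξ : IsPrimitiveRoot ξ (p ^ (m + 1)) :=
    hξ'.map_of_injective (f := IntermediateField.inclusion hKm)
      (IntermediateField.inclusion_injective hKm)
  have hKn : Kn p k Ω (n + 1) ≤ galoisClosure p k Ω (m + 1) x := by
    refine le_trans ?_ hKm
    refine IntermediateField.adjoin_le_iff.2 fun η hη => IntermediateField.subset_adjoin _ _ ?_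
    change η ^ p ^ (m + 1) = 1
    rw [← Nat.add_sub_cancel' (Nat.add_le_add_right hnm 1), pow_add, pow_mul, show _ = _ from hη,
      one_pow]
  set f := IntermediateField.inclusion hKn with hf
  obtain ⟨ζ, hζ⟩ := exists_primitiveRoot_Kn (p := p) (k := k) Ω (n + 1)
  have hfζ : IsPrimitiveRoot (f ζ) (p ^ (n + 1)) :=
    hζ.map_of_injective (f := f) (IntermediateField.inclusion_injective hKn)
  obtain ⟨N, hN, hNe⟩ := val_primitiveRoot_sub_one v hfζ he
  have hp2 : (2 : ℤ) ≤ p := by exact_mod_cast hp.out.two_le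
  have hpn : (1 : ℤ) ≤ (p ^ n : ℕ) := by exact_mod_cast Nat.one_le_pow _ _ hp.out.pos
  push_cast at hpn
  have he1' : (1 : ℤ) ≤ e := by exact_mod_cast he1
  have hN1 : 1 ≤ N := by
    by_contra hneg
    have h1 : (0 : ℤ) ≤ p ^ n * (p - 1) := mul_nonneg (by linarith) (by linarith)
    nlinarith
  obtain ⟨N, rfl⟩ := Int.eq_ofNat_of_zero_le (show 0 ≤ N by omega)
  have hNpos : 0 < N := by omega
  set ε : ℤ := (p ^ n : ℕ) * N with hεdef
  have hε : (p - 1 : ℤ) * ε = e := by rw [← hNe, hεdef]; push_cast; ring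
  have hNeR : (p ^ n * (p - 1) : ℝ) * N = e := by exact_mod_cast hNe
  have hmD : (m + 1) * e < D := by
    have : ((m : ℝ) + 1) * e < D := lt_of_le_of_lt (by gcongr) hBD
    exact_mod_cast this
  have hunity : ∀ h ∈ G, ∀ η : galoisClosure p k Ω (m + 1) x, η ^ p ^ (m + 1) = 1 → h η = η :=
    fun h hh η hη => algEquiv_primitiveRoot_eq hw he hε hv hπ hξ hmD ((hG h).1 hh) hη
  have hroot : ∃ g : galoisClosure p k Ω (m + 1) x ≃ₐ[K₀ p k] galoisClosure p k Ω (m + 1) x,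
      ∀ h ∈ G, h (g ⟨x, hxm⟩) = g ⟨x, hxm⟩ := by
    -- For α = 0 the root is x = 0, and no valuation argument is available or needed.
    by_cases hα0 : α' * β ^ p = 0
    · have hx0 : x = 0 := by
        rw [hα0] at hx
        exact pow_eq_zero_iff (pow_pos hp.out.pos _).ne' |>.1 hx
      refine ⟨1, fun h _ => ?_⟩
      have : (⟨x, hxm⟩ : galoisClosure p k Ω (m + 1) x) = 0 := Subtype.ext hx0
      rw [this, map_zero, map_zero]
    · have key₁ : ∀ a : ℤ, vn p k Ω (n + 1) (α' - 1) = a →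
          (c + n + 2) * e - N * (a - 1) < D := by
        intro a ha
        rw [ha] at hα'
        have := lt_of_boundTerm_le hp.out hα' hNeR hBD
        rify
        linarith
      have key₂ : ∀ a : ℤ, vn p k Ω (n + 1) (β - 1) = a →
          (c + n + 1) * e - N * (a - 1) < D := by
        intro a ha
        rw [ha] at hβ'
        have := lt_of_boundTerm_le hp.out hβ' hNeR hBD
        rify
        linarith
      have hN1' : (1 : ℤ) ≤ N := hN1
      have hbranch : ∀ z : Kn p k Ω (n + 1), 1 ≤ vn p k Ω (n + 1) (z - 1) ∨
          ∃ a : ℤ, a ≤ 0 ∧ vn p k Ω (n + 1) (z - 1) = a := by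
        intro z
        rcases h : vn p k Ω (n + 1) (z - 1) with _ | a
        · exact Or.inl le_top
        · rcases le_or_gt a 0 with h0 | h0
          · exact Or.inr ⟨a, h0, rfl⟩
          · refine Or.inl ?_
            change ((1 : ℤ) : WithTop ℤ) ≤ (a : WithTop ℤ)
            exact_mod_cast h0
      -- These are `key₁` and `key₂` rewritten with κ = D - (n + 1)e + ε - N. If v(α' - 1) ≤ 0 or
      -- v(β - 1) ≤ 0, the inequality already holds without the corresponding gain.
      have hcase : (c + 1) * e + ε + 1 ≤ D - (n + 1) * e + ε - N ∨ ∃ n₁ : ℕ, 1 ≤ n₁ ∧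
          ((n₁ : ℤ) : WithTop ℤ) ≤ vn p k Ω (n + 1) (α' - 1) ∧
          (c + 1) * e + ε + 1 ≤ D - (n + 1) * e + ε - N + N * n₁ ∧
          ((c + 1) * e + ε + 1 ≤ D - (n + 1) * e + ε - N + e ∨ ∃ n₂ : ℕ, 1 ≤ n₂ ∧
            ((n₂ : ℤ) : WithTop ℤ) ≤ vn p k Ω (n + 1) (β - 1) ∧
            (c + 1) * e + ε + 1 ≤ D - (n + 1) * e + ε - N + e + N * n₂) := by
        rcases hbranch α' with h1 | ⟨a, ha0, ha⟩
        · obtain ⟨n₁, hn₁, hn₁', hT⟩ := exists_nat_le_of_pos h1 hNpos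
            (T := (c + 1) * e + ε + 1 - (D - (n + 1) * e + ε - N))
            (fun a ha => by linarith [key₁ a ha])
          refine Or.inr ⟨n₁, hn₁, hn₁', by linarith, ?_⟩
          rcases hbranch β with h2 | ⟨b, hb0, hb⟩
          · obtain ⟨n₂, hn₂, hn₂', hT'⟩ := exists_nat_le_of_pos h2 hNpos
              (T := (c + 1) * e + ε + 1 - (D - (n + 1) * e + ε - N) - e)
              (fun a ha => by linarith [key₂ a ha])
            exact Or.inr ⟨n₂, hn₂, hn₂', by linarith⟩
          · have := key₂ b hb
            exact Or.inl (by nlinarith)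
        · have := key₁ a ha
          exact Or.inl (by nlinarith)
      obtain ⟨g, hg⟩ := exists_algEquiv_root_fixed hv hπ hw he hε hζ f hN hεdef hnm hcm hξ hmD
        hα hα0 hβ rfl hcase (x := ⟨x, hxm⟩) (Subtype.ext hx)
      exact ⟨g, fun h hh => hg h ((hG h).1 hh)⟩
  obtain ⟨g, hg⟩ := hroot
  -- Normality of G transfers the statement from the conjugate g x to x.
  have hxfix : ∀ h ∈ G, h ⟨x, hxm⟩ = ⟨x, hxm⟩ := by
    intro h hh
    have h1 := hg _ (hGn.conj_mem h hh g)
    rw [AlgEquiv.mul_apply, AlgEquiv.mul_apply, ← AlgEquiv.mul_apply g⁻¹, inv_mul_cancel,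
      AlgEquiv.one_apply] at h1
    exact g.injective h1
  have hlift : ∀ y : galoisClosure p k Ω (m + 1) x, (∀ h ∈ G, h y = y) →
      (y : Ω) ∈ IntermediateField.lift (IntermediateField.fixedField G) :=
    fun y hy => (IntermediateField.mem_lift y).2 fun h => hy h h.2
  refine hg₀1 (eq_one_of_fixes_of_normal (K := K₀ p k) (KnAdjoin p k Ω (m + 1) x) hGn (sup_le ?_ ?_)
    ((hG g₀).2 hg₀.ge))
  · refine IntermediateField.adjoin_le_iff.2 fun η hη => ?_
    exact hlift ⟨η, hKm (IntermediateField.subset_adjoin _ _ hη)⟩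
      fun h hh => hunity h hh _ (Subtype.ext hη)
  · exact IntermediateField.adjoin_simple_le_iff.2 (hlift ⟨x, hxm⟩ hxfix)

end Bound

/-! ### Existence of `p`-primitive representatives -/

section Primitive

variable {p : ℕ} [hp : Fact p.Prime] {k : Type*} [Field k] [CharP k p] [IsAlgClosed k]

/-- The residue field k is closed under p-th roots. -/
theorem exists_pow_residue {L : Type*} [Field L] [Algebra (K₀ p k) L]
    [Algebra.IsAlgebraic (K₀ p k) L] {v : AddValuation L (WithTop ℤ)} (hv : IsNormalizedVal p k v)
    {u : L} (hu : 0 ≤ v u) :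
    ∃ r : WittVector p k, ((1 : ℤ) : WithTop ℤ) ≤ v (u - ofWitt p k L r ^ p) := by
  obtain ⟨a, ha⟩ := exists_residue hv hu
  obtain ⟨b, hb⟩ := IsAlgClosed.exists_pow_nat_eq (WittVector.constantCoeff a) hp.out.pos
  obtain ⟨r, hr⟩ := WittVector.constantCoeff_surjective p b
  refine ⟨r, ?_⟩
  have h1 : ((1 : ℤ) : WithTop ℤ) ≤ v (ofWitt p k L (a - r ^ p)) :=
    one_le_val_ofWitt hv (by rw [map_sub, map_pow, hr, hb, sub_self])
  have h2 : u - ofWitt p k L r ^ p = (u - ofWitt p k L a) + ofWitt p k L (a - r ^ p) := by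
    rw [map_sub, map_pow]; ring
  rw [h2]
  exact v.map_le_add ha h1

theorem le_val_one_add_pow {R : Type*} [CommRing R] (w : AddValuation R (WithTop ℤ))
    {e σ : ℤ} (he : (e : WithTop ℤ) ≤ w (p : R)) {y : R} (hy : (σ : WithTop ℤ) ≤ w y)
    (hσ : 0 ≤ σ) : ((e + σ : ℤ) : WithTop ℤ) ≤ w ((1 + y) ^ p - 1 - y ^ p) := by
  have h1 : (1 + y) ^ p - 1 - y ^ p =
      p * ∑ j ∈ Finset.Ioo 0 p, 1 ^ j * y ^ (p - j) * ((p.choose j / p : ℕ) : R) := by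
    rw [add_pow_prime_eq' hp.out]; ring
  rw [h1]
  refine le_map_mul w he (w.map_le_sum fun j hj => ?_)
  have hj' := Finset.mem_Ioo.1 hj
  rw [one_pow, one_mul]
  refine int_le_mono (le_map_mul w (le_map_pow w hy (p - j)) (b := 0)
    (map_natCast_nonneg w _)) ?_
  have : (1 : ℤ) ≤ (p - j : ℕ) := by omega
  nlinarith

variable {Ω : Type*} [Field Ω] [Algebra (K₀ p k) Ω] [IsAlgClosed Ω]
  [Algebra.IsAlgebraic (K₀ p k) Ω]

/-- Elements of `K_n` that are sufficiently close to `1` are `p`-th powers. -/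
theorem exists_pow_eq_one_add {n : ℕ} {t : Kn p k Ω (n + 1)}
    (ht : ((p ^ (n + 1) : ℕ) : ℤ) ≤ vn p k Ω (n + 1) t) :
    ∃ y : Kn p k Ω (n + 1), y ^ p = 1 + t := by
  have := charZero_K₀ p k
  have : IsAlgClosure (K₀ p k) Ω := ⟨inferInstance, inferInstance⟩
  have : Normal (K₀ p k) Ω := IsAlgClosure.normal (K₀ p k) Ω
  obtain ⟨x, hx⟩ := IsAlgClosed.exists_pow_nat_eq ((1 + t : Kn p k Ω (n + 1)) : Ω) hp.out.pos
  set M := galoisClosure p k Ω (n + 1) x with hM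
  have : Normal (K₀ p k) M := normalClosure.normal _ _ _
  have : IsGalois (K₀ p k) M := {}
  obtain ⟨v, hv⟩ := exists_isNormalizedVal p k M
  have hle : KnAdjoin p k Ω (n + 1) x ≤ M := IntermediateField.le_normalClosure _
  have hKn : Kn p k Ω (n + 1) ≤ M := le_sup_left.trans hle
  have hxm : x ∈ M := hle ((le_sup_right : _ ≤ KnAdjoin p k Ω (n + 1) x)
    (IntermediateField.mem_adjoin_simple_self _ x))
  set f := IntermediateField.inclusion hKn with hf
  obtain ⟨ζ, hζ⟩ := exists_primitiveRoot_Kn (p := p) (k := k) Ω (n + 1)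
  have hfζ : IsPrimitiveRoot (f ζ) (p ^ (n + 1)) :=
    hζ.map_of_injective (f := f) (IntermediateField.inclusion_injective hKn)
  obtain ⟨e, he1, he⟩ := exists_val_p hv
  obtain ⟨N, hN, hNe⟩ := val_primitiveRoot_sub_one v hfζ he
  have hξ : IsPrimitiveRoot (f ζ ^ p ^ n) p := hfζ.pow (pow_pos hp.out.pos _) (pow_succ p n)
  obtain ⟨ε, hε, hεe⟩ := val_primitiveRoot_sub_one (n := 0) v (by simpa using hξ) he
  rw [pow_zero, one_mul] at hεe
  have hp2 : (2 : ℤ) ≤ p := by exact_mod_cast hp.out.two_le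
  have hpn : (1 : ℤ) ≤ (p : ℤ) ^ n := by exact_mod_cast Nat.one_le_pow _ _ hp.out.pos
  have hεN : ε = p ^ n * N := by
    have h0 : (p - 1 : ℤ) ≠ 0 := by omega
    refine mul_left_cancel₀ h0 ?_
    rw [hεe, ← hNe]; ring
  have hN0 : 0 ≤ N := by
    by_contra hneg
    have h1 : (0 : ℤ) < p ^ n * (p - 1) := mul_pos (by linarith) (by linarith)
    have he0 : (0 : ℤ) ≤ e := e.cast_nonneg
    nlinarith
  obtain ⟨N, rfl⟩ := Int.eq_ofNat_of_zero_le hN0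
  have hvt : ((p ^ (n + 1) * N : ℕ) : ℤ) ≤ v (f t) := by
    obtain ⟨U, hU⟩ := exists_expansion hζ ht
    rw [hU, map_mul, map_pow, algHom_eval₂_ofWitt, map_sub, map_one]
    refine int_le_mono (le_map_mul v (map_pow_coe v hN (p ^ (n + 1))).ge (b := 0)
      (val_eval₂_nonneg v (val_ofWitt_nonneg hv) ?_ U)) (by push_cast; linarith)
    rw [hN]
    exact_mod_cast hN0
  set x' : M := ⟨x, hxm⟩ with hx'
  have hxp : x' ^ p = 1 + f t := by
    refine Subtype.ext (hx.trans ?_)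
    simp [hf]
  have hvt1 : 1 + f t ≠ 0 := by
    intro h
    have h1 : v (f t) = 0 := by
      rw [← v.map_neg, show -f t = 1 by linear_combination -h, v.map_one]
    rw [h1] at hvt
    have h2 : (0 : ℤ) < N := by
      have he1' : (1 : ℤ) ≤ e := by exact_mod_cast he1
      by_contra hneg
      have : (N : ℤ) = 0 := by omega
      rw [this, mul_zero] at hNe
      omega
    have h3 : 0 < p ^ (n + 1) * N := Nat.mul_pos (pow_pos hp.out.pos _) (by exact_mod_cast h2)
    have h4 : ((p ^ (n + 1) * N : ℕ) : ℤ) ≤ 0 := by exact_mod_cast hvt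
    omega
  have hx0 : x' ≠ 0 := by
    intro h
    rw [h, zero_pow hp.out.ne_zero] at hxp
    exact hvt1 hxp.symm
  obtain ⟨η, hη, r, hr, hbin⟩ := exists_root_close_to_one v hp.out.pos hξ hxp hx0 hvt
  -- The binomial term j = p gives pr ≥ p^(n+1) N = pε.
  have hεr : ε ≤ r := by
    have h1 := hbin p hp.out.one_le le_rfl
    rw [Nat.choose_self, Nat.cast_one, v.map_one, zero_add, WithTop.coe_le_coe] at h1
    push_cast at h1
    rw [hεN]
    refine le_of_mul_le_mul_left (a := (p : ℤ)) ?_ (by linarith)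
    rw [← mul_assoc, ← pow_succ']
    exact h1
  set y := η * x' with hy
  have hyp : y ^ p = 1 + f t := by rw [hy, mul_pow, hη, one_mul, hxp]
  have hy0 : y ≠ 0 := by
    intro h
    rw [h, zero_pow hp.out.ne_zero] at hyp
    exact hvt1 hyp.symm
  have hy1 : ((ε : ℤ) : WithTop ℤ) ≤ v (y - 1) := int_le_mono hr hεr
  set lam := f ζ ^ p ^ n - 1 with hlam
  have hlam0 : lam ≠ 0 := ne_zero_of_val_eq_coe hε
  -- In the borderline case y - 1 has valuation just ε. The residue of (y - 1)/λ comes from W(k) and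
  -- is fixed by σ, so σ y - y has valuation at least ε + 1, enough to force σ y = y.
  obtain ⟨a, ha⟩ := exists_residue hv (int_le_val_div (a := 0) (by simpa using hy1) hε)
  have hfix : ∀ σ : M ≃ₐ[K₀ p k] M, (∀ z, σ (f z) = f z) → σ y = y := by
    intro σ hσ
    have h1 : ((1 : ℤ) : WithTop ℤ) ≤ v (σ ((y - 1) / lam - ofWitt p k M a)) := by
      rwa [val_algEquiv hv]
    have h2 := le_map_mul v (v.map_le_sub h1 ha) hε.ge
    have hσl : σ lam = lam := by rw [hlam, map_sub, map_pow, hσ, map_one]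
    have h3 : (σ ((y - 1) / lam - ofWitt p k M a) - ((y - 1) / lam - ofWitt p k M a)) * lam =
        σ y - y := by
      rw [map_sub, algEquiv_ofWitt, map_div₀, hσl, map_sub, map_one]
      field_simp
      ring
    rw [h3] at h2
    have hσy : σ y ^ p = y ^ p := by
      rw [← map_pow, hyp, map_add, map_one, hσ]
    have hroot : (σ y / y) ^ p ^ 1 = 1 := by
      rw [pow_one, div_pow, hσy, div_self (pow_ne_zero p hy0)]
    have hvy : v y = 0 := by
      have h4 : y = 1 + (y - 1) := by ring
      have hε1 : v (1 : M) < v (y - 1) := by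
        rw [v.map_one]
        refine lt_of_lt_of_le ?_ hy1
        have he1' : (1 : ℤ) ≤ e := by exact_mod_cast he1
        have : 0 < ε := by
          by_contra hneg
          nlinarith
        exact_mod_cast this
      rw [h4, v.map_add_eq_of_lt_left hε1, v.map_one]
    have h5 := eq_one_of_val_sub_one v hroot he hεe (by
      have h6 : σ y - y = (σ y / y - 1) * y := by field_simp
      rw [h6, v.map_mul, hvy, add_zero] at h2
      exact int_le_mono h2 (by linarith))
    exact (div_eq_one_iff_eq hy0).1 h5
  have hmem : y ∈ IntermediateField.restrict hKn := by
    rw [← IsGalois.fixedField_fixingSubgroup (IntermediateField.restrict hKn)]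
    intro σ
    refine hfix σ fun z => σ.2 ⟨f z, ?_⟩
    exact (IntermediateField.mem_restrict hKn _).2 z.2
  refine ⟨⟨y, (IntermediateField.mem_restrict hKn y).1 hmem⟩, Subtype.ext ?_⟩
  have h7 := congrArg (Subtype.val : M → Ω) hyp
  simpa [hf] using h7

/-- Induction on the gap between v(z - 1) and p^(n+1) = pe/(p - 1). If p divides v(z - 1), dividing
by some (1 + y)^p raises this valuation; if not, z is p-primitive; when the gap closes, z is a p-th
power. -/
theorem exists_mul_pow_of_close (n : ℕ) (d : ℕ) {z : Kn p k Ω (n + 1)}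
    (hz1 : ((1 : ℤ) : WithTop ℤ) ≤ vn p k Ω (n + 1) (z - 1))
    (hz : (((p ^ (n + 1) : ℕ) - d : ℤ) : WithTop ℤ) ≤ vn p k Ω (n + 1) (z - 1)) :
    ∃ α' β : Kn p k Ω (n + 1), z = α' * β ^ p ∧
      (α' = 1 ∨ IsPPrimitive p (vn p k Ω (n + 1)) α') ∧ 0 ≤ vn p k Ω (n + 1) β := by
  set v := vn p k Ω (n + 1) with hvdef
  have hv : IsNormalizedVal p k v := vn_isNormalizedVal Ω (n + 1)
  have hp2 : (2 : ℤ) ≤ p := by exact_mod_cast hp.out.two_le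
  induction d generalizing z with
  | zero =>
    obtain ⟨y, hy⟩ := exists_pow_eq_one_add (t := z - 1) (by simpa using hz)
    have hyz : z = y ^ p := by rw [hy]; ring
    refine ⟨1, y, by rw [hyz, one_mul], Or.inl rfl, ?_⟩
    by_contra hneg
    have hz0 : v z = 0 := by
      have h1 : v (1 : Kn p k Ω (n + 1)) < v (z - 1) := by
        rw [v.map_one]
        exact lt_of_lt_of_le (by decide) hz1
      have h2 := v.map_add_eq_of_lt_left h1
      rwa [add_sub_cancel, v.map_one] at h2
    have hy0 : y ≠ 0 := by rintro rfl; simp at hneg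
    obtain ⟨m, hm⟩ := exists_val_eq_coe v hy0
    have h3 := map_pow_coe v hm p
    rw [← hyz, hz0] at h3
    rw [hm] at hneg
    norm_cast at h3 hneg
    nlinarith
  | succ d ih =>
    by_cases hd : (((p ^ (n + 1) : ℕ) - d : ℤ) : WithTop ℤ) ≤ v (z - 1)
    · exact ih hz1 hd
    have hz0 : z - 1 ≠ 0 := by
      intro h
      rw [h, v.map_zero] at hd
      exact hd le_top
    obtain ⟨m, hm⟩ := exists_val_eq_coe v hz0
    rw [hm] at hz1 hz hd
    norm_cast at hz1
    rw [WithTop.coe_le_coe] at hz hd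
    push_cast at hz hd
    have hmlt : m < p ^ (n + 1) := by omega
    obtain ⟨ζ, hζ⟩ := exists_primitiveRoot_Kn (p := p) (k := k) Ω (n + 1)
    have hπ := vn_primitiveRoot_sub_one hζ
    have he := vn_p hζ
    rw [← hvdef] at hπ he
    by_cases hpm : (p : ℤ) ∣ m
    · obtain ⟨m', rfl⟩ := hpm
      have hm'0 : 0 < m' := by
        by_contra hneg
        nlinarith
      obtain ⟨m', rfl⟩ := Int.eq_ofNat_of_zero_le hm'0.le
      have hm'lt : (m' : ℤ) < p ^ n := by
        rw [pow_succ'] at hmlt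
        exact lt_of_mul_lt_mul_left hmlt (by linarith)
      set π := ζ - 1 with hπdef
      have hπ0 : π ≠ 0 := ne_zero_of_val_eq_coe (n := 1) hπ
      have hπm : v (π ^ m') = ((m' : ℤ) : WithTop ℤ) := by simpa using map_pow_coe v (a := 1) hπ m'
      have hπpm := map_pow_coe v hπm p
      obtain ⟨r, hr⟩ := exists_pow_residue hv
        (int_le_val_div (a := 0) (by rw [zero_add]; exact hm.ge) hπpm)
      set y := π ^ m' * ofWitt p k _ r with hy
      have hvy : ((m' : ℤ) : WithTop ℤ) ≤ v y := by
        refine int_le_mono (le_map_mul v hπm.ge (b := 0) (val_ofWitt_nonneg hv r)) (by simp)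
      have h1 := le_val_one_add_pow v he.ge hvy hm'0.le
      have h2 := le_map_mul v hr hπpm.ge
      -- y^p has the same leading term as z - 1, so (1 + y)^p cancels it. The mixed terms have
      -- valuation at least e + m', which exceeds pm' because m' < p^n and e = p^n(p - 1).
      have h3 : ((p * m' + 1 : ℤ) : WithTop ℤ) ≤ v (z - (1 + y) ^ p) := by
        have h4 : z - (1 + y) ^ p = ((z - 1) / (π ^ m') ^ p - ofWitt p k _ r ^ p) * (π ^ m') ^ p -
            ((1 + y) ^ p - 1 - y ^ p) := by
          rw [hy, mul_pow]
          field_simp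
          ring
        rw [h4]
        refine v.map_le_sub (int_le_mono h2 (by linarith)) (int_le_mono h1 ?_)
        rw [Nat.cast_mul, Nat.cast_sub hp.out.one_le]
        push_cast
        nlinarith
      have hs : v (1 + y) = 0 := by
        have h5 : v (1 : Kn p k Ω (n + 1)) < v y := by
          rw [v.map_one]
          exact lt_of_lt_of_le (by exact_mod_cast hm'0) hvy
        rw [v.map_add_eq_of_lt_left h5, v.map_one]
      have hs0 : 1 + y ≠ 0 := ne_zero_of_val_eq_coe (n := 0) hs
      have hsp := map_pow_coe v (a := 0) hs p
      have h6 : ((p * m' + 1 : ℤ) : WithTop ℤ) ≤ v (z / (1 + y) ^ p - 1) := by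
        have h7 : z / (1 + y) ^ p - 1 = (z - (1 + y) ^ p) / (1 + y) ^ p := by field_simp
        rw [h7]
        exact int_le_val_div (by simpa using h3) hsp
      obtain ⟨α', β, hz', hα', hβ⟩ := ih (z := z / (1 + y) ^ p) (int_le_mono h6 (by nlinarith))
        (int_le_mono h6 (by push_cast; linarith))
      refine ⟨α', β * (1 + y), ?_, hα', by rw [v.map_mul, hs, add_zero]; exact hβ⟩
      rw [mul_pow, ← mul_assoc, ← hz']
      field_simp
    · refine ⟨z, 1, by simp, Or.inr (Or.inr ⟨m, _, hm, he, by omega, ?_, hpm⟩), by simp⟩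
      have h1 : (m : ℝ) < p ^ (n + 1) := by exact_mod_cast hmlt
      have h2 : (0 : ℝ) < p - 1 := by
        have : (2 : ℝ) ≤ p := by exact_mod_cast hp.out.two_le
        linarith
      -- The threshold pe/(p - 1) is exactly p^(n+1).
      refine lt_of_lt_of_eq h1 ?_
      rw [Int.cast_natCast, Nat.cast_mul, Nat.cast_sub hp.out.one_le]
      push_cast
      field_simp
      ring

/-- Every integral element of `K_n` is a `p`-primitive element, up to a `p`-th power. -/
theorem exists_mul_pow (n : ℕ) {α : Kn p k Ω (n + 1)} (hα : 0 ≤ vn p k Ω (n + 1) α) :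
    ∃ α' β : Kn p k Ω (n + 1), α = α' * β ^ p ∧
      (α' = 1 ∨ IsPPrimitive p (vn p k Ω (n + 1)) α') ∧ 0 ≤ vn p k Ω (n + 1) β := by
  set v := vn p k Ω (n + 1) with hvdef
  have hv : IsNormalizedVal p k v := vn_isNormalizedVal Ω (n + 1)
  have hp0 : (0 : ℤ) < p := by exact_mod_cast hp.out.pos
  by_cases hα0 : α = 0
  · exact ⟨1, 0, by simp [hα0, hp.out.ne_zero], Or.inl rfl, by simp⟩
  obtain ⟨a, ha⟩ := exists_val_eq_coe v hα0
  by_cases hpa : (p : ℤ) ∣ a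
  swap
  · exact ⟨α, 1, by simp, Or.inr (Or.inl ⟨a, ha, hpa⟩), by simp⟩
  obtain ⟨s, rfl⟩ := hpa
  have hs0 : 0 ≤ s := by
    rw [ha] at hα
    have h1 : 0 ≤ (p : ℤ) * s := by exact_mod_cast hα
    exact nonneg_of_mul_nonneg_right h1 hp0
  obtain ⟨s, rfl⟩ := Int.eq_ofNat_of_zero_le hs0
  obtain ⟨π, hπ⟩ := exists_uniformizer hv
  have hπ0 : π ≠ 0 := ne_zero_of_val_eq_coe (n := 1) hπ
  have hπs : v (π ^ s) = ((s : ℤ) : WithTop ℤ) := by simpa using map_pow_coe v (a := 1) hπ s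
  have hπps := map_pow_coe v hπs p
  have hu : v (α / (π ^ s) ^ p) = ((0 : ℤ) : WithTop ℤ) := by
    rw [map_div_coe ha hπps, sub_self]
  obtain ⟨r, hr⟩ := exists_pow_residue hv hu.ge
  set ρ := ofWitt p k (Kn p k Ω (n + 1)) r with hρ
  have hρp : v (ρ ^ p) = ((0 : ℤ) : WithTop ℤ) := by
    have h1 : ρ ^ p = α / (π ^ s) ^ p - (α / (π ^ s) ^ p - ρ ^ p) := by ring
    rw [h1, v.map_sub_eq_of_lt_left, hu]
    rw [hu]
    exact lt_of_lt_of_le (by decide) hr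
  have hρ0 : ρ ≠ 0 := by
    intro h
    rw [h, zero_pow hp.out.ne_zero] at hρp
    exact ne_zero_of_val_eq_coe hρp rfl
  -- Removing a power of π and a p-th root of the leading residue leaves a unit congruent to 1.
  set z := α / (π ^ s * ρ) ^ p with hz
  have hz1 : ((1 : ℤ) : WithTop ℤ) ≤ v (z - 1) := by
    have h1 : z - 1 = (α / (π ^ s) ^ p - ρ ^ p) / ρ ^ p := by
      rw [hz, mul_pow]; field_simp
    rw [h1]
    exact int_le_val_div (by simpa using hr) hρp
  obtain ⟨α', β, hzβ, hα', hβ⟩ := exists_mul_pow_of_close n (p ^ (n + 1)) hz1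
    (int_le_mono hz1 (by simp))
  refine ⟨α', β * (π ^ s * ρ), ?_, hα', ?_⟩
  · rw [mul_pow, ← mul_assoc, ← hzβ, hz]
    field_simp
  · rw [v.map_mul, v.map_mul]
    refine add_nonneg hβ (add_nonneg ?_ (val_ofWitt_nonneg hv r))
    rw [hπs]
    exact_mod_cast hs0

end Primitive
end WittKummer

/-! ### Assembly of the decomposition and the bound -/

theorem corollary4p3 (p : ℕ) [Fact p.Prime] (k : Type*) [Field k] [CharP k p] [IsAlgClosed k]
    (Ω : Type*) [Field Ω] [Algebra (WittKummer.K₀ p k) Ω] [IsAlgClosed Ω]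
    [Algebra.IsAlgebraic (WittKummer.K₀ p k) Ω]
    (ℓ c : ℕ) (hℓ : 1 ≤ ℓ) (hc : 1 ≤ c)
    (α : WittKummer.Kn p k Ω ℓ) (hα : 0 ≤ WittKummer.vn p k Ω ℓ α) :
    (∃ α' β : WittKummer.Kn p k Ω ℓ, α = α' * β ^ p ∧
      (α' = 1 ∨ WittKummer.IsPPrimitive p (WittKummer.vn p k Ω ℓ) α') ∧
      0 ≤ WittKummer.vn p k Ω ℓ β) ∧
    ∀ α' β : WittKummer.Kn p k Ω ℓ, α = α' * β ^ p →
      (α' = 1 ∨ WittKummer.IsPPrimitive p (WittKummer.vn p k Ω ℓ) α') →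
      0 ≤ WittKummer.vn p k Ω ℓ β →
      ∀ x : Ω, x ^ p ^ c = (α : Ω) →
      ((WittKummer.conductor (WittKummer.K₀ p k)
          (WittKummer.normVal p k (WittKummer.galoisClosure p k Ω (max ℓ c) x)) : ℝ) :
            WithBot ℝ) ≤
        max (((max ℓ c : ℝ) - 1 : ℝ) : WithBot ℝ)
          (max (WittKummer.boundTerm p ℓ ((c : ℝ) + ℓ - 1) (WittKummer.vn p k Ω ℓ (α' - 1)))
            (WittKummer.boundTerm p ℓ ((c : ℝ) + ℓ - 2) (WittKummer.vn p k Ω ℓ (β - 1)))) := by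
  obtain ⟨n, rfl⟩ : ∃ n, ℓ = n + 1 := ⟨ℓ - 1, by omega⟩
  obtain ⟨c, rfl⟩ : ∃ c', c = c' + 1 := ⟨c - 1, by omega⟩
  refine ⟨WittKummer.exists_mul_pow n hα, ?_⟩
  rintro α' β rfl - hβ x hx
  have hmax : max (n + 1) (c + 1) = max n c + 1 := (Nat.succ_max_succ n c)
  have hm : (max (n + 1 : ℕ) (c + 1 : ℕ) : ℝ) - 1 = (max n c : ℕ) := by
    rw [← Nat.cast_max, hmax]; push_cast; ring
  rw [hm, hmax]
  have h₁ : ((c + 1 : ℕ) : ℝ) + (n + 1 : ℕ) - 1 = c + n + 1 := by push_cast; ring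
  have h₂ : ((c + 1 : ℕ) : ℝ) + (n + 1 : ℕ) - 2 = c + n := by push_cast; ring
  rw [h₁, h₂]
  set b₁ := WittKummer.boundTerm p (n + 1) (c + n + 1) (WittKummer.vn p k Ω (n + 1) (α' - 1))
  set b₂ := WittKummer.boundTerm p (n + 1) (c + n) (WittKummer.vn p k Ω (n + 1) (β - 1))
  -- The first term is real, so the maximum is not -∞ even if both other terms are.
  obtain ⟨B, hB⟩ := WithBot.ne_bot_iff_exists.1 (ne_bot_of_le_ne_bot WithBot.coe_ne_bot
    (le_max_left (((max n c : ℕ) : ℝ) : WithBot ℝ) (max b₁ b₂)))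
  rw [← hB, WithBot.coe_le_coe]
  refine WittKummer.conductor_galoisClosure_le Ω n c α' β hα hβ hx (le_max_left n c)
    (le_max_right n c) ?_ ?_ ?_
  · rw [← WithBot.coe_le_coe, hB]
    exact le_max_left _ _
  · rw [hB]
    exact (le_max_left _ _).trans (le_max_right _ _)
  · rw [hB]
    exact (le_max_right _ _).trans (le_max_right _ _)
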